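/- Let $C$ be an irreducible non-singular affine algebraic curve over $\mathbb R$ with coordinate ring $A=\mathbb R[C]$, and let $V\subset A$ be a linear subspace of dimension $n+1$, $n\ge 0$. Let $\xi\in C(\mathbb R)$, and let $t\in A$ be such that the maximal ideal of $A$ at $\xi$ is generated by $t$ and the module $\Omega_{A/\mathbb R}$ of Kähler differentials is freely generated by $dt$. By a closed interval on the positive side of $\xi$ we mean a compact connected set $J\subset C(\mathbb R)$ with $\xi\in J$ and $|J|>1$ on which $u\ge 0$ for some local uniformizer $u\in A$ at $\xi$ with $\frac{u}{t}(\xi)>0$. For a real closed field $R\supset\mathbb R$ let $S_R\subset C(R)$ denote the base field extension of a semialgebraic set $S\subset C(\mathbb R)$ (the set defined in $C(R)$ by the same polynomial inequalities), put $V_R=V\otimes R$, and let $$(P_{V,S})_R=\{g\in V_R\colon g\ge 0\text{ on }S_R\}.$$ Then there is a closed interval $J$ on the positive side of $\xi$ such that the following holds for every closed interval $S\subset J$ on the positive side of $\xi$, every real closed field $R\supset\mathbb R$ and every $f\in V_R$: If $f$ spans an extreme ray of the cone $(P_{V,S})_R$ and $f$ does not vanish at the two boundary points of $S$, then $f$ has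 only finitely many zeros in $S_R$, and their number, counted with multiplicities, is exactly $n$. Moreover, $n$ is even whenever such an $f$ exists. -/

import Mathlib

open scoped TensorProduct

noncomputable section

namespace AffineCurve

universe u v

/-! Throughout, `A` is the affine coordinate ring of an affine variety `C` over `ℝ`, and for a field
`R` containing `ℝ` the set `C(R)` of `R`-rational points is the set `A →ₐ[ℝ] R` of
`ℝ`-algebra homomorphisms. The value at a point `η` of a function `a` is `η a`. -/

section Points

variable {A : Type u} [CommRing A] [Algebra ℝ A]

/-- The Euclidean topology on the set `C(ℝ)` of real points: the coarsest topology for which all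
elements of the coordinate ring are continuous functions. If `A` is generated by `x₁, …, xₘ`, this
is the subspace topology of `C(ℝ) ⊆ ℝ ^ m`. -/
instance realPointsTopology : TopologicalSpace (A →ₐ[ℝ] ℝ) :=
  TopologicalSpace.induced (fun ζ : A →ₐ[ℝ] ℝ => (fun a => ζ a : A → ℝ)) inferInstance

/-- The order of `f` along an ideal `m`: the largest `k` with `f ∈ m ^ k`, and `⊤` if there is no
largest one. If `m` is a maximal ideal and the local ring at `m` is a discrete valuation ring,
then this is the value of `f` under that valuation. -/
def order {B : Type*} [CommRing B] (m : Ideal B) (f : B) : ℕ∞ :=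
  ⨆ (k : ℕ) (_ : f ∈ m ^ k), (k : ℕ∞)

/-- The maximal ideal of `A` belonging to a real point `ξ`. -/
def maxIdealAt (ξ : A →ₐ[ℝ] ℝ) : Ideal A := RingHom.ker ξ

/-- `u` is a local uniformizer at `ξ`. -/
def IsLocalUniformizer (ξ : A →ₐ[ℝ] ℝ) (u : A) : Prop := order (maxIdealAt ξ) u = 1

/-- The uniformizers `u₁` and `u₂` at `ξ` define the same local orientation: the rational function
`u₁ / u₂`, which is regular at `ξ`, is positive at `ξ`. That is, `u₁ / u₂ = a / b` with `a` and
`b` regular functions that are positive at `ξ`. -/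
def SameOrientation (ξ : A →ₐ[ℝ] ℝ) (u₁ u₂ : A) : Prop :=
  ∃ a b : A, 0 < ξ a ∧ 0 < ξ b ∧ b * u₁ = a * u₂

/-- `J` is a closed interval on the positive side of `ξ`, with respect to the local orientation at
`ξ` that is represented by the uniformizer `t`: a compact connected set of real points that
contains `ξ` and some other point, and on which some uniformizer `u` representing this local
orientation is nonnegative. -/
def IsPositiveInterval (ξ : A →ₐ[ℝ] ℝ) (t : A) (J : Set (A →ₐ[ℝ] ℝ)) : Prop :=
  IsCompact J ∧ IsConnected J ∧ ξ ∈ J ∧ J.Nontrivial ∧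
    ∃ u : A, IsLocalUniformizer ξ u ∧ SameOrientation ξ u t ∧ ∀ ζ ∈ J, 0 ≤ ζ u

end Points

/-- Finite Boolean combinations of strict polynomial inequalities `a > 0` with `a` in the
coordinate ring `A` (an equation `a = 0` is expressed as `¬ (a > 0) ∧ ¬ (-a > 0)`). -/
inductive SemialgFormula (A : Type u) : Type u
  | pos (a : A) : SemialgFormula A
  | not (φ : SemialgFormula A) : SemialgFormula A
  | and (φ ψ : SemialgFormula A) : SemialgFormula A

section BaseExtension

variable {A : Type u} [CommRing A] [Algebra ℝ A]
variable (R : Type v) [Field R] [LinearOrder R] [IsStrictOrderedRing R] [Algebra ℝ R]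

variable {R} in
/-- The point `η ∈ C(R)` satisfies the given system of polynomial inequalities. -/
def SemialgFormula.Holds : SemialgFormula A → (A →ₐ[ℝ] R) → Prop
  | .pos a, η => 0 < η a
  | .not φ, η => ¬ φ.Holds η
  | .and φ ψ, η => φ.Holds η ∧ ψ.Holds η

/-- The base field extension `M_R ⊆ C(R)` of a semialgebraic set `M ⊆ C(ℝ)`: the set of points of
`C(R)` satisfying a system of polynomial inequalities that describes `M`. (For real closed `R`,
any two such systems define the same subset of `C(R)`.) -/
def baseExtension (M : Set (A →ₐ[ℝ] ℝ)) : Set (A →ₐ[ℝ] R) :=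
  {η | ∃ φ : SemialgFormula A, {ζ : A →ₐ[ℝ] ℝ | φ.Holds ζ} = M ∧ φ.Holds η}

/-- A real point, regarded as a point over `R`. -/
def extendPoint (ζ : A →ₐ[ℝ] ℝ) : A →ₐ[ℝ] R := (Algebra.ofId ℝ R).comp ζ

variable {R}

/-- Evaluation at `η ∈ C(R)` of the functions in `R[C] = R ⊗ A`; it sends `r ⊗ a` to
`r * η a`. -/
def evalAt (η : A →ₐ[ℝ] R) : R ⊗[ℝ] A →ₐ[R] R :=
  Algebra.TensorProduct.lift (Algebra.ofId R R) η (fun _ _ => Commute.all _ _)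

/-- The order of vanishing of `f ∈ R[C]` at the point `η ∈ C(R)`. -/
def vanishingOrder (η : A →ₐ[ℝ] R) (f : R ⊗[ℝ] A) : ℕ∞ := order (RingHom.ker (evalAt η)) f

variable (R)

/-- The cone `(P_{V,S})_R` of all `g ∈ V_R = R ⊗ V` that are nonnegative on `S_R`. -/
def nonnegCone (V : Submodule ℝ A) (S : Set (A →ₐ[ℝ] ℝ)) : PointedCone R (R ⊗[ℝ] A) where
  carrier := {g | g ∈ V.baseChange R ∧ ∀ η ∈ baseExtension R S, 0 ≤ evalAt η g}
  zero_mem' := ⟨zero_mem _, fun η _ => by simp⟩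
  add_mem' := fun hx hy => ⟨add_mem hx.1 hy.1, fun η h => by
    rw [map_add]; exact add_nonneg (hx.2 η h) (hy.2 η h)⟩
  smul_mem' := fun c x hx => ⟨(V.baseChange R).smul_mem (c : R) hx.1, fun η h => by
    have h1 : evalAt η (c • x) = (c : R) * evalAt η x := map_smul (evalAt η) (c : R) x
    rw [h1]; exact mul_nonneg c.2 (hx.2 η h)⟩

end BaseExtension

/-- The nonzero element `f` of the cone `P` spans an extreme ray of `P`: the half-line
`{c • f | c ≥ 0}` is a face of `P`. -/
def SpansExtremeRay {R : Type*} [Field R] [LinearOrder R] [IsStrictOrderedRing R]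
    {M : Type*} [AddCommGroup M] [Module R M] (P : PointedCone R M) (f : M) : Prop :=
  f ≠ 0 ∧ f ∈ P ∧ (PointedCone.hull R {f}).IsFaceOf P

end AffineCurve

end

noncomputable section

set_option linter.unusedSectionVars false
set_option linter.unusedVariables false

open Polynomial Module

/-! ### Irreducible polynomials over a real closed field. -/

namespace RealClosed

section Algebraic

variable {R : Type*} [Field R] [IsRealClosed R] [CharZero R]

/-! Over `ℝ` this is the classical argument for Chebyshev systems. Let `D` be the derivation dual to
`dt` and `γ` its integral curve through `ξ`. Then `t` is the time parameter along `γ`, the small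
intervals in question are the arcs `γ([0, s₀])`, and the multiplicity of a zero is the number of
successive derivatives along `D`, starting with the zeroth, that vanish there. On a short arc `V` is
an extended Chebyshev system (`exists_sum_le`): dividing by some `v ∈ V` and differentiating lowers
the dimension by one and, by Rolle, the zero count by at most one. So an extremal `f` has at most
`n` zeros. If it had fewer, vanishing at the zeros of `f` to at least the same orders would cut out
a subspace of dimension at least 2, containing some `g` that is not a multiple of `f`. By
compactness `|g| ≤ C f` on the arc, so `f ± δ g ≥ 0` for small `δ > 0`, against extremality
(`exists_zeros_of_extremal`). The zeros are interior and `f ≥ 0`, so every multiplicity is even, and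
hence so is `n`.

These analytic tools do not exist over `R`. But for a semialgebraic `S` the conclusion is a
first-order sentence with real parameters (`ExtremalZeros`), so Tarski's transfer principle carries
it to every `R` (`extremalZeros_transfer`), and `J`, chosen over `ℝ`, serves all `R` at once. The
principle is proved without a syntax of formulas: a predicate counts as quantifier-free if finitely
many signs decide it (`Transfers`), and such predicates are closed under `∃` (`exists_elim`), by an
induction on degrees. The algebraic input is that irreducible polynomials over a real closed field
have degree at most 2, which yields the intermediate value theorem and Rolle's theorem.

Two bridges remain. The order defined by powers of a maximal ideal of `R ⊗ A` agrees with the order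
read off from derivatives (`vanishingOrder_eq`), and the existence of an extreme ray forces `S` to
be semialgebraic (`exists_formula_of_spansExtremeRay`). -/

theorem finrank_eq_one_of_odd {F : Type*} [Field F] [Algebra R F] [FiniteDimensional R F]
    (h : Odd (finrank R F)) : finrank R F = 1 := by
  obtain ⟨α, hα⟩ := Field.exists_primitive_element R F
  have hint : IsIntegral R α := Algebra.IsIntegral.isIntegral α
  have hdeg : (minpoly R α).natDegree = finrank R F := by
    rw [← IntermediateField.adjoin.finrank hint, hα, IntermediateField.finrank_top']
  obtain ⟨x, hx⟩ := IsRealClosed.exists_isRoot_of_odd_natDegree (f := minpoly R α)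
    (by rwa [hdeg])
  rw [← hdeg]
  exact natDegree_eq_of_degree_eq_some
    (degree_eq_one_of_irreducible_of_root (minpoly.irreducible hint) hx)

/-- With `r = |a + b i|` the half-angle formulas give `c ^ 2 = (r + a) / 2` and `d ^ 2 = (r - a) /
2`. Then `(2 c d) ^ 2 = b ^ 2`, and the sign of `d` can be adjusted. -/
theorem isSquare_add_mul_sqrt_neg_one {E : Type*} [Field E] [Algebra R E] [LinearOrder R]
    [IsStrictOrderedRing R] {i : E} (hi : i ^ 2 = -1) (a b : R) :
    ∃ c d : R, algebraMap R E a + algebraMap R E b * i =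
      (algebraMap R E c + algebraMap R E d * i) ^ 2 := by
  obtain ⟨r, hr⟩ := IsSquare.of_nonneg (add_nonneg (mul_self_nonneg a) (mul_self_nonneg b))
  wlog hr0 : 0 ≤ r generalizing r
  · exact this (-r) (by rw [hr]; ring) (by linarith)
  have h1 : |a| ≤ r := abs_le_of_sq_le_sq (by nlinarith [mul_self_nonneg b]) hr0
  obtain ⟨c, hc⟩ := IsSquare.of_nonneg (show 0 ≤ (r + a) / 2 by linarith [neg_abs_le a])
  obtain ⟨d, hd⟩ := IsSquare.of_nonneg (show 0 ≤ (r - a) / 2 by linarith [le_abs_self a])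
  have h2 : (2 * (c * d)) ^ 2 = b ^ 2 := by
    calc (2 * (c * d)) ^ 2 = 4 * (c * c) * (d * d) := by ring
      _ = r * r - a * a := by rw [← hc, ← hd]; ring
      _ = b ^ 2 := by rw [← hr]; ring
  have h3 : c * c - d * d = a := by rw [← hc, ← hd]; ring
  rcases sq_eq_sq_iff_eq_or_eq_neg.1 h2 with h | h
  · refine ⟨c, d, ?_⟩
    rw [← h, ← h3]
    simp only [map_sub, map_mul, map_ofNat]
    linear_combination (-(algebraMap R E d) ^ 2) * hi
  · refine ⟨c, -d, ?_⟩
    rw [← h3, show b = - (2 * (c * d)) by rw [h]; ring]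
    simp only [map_sub, map_mul, map_ofNat, map_neg]
    linear_combination (-(algebraMap R E d) ^ 2) * hi

theorem finrank_ne_two_of_isSquare {L M : Type*} [Field L] [CharZero L] [Field M] [Algebra L M]
    (hL : ∀ x : L, IsSquare x) : finrank L M ≠ 2 := by
  intro h2
  have hfin : FiniteDimensional L M := Module.finite_of_finrank_pos (by omega)
  obtain ⟨α, hα⟩ := Field.exists_primitive_element L M
  have hint : IsIntegral L α := Algebra.IsIntegral.isIntegral α
  have hdeg : (minpoly L α).natDegree = 2 := by
    rw [← IntermediateField.adjoin.finrank hint, hα, IntermediateField.finrank_top', h2]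
  have hirr := minpoly.irreducible hint
  set p := minpoly L α with hp
  have hlc : p.coeff 2 = 1 := by
    have := minpoly.monic hint
    rwa [Monic, leadingCoeff, hdeg] at this
  obtain ⟨s, hs⟩ := hL ((p.coeff 1) ^ 2 - 4 * p.coeff 0)
  have hroot : p.IsRoot ((-p.coeff 1 + s) / 2) := by
    rw [IsRoot, eval_eq_sum_range, hdeg, Finset.sum_range_succ, Finset.sum_range_succ,
      Finset.sum_range_one, hlc]
    field_simp
    linear_combination -hs
  have : p.natDegree = 1 :=
    natDegree_eq_of_degree_eq_some (degree_eq_one_of_irreducible_of_root hirr hroot)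
  omega

/-- Artin's Galois-theoretic argument. The fixed field of a Sylow 2-subgroup has odd degree over
`R`, hence is `R`, so `[E : R]` is a power of 2. All elements of `L = R(i)` are squares, so `L` has
no quadratic extension, whereas a nontrivial 2-group has a subgroup of index 2. Thus `E = L` has
degree 2. -/
theorem natDegree_le_two_of_irreducible [LinearOrder R] [IsStrictOrderedRing R] {q : R[X]}
    (hq : Irreducible q) : q.natDegree ≤ 2 := by
  classical
  -- The second factor puts a square root of `-1` into the splitting field.
  let P : R[X] := q * (X ^ 2 + 1)
  have hP0 : P ≠ 0 := mul_ne_zero hq.ne_zero (by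
    intro h
    have := congrArg (eval 0) h
    simp at this)
  let E := P.SplittingField
  have hsplit : (P.map (algebraMap R E)).Splits := SplittingField.splits P
  have hgal : IsGalois R E := ⟨⟩
  have hroot : ∀ f : R[X], f ∣ P → f.natDegree ≠ 0 → ∃ x : E, aeval x f = 0 := by
    intro f hf hd
    have hs : (f.map (algebraMap R E)).Splits :=
      hsplit.of_dvd ((Polynomial.map_ne_zero_iff (algebraMap R E).injective).2 hP0)
        (Polynomial.map_dvd _ hf)
    obtain ⟨x, hx⟩ := hs.exists_eval_eq_zero (by
      rw [degree_map]
      intro h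
      exact hd (natDegree_eq_of_degree_eq_some h))
    exact ⟨x, by rwa [aeval_def, ← eval_map]⟩
  obtain ⟨i, hi⟩ := hroot (X ^ 2 + 1) (dvd_mul_left _ _) (by
    rw [show (X ^ 2 + 1 : R[X]) = X ^ 2 + C 1 by simp, natDegree_X_pow_add_C]; norm_num)
  replace hi : i ^ 2 = -1 := by
    have : i ^ 2 + 1 = 0 := by simpa using hi
    linear_combination this
  have hG : ∃ N, finrank R E = 2 ^ N := by
    let H : Sylow 2 Gal(E/R) := default
    have h1 : Odd (finrank R (IntermediateField.fixedField (H : Subgroup Gal(E/R)))) := by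
      rw [IntermediateField.finrank_eq_fixingSubgroup_index, IntermediateField.fixingSubgroup_fixedField,
        ← Nat.not_even_iff_odd, even_iff_two_dvd]
      exact H.not_dvd_index
    have h2 := finrank_eq_one_of_odd h1
    have h3 := finrank_mul_finrank R (IntermediateField.fixedField (H : Subgroup Gal(E/R))) E
    rw [h2, one_mul, IntermediateField.finrank_fixedField_eq_card] at h3
    obtain ⟨N, hN⟩ := IsPGroup.iff_card.1 H.isPGroup'
    exact ⟨N, by rw [← h3, ← hN]⟩
  obtain ⟨N, hN⟩ := hG
  have hint : IsIntegral R i := Algebra.IsIntegral.isIntegral i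
  let L := IntermediateField.adjoin R {i}
  have hmin : minpoly R i = X ^ 2 + 1 := by
    symm
    apply minpoly.eq_of_irreducible_of_monic
    · apply Polynomial.irreducible_of_degree_le_three_of_not_isRoot
      · rw [show (X ^ 2 + 1 : R[X]) = X ^ 2 + C 1 by simp, natDegree_X_pow_add_C]; simp
      · intro x hx
        have : x ^ 2 + 1 = 0 := by simpa using hx
        nlinarith [sq_nonneg x]
    · simp [hi]
    · rw [show (X ^ 2 + 1 : R[X]) = X ^ 2 + C 1 by simp]
      exact monic_X_pow_add_C _ (by norm_num)
  have hdim : (minpoly R i).natDegree = 2 := by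
    rw [hmin, show (X ^ 2 + 1 : R[X]) = X ^ 2 + C 1 by simp, natDegree_X_pow_add_C]
  have hL2 : finrank R L = 2 := by
    rw [IntermediateField.adjoin.finrank hint, hdim]
  have hsq : ∀ x : L, IsSquare x := by
    intro x
    let pb := IntermediateField.adjoin.powerBasis hint
    obtain ⟨f, hf, hx⟩ := pb.exists_eq_aeval x
    have hf1 : f.natDegree ≤ 1 := by
      have : pb.dim = 2 := by
        rw [IntermediateField.adjoin.powerBasis_dim, hdim]
      omega
    rw [eq_X_add_C_of_natDegree_le_one hf1] at hx
    have hg : pb.gen ^ 2 = -1 := by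
      rw [IntermediateField.adjoin.powerBasis_gen]
      apply Subtype.ext
      simpa using hi
    obtain ⟨c, d, hcd⟩ := isSquare_add_mul_sqrt_neg_one hg (f.coeff 0) (f.coeff 1)
    refine ⟨algebraMap R L c + algebraMap R L d * pb.gen, ?_⟩
    rw [← sq, ← hcd, hx]
    simp [add_comm]
  have hEL : finrank L E = 1 := by
    have h3 := finrank_mul_finrank R L E
    rw [hL2, hN] at h3
    by_contra hne
    obtain ⟨k, hk⟩ : ∃ k, finrank L E = 2 ^ (k + 1) := by
      have hdvd : finrank L E ∣ 2 ^ N := Dvd.intro_left _ h3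
      obtain ⟨k, -, hk⟩ := (Nat.dvd_prime_pow Nat.prime_two).1 hdvd
      cases k with
      | zero => exact absurd hk hne
      | succ k => exact ⟨k, hk⟩
    have hcard : Nat.card Gal(E/L) = 2 ^ (k + 1) := by
      rw [IsGalois.card_aut_eq_finrank, hk]
    obtain ⟨H, hH⟩ := Sylow.exists_subgroup_card_pow_prime (G := Gal(E/L)) 2 (n := k)
      (by rw [hcard, pow_succ]; exact Dvd.intro _ rfl)
    have h4 := finrank_mul_finrank L (IntermediateField.fixedField H) E
    rw [IntermediateField.finrank_fixedField_eq_card, hH, hk, pow_succ, mul_comm] at h4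
    exact finrank_ne_two_of_isSquare hsq (Nat.eq_of_mul_eq_mul_left (by positivity) h4)
  have hE : finrank R E = 2 := by
    rw [← finrank_mul_finrank R L E, hEL, hL2]
  by_contra hlt
  obtain ⟨x, hx⟩ := hroot q (dvd_mul_right _ _) (by omega)
  have hm : q.natDegree = (minpoly R x).natDegree := by
    rw [← minpoly.eq_of_irreducible hq hx]
    rw [natDegree_mul hq.ne_zero (by simpa using hq.ne_zero), natDegree_C, add_zero]
  have := minpoly.natDegree_le (A := R) x
  omega

end Algebraic

end RealClosed

/-! ### Intermediate values, Rolle's theorem and root bounds. -/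

namespace RealClosed

variable {K : Type*} [Field K] [LinearOrder K] [IsStrictOrderedRing K]

section IVT

variable [IsRealClosed K]

/-- An irreducible quadratic has negative discriminant, and completing the square shows that it has
constant sign. -/
theorem natDegree_eq_one_of_irreducible_of_mul_neg {q : K[X]} (hq : Irreducible q) {a b : K}
    (h : q.eval a * q.eval b < 0) : q.natDegree = 1 := by
  have h2 := natDegree_le_two_of_irreducible hq
  have h0 : q.natDegree ≠ 0 := by
    intro h0
    rw [eq_C_of_natDegree_eq_zero h0] at h
    simp only [eval_C] at h
    exact absurd h (not_lt.2 (mul_self_nonneg _))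
  by_contra h1
  have hd : q.natDegree = 2 := by omega
  have hev : ∀ x, q.eval x = q.coeff 0 + q.coeff 1 * x + q.coeff 2 * x ^ 2 := by
    intro x
    rw [eval_eq_sum_range, hd, Finset.sum_range_succ, Finset.sum_range_succ,
      Finset.sum_range_one]
    simp
  have hl : q.coeff 2 ≠ 0 := by
    rw [← hd]
    exact leadingCoeff_ne_zero.2 hq.ne_zero
  rcases le_or_gt 0 ((q.coeff 1) ^ 2 - 4 * q.coeff 2 * q.coeff 0) with hdisc | hdisc
  · obtain ⟨s, hs⟩ := IsSquare.of_nonneg hdisc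
    have hroot : q.IsRoot ((-q.coeff 1 + s) / (2 * q.coeff 2)) := by
      rw [IsRoot, hev]
      field_simp
      linear_combination -hs
    have : q.natDegree = 1 :=
      natDegree_eq_of_degree_eq_some (degree_eq_one_of_irreducible_of_root hq hroot)
    omega
  · have hpos : ∀ x, 0 < 4 * q.coeff 2 * q.eval x := by
      intro x
      rw [hev]
      nlinarith [sq_nonneg (2 * q.coeff 2 * x + q.coeff 1)]
    nlinarith [mul_pos (hpos a) (hpos b), sq_nonneg (q.coeff 2)]

/-- The intermediate value theorem for polynomials over a real closed field. -/
theorem exists_root_of_mul_neg {p : K[X]} {a b : K} (hab : a < b)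
    (h : p.eval a * p.eval b < 0) : ∃ c, a < c ∧ c < b ∧ p.eval c = 0 := by
  induction p using WfDvdMonoid.induction_on_irreducible with
  | zero => simp at h
  | unit u hu =>
    obtain ⟨c, -, rfl⟩ := Polynomial.isUnit_iff.1 hu
    simp only [eval_C] at h
    exact absurd h (not_lt.2 (mul_self_nonneg _))
  | mul p q hp hq ih =>
    rw [eval_mul, eval_mul] at h
    -- If the product changes sign, so does one of its factors; an irreducible factor that changes
    -- sign is linear and has an explicit root.
    rcases lt_or_ge (p.eval a * p.eval b) 0 with h1 | h1
    · obtain ⟨c, hc⟩ := ih h1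
      exact ⟨c, hc.1, hc.2.1, by simp [hc.2.2]⟩
    · have h2 : q.eval a * q.eval b < 0 := by
        by_contra h3
        nlinarith [mul_nonneg h1 (not_lt.1 h3)]
      have hd := natDegree_eq_one_of_irreducible_of_mul_neg hq h2
      have hev : ∀ x, q.eval x = q.coeff 1 * x + q.coeff 0 := by
        intro x
        rw [eval_eq_sum_range, hd, Finset.sum_range_succ, Finset.sum_range_one]
        simp [add_comm]
      have hl : q.coeff 1 ≠ 0 := by
        rw [← hd]
        exact leadingCoeff_ne_zero.2 hq.ne_zero
      rw [hev, hev] at h2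
      set u := q.coeff 1
      set v := q.coeff 0
      have h4 : (a - -v / u) * (b - -v / u) < 0 := by
        have : (a - -v / u) * (b - -v / u) = (u * a + v) * (u * b + v) / (u * u) := by
          field_simp
          ring
        rw [this]
        exact div_neg_of_neg_of_pos h2 (mul_self_pos.2 hl)
      refine ⟨-v / u, ?_, ?_, ?_⟩
      · by_contra hc
        nlinarith [mul_nonneg (sub_nonneg.2 (not_lt.1 hc))
          (sub_nonneg.2 ((not_lt.1 hc).trans hab.le))]
      · by_contra hc
        nlinarith [mul_nonneg (sub_nonneg.2 (not_lt.1 hc))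
          (sub_nonneg.2 (hab.le.trans (not_lt.1 hc)))]
      · rw [eval_mul, hev]
        field_simp
        ring

/-- A polynomial without roots in an open interval has constant sign there. -/
theorem sign_eval_eq_of_forall_ne_zero {p : K[X]} {u v x y : K} (hx : x ∈ Set.Ioo u v)
    (hy : y ∈ Set.Ioo u v) (h : ∀ z ∈ Set.Ioo u v, p.eval z ≠ 0) :
    SignType.sign (p.eval x) = SignType.sign (p.eval y) := by
  wlog hxy : x ≤ y generalizing x y
  · exact (this hy hx (le_of_not_ge hxy)).symm
  rcases hxy.eq_or_lt with rfl | hxy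
  · rfl
  rcases (h x hx).lt_or_gt with h1 | h1 <;> rcases (h y hy).lt_or_gt with h2 | h2
  · rw [sign_neg h1, sign_neg h2]
  · obtain ⟨c, hc1, hc2, hc⟩ := exists_root_of_mul_neg hxy (mul_neg_of_neg_of_pos h1 h2)
    exact absurd hc (h c ⟨hx.1.trans hc1, hc2.trans hy.2⟩)
  · obtain ⟨c, hc1, hc2, hc⟩ := exists_root_of_mul_neg hxy (mul_neg_of_pos_of_neg h1 h2)
    exact absurd hc (h c ⟨hx.1.trans hc1, hc2.trans hy.2⟩)
  · rw [sign_pos h1, sign_pos h2]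

/-- Rolle's theorem between consecutive roots. -/
theorem exists_derivative_root_of_consecutive {p : K[X]} {a b : K} (hab : a < b)
    (ha : p.eval a = 0) (hb : p.eval b = 0) (h : ∀ z ∈ Set.Ioo a b, p.eval z ≠ 0) :
    ∃ c ∈ Set.Ioo a b, (derivative p).eval c = 0 := by
  have hp : p ≠ 0 := by
    rintro rfl
    exact h ((a + b) / 2) ⟨by linarith, by linarith⟩ (by simp)
  obtain ⟨q, hq, hqa⟩ := exists_eq_pow_rootMultiplicity_mul_and_not_dvd p hp a
  have hq0 : q ≠ 0 := by rintro rfl; simp at hqa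
  obtain ⟨r, hr, hrb⟩ := exists_eq_pow_rootMultiplicity_mul_and_not_dvd q hq0 b
  have hm : p.rootMultiplicity a ≠ 0 := ((rootMultiplicity_pos hp).2 ha).ne'
  have hqb : q.eval b = 0 := by
    have := hb
    rw [hq, eval_mul, eval_pow] at this
    rcases mul_eq_zero.1 this with h1 | h1
    · exact absurd (pow_eq_zero_iff hm |>.1 h1) (by simpa using (sub_pos.2 hab).ne')
    · exact h1
  have hk : q.rootMultiplicity b ≠ 0 := ((rootMultiplicity_pos hq0).2 hqb).ne'
  rw [dvd_iff_isRoot, IsRoot] at hqa hrb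
  generalize p.rootMultiplicity a = m at hq hm
  generalize q.rootMultiplicity b = k at hr hk
  have hra : r.eval a ≠ 0 := by
    intro h0
    exact hqa (by rw [hr, eval_mul, h0, mul_zero])
  obtain ⟨m', rfl⟩ : ∃ m', m = m' + 1 := Nat.exists_eq_succ_of_ne_zero hm
  obtain ⟨k', rfl⟩ : ∃ k', k = k' + 1 := Nat.exists_eq_succ_of_ne_zero hk
  have hrz : ∀ z ∈ Set.Ioo a b, r.eval z ≠ 0 := by
    intro z hz h0
    apply h z hz
    rw [hq, hr]
    simp [h0]
  have hrab : 0 < r.eval a * r.eval b := by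
    rcases (mul_ne_zero hra hrb).lt_or_gt with h1 | h1
    · obtain ⟨c, hc1, hc2, hc⟩ := exists_root_of_mul_neg hab h1
      exact absurd hc (hrz c ⟨hc1, hc2⟩)
    · exact h1
  -- `s` is what remains of the derivative of `(X - a) ^ m * (X - b) ^ k * r` after removing `(X -
  -- a) ^ (m - 1) * (X - b) ^ (k - 1)`. As `r` does not change sign, `s a` and `s b` have opposite
  -- signs.
  let s : K[X] := C (m' + 1 : K) * (X - C b) * r + C (k' + 1 : K) * (X - C a) * r
    + (X - C a) * (X - C b) * derivative r
  have hs : derivative p = (X - C a) ^ m' * (X - C b) ^ k' * s := by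
    rw [hq, hr]
    simp only [derivative_mul, derivative_X_sub_C_pow, s]
    simp only [Nat.add_sub_cancel, Nat.cast_add, Nat.cast_one, map_add, map_natCast, map_one]
    ring
  have hsab : s.eval a * s.eval b < 0 := by
    simp only [s, eval_add, eval_mul, eval_sub, eval_X, eval_C, sub_self, mul_zero, zero_mul,
      add_zero, zero_add]
    have h1 : 0 < (m' + 1 : K) * (k' + 1) * (b - a) * (b - a) := by
      have := sub_pos.2 hab
      positivity
    nlinarith [mul_pos h1 hrab]
  obtain ⟨c, hc1, hc2, hc⟩ := exists_root_of_mul_neg hab hsab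
  exact ⟨c, ⟨hc1, hc2⟩, by rw [hs, eval_mul, hc, mul_zero]⟩

/-- Rolle's theorem for polynomials over a real closed field. -/
theorem exists_derivative_root {p : K[X]} {a b : K} (hab : a < b)
    (ha : p.eval a = 0) (hb : p.eval b = 0) :
    ∃ c ∈ Set.Ioo a b, (derivative p).eval c = 0 := by
  classical
  by_cases hp : p = 0
  · exact ⟨(a + b) / 2, ⟨by linarith, by linarith⟩, by simp [hp]⟩
  let T := p.roots.toFinset.filter (fun z => a < z)
  have hbT : b ∈ T := by simp [T, hp, hab, hb]
  let c := T.min' ⟨b, hbT⟩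
  have hcT : c ∈ T := T.min'_mem _
  have hcb : c ≤ b := T.min'_le _ hbT
  simp only [T, Finset.mem_filter, Multiset.mem_toFinset, mem_roots hp, IsRoot] at hcT
  obtain ⟨d, hd, hd'⟩ := exists_derivative_root_of_consecutive hcT.2 ha hcT.1 (by
    intro z hz h0
    have hzT : z ∈ T := by simp [T, hp, hz.1, h0]
    exact absurd (T.min'_le _ hzT) (not_le.2 hz.2))
  exact ⟨d, ⟨hd.1, hd.2.trans_le hcb⟩, hd'⟩

/-- Rolle's theorem for `p` minus its chord, scaled by `b - a` to avoid division. -/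
theorem exists_eval_sub_eq {p : K[X]} {a b : K} (hab : a < b) :
    ∃ c ∈ Set.Ioo a b, p.eval b - p.eval a = (derivative p).eval c * (b - a) := by
  let q : K[X] := C (b - a) * p - C (p.eval b - p.eval a) * X
    - C ((b - a) * p.eval a - (p.eval b - p.eval a) * a)
  obtain ⟨c, hc, h⟩ := exists_derivative_root (p := q) hab (by simp [q]) (by simp [q]; ring)
  refine ⟨c, hc, ?_⟩
  simp [q] at h
  linear_combination -h

/-- If the derivative has no roots in an interval, then a polynomial has a root in the interval
only if it changes sign. -/
theorem mul_neg_of_root_of_derivative_ne_zero {p : K[X]} {u v x : K} (hx : x ∈ Set.Ioo u v)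
    (h0 : p.eval x = 0) (h : ∀ z ∈ Set.Ioo u v, (derivative p).eval z ≠ 0) :
    p.eval u * p.eval v < 0 := by
  obtain ⟨c, hc, h1⟩ := exists_eval_sub_eq (p := p) hx.1
  obtain ⟨d, hd, h2⟩ := exists_eval_sub_eq (p := p) hx.2
  have hc' : c ∈ Set.Ioo u v := ⟨hc.1, hc.2.trans hx.2⟩
  have hd' : d ∈ Set.Ioo u v := ⟨hx.1.trans hd.1, hd.2⟩
  have hs := sign_eval_eq_of_forall_ne_zero hc' hd' h
  have hpos : 0 < (derivative p).eval c * (derivative p).eval d := by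
    rcases (h c hc').lt_or_gt with h3 | h3
    · rw [sign_neg h3, eq_comm, sign_eq_neg_one_iff] at hs
      exact mul_pos_of_neg_of_neg h3 hs
    · rw [sign_pos h3, eq_comm, sign_eq_one_iff] at hs
      exact mul_pos h3 hs
  rw [h0] at h1 h2
  have e1 : p.eval u = -((derivative p).eval c * (x - u)) := by linear_combination -h1
  have e2 : p.eval v = (derivative p).eval d * (v - x) := by linear_combination h2
  rw [e1, e2]
  nlinarith [mul_pos hpos (mul_pos (sub_pos.2 hx.1) (sub_pos.2 hx.2))]

end IVT

/-- A bound for the roots of a polynomial of degree `d`. -/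
theorem abs_mul_lt_of_root {p : K[X]} {d : ℕ} (hd : p.natDegree = d) (hd0 : d ≠ 0) {x : K}
    (hx : p.eval x = 0) :
    (p.coeff d) ^ 2 * |x| <
      (p.coeff d) ^ 2 + ∑ i ∈ Finset.range d, ((p.coeff i) ^ 2 + (p.coeff d) ^ 2) := by
  have hp : p ≠ 0 := by rintro rfl; simp at hd; omega
  have hl : p.coeff d ≠ 0 := by rw [← hd]; exact leadingCoeff_ne_zero.2 hp
  have hl2 : 0 < (p.coeff d) ^ 2 := by positivity
  have hsum : 0 ≤ ∑ i ∈ Finset.range d, ((p.coeff i) ^ 2 + (p.coeff d) ^ 2) :=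
    Finset.sum_nonneg fun i _ => by positivity
  by_contra hcon
  rw [not_lt] at hcon
  have hx1 : 1 ≤ |x| := by
    by_contra h
    nlinarith
  obtain ⟨e, rfl⟩ := Nat.exists_eq_succ_of_ne_zero hd0
  have hxe : 0 < |x| ^ e := by positivity
  rw [eval_eq_sum_range, hd, Finset.sum_range_succ] at hx
  have h1 : |p.coeff (e + 1)| * |x| ^ (e + 1) ≤
      (∑ i ∈ Finset.range (e + 1), |p.coeff i|) * |x| ^ e := by
    rw [← abs_pow, ← abs_mul, eq_neg_of_add_eq_zero_right hx, abs_neg, Finset.sum_mul]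
    refine (Finset.abs_sum_le_sum_abs _ _).trans (Finset.sum_le_sum fun i hi => ?_)
    rw [abs_mul, abs_pow]
    exact mul_le_mul_of_nonneg_left
      (pow_le_pow_right₀ hx1 (by simpa using Nat.lt_succ_iff.1 (Finset.mem_range.1 hi)))
      (abs_nonneg _)
  have h2 : |p.coeff (e + 1)| * |x| ≤ ∑ i ∈ Finset.range (e + 1), |p.coeff i| := by
    rw [pow_succ] at h1
    exact le_of_mul_le_mul_right (by linarith) hxe
  -- Squares replace absolute values so that the bound is a polynomial in the coefficients and makes
  -- sense in the parameter ring.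
  have h3 : |p.coeff (e + 1)| * ∑ i ∈ Finset.range (e + 1), |p.coeff i| ≤
      ∑ i ∈ Finset.range (e + 1), ((p.coeff i) ^ 2 + (p.coeff (e + 1)) ^ 2) := by
    rw [Finset.mul_sum]
    refine Finset.sum_le_sum fun i _ => ?_
    rw [← sq_abs (p.coeff i), ← sq_abs (p.coeff (e + 1))]
    nlinarith [sq_nonneg (|p.coeff i| - |p.coeff (e + 1)|), sq_nonneg (|p.coeff i|),
      sq_nonneg (|p.coeff (e + 1)|)]
  have h4 := mul_le_mul_of_nonneg_left h2 (abs_nonneg (p.coeff (e + 1)))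
  rw [← mul_assoc, ← abs_mul, ← sq, abs_of_pos hl2] at h4
  simp only [Nat.succ_eq_add_one] at *
  linarith

end RealClosed

/-! ### Test points for sign conditions, and pseudo-division. -/

namespace RealClosed

section Witnesses

variable {K : Type*} [Field K] [LinearOrder K] [IsStrictOrderedRing K]
variable {ι : Type*}

theorem finite_setOf_root {K : Type*} [Field K] [Finite ι] (e : ι → K[X]) : {x : K | ∃ i, e i ≠ 0 ∧ (e i).eval x = 0}.Finite := by
  have : {x : K | ∃ i, e i ≠ 0 ∧ (e i).eval x = 0} =
      ⋃ i, {x : K | e i ≠ 0 ∧ (e i).eval x = 0} := by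
    ext x; simp
  rw [this]
  refine Set.finite_iUnion fun i => ?_
  by_cases h : e i = 0
  · simp [h]
  · exact ((e i).rootSet_finite K).subset fun x hx => by
      rw [mem_rootSet]
      exact ⟨h, by simpa using hx.2⟩

theorem sign_eval_eq_of_no_root [IsRealClosed K] (e : ι → K[X]) {u v x y : K}
    (hx : x ∈ Set.Ioo u v)
    (hy : y ∈ Set.Ioo u v) (h : ¬ ∃ k, ∃ w, e k ≠ 0 ∧ (e k).eval w = 0 ∧ u < w ∧ w < v) (i : ι) :
    SignType.sign ((e i).eval x) = SignType.sign ((e i).eval y) := by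
  by_cases h0 : e i = 0
  · simp [h0]
  · exact sign_eval_eq_of_forall_ne_zero hx hy fun z hz h1 => h ⟨i, z, h0, h1, hz.1, hz.2⟩

/-- A real root of `p` at which finitely many other polynomials have prescribed signs can be found
by looking only at the roots of these polynomials, provided that these polynomials
include the derivative of `p` and have roots on both sides of all roots of `p`. -/
theorem exists_root_sign_iff [IsRealClosed K] [Finite ι] (p : K[X]) (e : ι → K[X]) (τ : ι → SignType)
    (hder : ∃ i, e i = derivative p) (hder0 : derivative p ≠ 0)
    (hlow : ∃ i, e i ≠ 0 ∧ ∃ y, (e i).eval y = 0 ∧ ∀ x, p.eval x = 0 → y < x)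
    (hupp : ∃ i, e i ≠ 0 ∧ ∃ y, (e i).eval y = 0 ∧ ∀ x, p.eval x = 0 → x < y) :
    (∃ x, p.eval x = 0 ∧ ∀ i, SignType.sign ((e i).eval x) = τ i) ↔
    (∃ i, ∃ x, e i ≠ 0 ∧ (e i).eval x = 0 ∧ p.eval x = 0 ∧
      ∀ i, SignType.sign ((e i).eval x) = τ i) ∨
    (∃ i j, ∃ u, e i ≠ 0 ∧ (e i).eval u = 0 ∧ ∃ v, e j ≠ 0 ∧ (e j).eval v = 0 ∧
      u < v ∧ p.eval u * p.eval v < 0 ∧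
      (∀ i, SignType.sign ((e i).eval ((u + v) / 2)) = τ i) ∧
      ¬ ∃ k, ∃ w, e k ≠ 0 ∧ (e k).eval w = 0 ∧ u < w ∧ w < v) := by
  constructor
  · rintro ⟨x, hx, hτ⟩
    by_cases hr : ∃ i, e i ≠ 0 ∧ (e i).eval x = 0
    · obtain ⟨i, hi, hix⟩ := hr
      exact Or.inl ⟨i, x, hi, hix, hx, hτ⟩
    right
    have hfin := finite_setOf_root e
    obtain ⟨i, hi, y, hy, hyx⟩ := hlow
    obtain ⟨j, hj, z, hz, hzx⟩ := hupp
    -- `u` and `v` are the roots of the `e i` nearest to `x` on either side. No `e i` changes sign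
    -- between them, so the midpoint has the signs of `x`; and `p` is strictly monotone there, so it
    -- changes sign.
    obtain ⟨u, ⟨⟨i, hi, hu⟩, hux⟩, humax⟩ := Set.exists_max_image
      ({x : K | ∃ i, e i ≠ 0 ∧ (e i).eval x = 0} ∩ {w | w < x}) id
      (hfin.inter_of_left _) ⟨y, ⟨i, hi, hy⟩, hyx x hx⟩
    obtain ⟨v, ⟨⟨j, hj, hv⟩, hvx⟩, hvmin⟩ := Set.exists_min_image
      ({x : K | ∃ i, e i ≠ 0 ∧ (e i).eval x = 0} ∩ {w | x < w}) id
      (hfin.inter_of_left _) ⟨z, ⟨j, hj, hz⟩, hzx x hx⟩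
    simp only [Set.mem_ofPred_eq, id] at hux hvx humax hvmin
    have hno : ¬ ∃ k, ∃ w, e k ≠ 0 ∧ (e k).eval w = 0 ∧ u < w ∧ w < v := by
      rintro ⟨k, w, hk, hw, h1, h2⟩
      rcases lt_trichotomy w x with h | h | h
      · exact absurd (humax w ⟨⟨k, hk, hw⟩, h⟩) (not_le.2 h1)
      · exact hr ⟨k, hk, h ▸ hw⟩
      · exact absurd (hvmin w ⟨⟨k, hk, hw⟩, h⟩) (not_le.2 h2)
    have hxm : x ∈ Set.Ioo u v := ⟨hux, hvx⟩
    have huv := hux.trans hvx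
    have hmm : (u + v) / 2 ∈ Set.Ioo u v := ⟨by linarith, by linarith⟩
    refine ⟨i, j, u, hi, hu, v, hj, hv, huv, ?_, fun k => ?_, hno⟩
    · obtain ⟨k, hk⟩ := hder
      exact mul_neg_of_root_of_derivative_ne_zero hxm hx fun w hw h =>
        hno ⟨k, w, hk ▸ hder0, hk ▸ h, hw.1, hw.2⟩
    · rw [← hτ k]
      exact sign_eval_eq_of_no_root e hmm hxm hno k
  · rintro (⟨i, x, -, -, h⟩ | ⟨i, j, u, -, -, v, -, -, huv, hneg, hτ, hno⟩)
    · exact ⟨x, h⟩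
    · obtain ⟨x, h1, h2, hx⟩ := exists_root_of_mul_neg huv hneg
      refine ⟨x, hx, fun k => ?_⟩
      rw [← hτ k]
      exact sign_eval_eq_of_no_root e ⟨h1, h2⟩ ⟨by linarith, by linarith⟩ hno k

/-- Finite set of test points for sign conditions. -/
theorem exists_sign_iff [IsRealClosed K] [Finite ι] (e : ι → K[X]) (τ : ι → SignType) :
    (∃ x, True ∧ ∀ i, SignType.sign ((e i).eval x) = τ i) ↔
    (∃ i, ∃ x, e i ≠ 0 ∧ (e i).eval x = 0 ∧ ((∀ i, SignType.sign ((e i).eval x) = τ i) ∨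
      (∀ i, SignType.sign ((e i).eval (x + 1)) = τ i) ∨
      (∀ i, SignType.sign ((e i).eval (x - 1)) = τ i))) ∨
    (∃ i j, ∃ u, e i ≠ 0 ∧ (e i).eval u = 0 ∧ ∃ v, e j ≠ 0 ∧ (e j).eval v = 0 ∧
      (∀ i, SignType.sign ((e i).eval ((u + v) / 2)) = τ i)) ∨
    (∀ i, SignType.sign ((e i).eval 0) = τ i) := by
  constructor
  · rintro ⟨x, -, hτ⟩
    by_cases hr : ∃ i, e i ≠ 0 ∧ (e i).eval x = 0
    · obtain ⟨i, hi, hix⟩ := hr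
      exact Or.inl ⟨i, x, hi, hix, Or.inl hτ⟩
    have hfin := finite_setOf_root e
    -- The test point is the midpoint of two neighbouring roots, or 1 beyond the last root, or 1
    -- before the first, or `0` if there are no roots.
    by_cases hlow : ({x : K | ∃ i, e i ≠ 0 ∧ (e i).eval x = 0} ∩ {w | w < x}).Nonempty <;>
    by_cases hupp : ({x : K | ∃ i, e i ≠ 0 ∧ (e i).eval x = 0} ∩ {w | x < w}).Nonempty
    · obtain ⟨u, ⟨⟨i, hi, hu⟩, hux⟩, humax⟩ := Set.exists_max_image _ id
        (hfin.inter_of_left _) hlow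
      obtain ⟨v, ⟨⟨j, hj, hv⟩, hvx⟩, hvmin⟩ := Set.exists_min_image _ id
        (hfin.inter_of_left _) hupp
      simp only [Set.mem_ofPred_eq, id] at hux hvx humax hvmin
      refine Or.inr (Or.inl ⟨i, j, u, hi, hu, v, hj, hv, fun k => ?_⟩)
      rw [← hτ k]
      refine sign_eval_eq_of_no_root e (u := u) (v := v) ⟨by linarith, by linarith⟩
        ⟨hux, hvx⟩ ?_ k
      rintro ⟨k, w, hk, hw, h1, h2⟩
      rcases lt_trichotomy w x with h | h | h
      · exact absurd (humax w ⟨⟨k, hk, hw⟩, h⟩) (not_le.2 h1)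
      · exact hr ⟨k, hk, h ▸ hw⟩
      · exact absurd (hvmin w ⟨⟨k, hk, hw⟩, h⟩) (not_le.2 h2)
    · obtain ⟨u, ⟨⟨i, hi, hu⟩, hux⟩, humax⟩ := Set.exists_max_image _ id
        (hfin.inter_of_left _) hlow
      simp only [Set.mem_ofPred_eq, id] at hux humax
      refine Or.inl ⟨i, u, hi, hu, Or.inr (Or.inl fun k => ?_)⟩
      rw [← hτ k]
      refine sign_eval_eq_of_no_root e (u := u) (v := max x (u + 1) + 1)
        ⟨by linarith, by linarith [le_max_right x (u + 1)]⟩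
        ⟨hux, by linarith [le_max_left x (u + 1)]⟩ ?_ k
      rintro ⟨k, w, hk, hw, h1, h2⟩
      rcases lt_trichotomy w x with h | h | h
      · exact absurd (humax w ⟨⟨k, hk, hw⟩, h⟩) (not_le.2 h1)
      · exact hr ⟨k, hk, h ▸ hw⟩
      · exact hupp ⟨w, ⟨k, hk, hw⟩, h⟩
    · obtain ⟨v, ⟨⟨j, hj, hv⟩, hvx⟩, hvmin⟩ := Set.exists_min_image _ id
        (hfin.inter_of_left _) hupp
      simp only [Set.mem_ofPred_eq, id] at hvx hvmin
      refine Or.inl ⟨j, v, hj, hv, Or.inr (Or.inr fun k => ?_)⟩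
      rw [← hτ k]
      refine sign_eval_eq_of_no_root e (u := min x (v - 1) - 1) (v := v)
        ⟨by linarith [min_le_right x (v - 1)], by linarith⟩
        ⟨by linarith [min_le_left x (v - 1)], hvx⟩ ?_ k
      rintro ⟨k, w, hk, hw, h1, h2⟩
      rcases lt_trichotomy w x with h | h | h
      · exact hlow ⟨w, ⟨k, hk, hw⟩, h⟩
      · exact hr ⟨k, hk, h ▸ hw⟩
      · exact absurd (hvmin w ⟨⟨k, hk, hw⟩, h⟩) (not_le.2 h2)
    · refine Or.inr (Or.inr fun k => ?_)
      rw [← hτ k]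
      refine sign_eval_eq_of_no_root e (u := min x 0 - 1) (v := max x 0 + 1)
        ⟨by linarith [min_le_right x 0], by linarith [le_max_right x 0]⟩
        ⟨by linarith [min_le_left x 0], by linarith [le_max_left x 0]⟩ ?_ k
      rintro ⟨k, w, hk, hw, h1, h2⟩
      rcases lt_trichotomy w x with h | h | h
      · exact hlow ⟨w, ⟨k, hk, hw⟩, h⟩
      · exact hr ⟨k, hk, h ▸ hw⟩
      · exact hupp ⟨w, ⟨k, hk, hw⟩, h⟩
  · rintro (⟨i, x, -, -, h | h | h⟩ | ⟨i, j, u, -, -, v, -, -, h⟩ | h)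
    · exact ⟨x, trivial, h⟩
    · exact ⟨x + 1, trivial, h⟩
    · exact ⟨x - 1, trivial, h⟩
    · exact ⟨_, trivial, h⟩
    · exact ⟨0, trivial, h⟩

end Witnesses

/-- Pseudo-division, with an even power of the leading coefficient. -/
theorem exists_pseudo_division {D : Type*} [CommRing D] (p : D[X]) {d : ℕ}
    (hp : p.natDegree = d) (hd : d ≠ 0) (q : D[X]) :
    ∃ (k : ℕ) (s r : D[X]), C (p.coeff d ^ (2 * k)) * q = p * s + r ∧ r.natDegree < d := by
  have aux : ∀ m, ∀ q : D[X], q.natDegree ≤ m →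
      ∃ (k : ℕ) (s r : D[X]), C (p.coeff d ^ k) * q = p * s + r ∧ r.natDegree < d := by
    intro m
    induction m with
    | zero => exact fun q hq => ⟨0, 0, q, by simp, by omega⟩
    | succ m ih =>
      intro q hq
      by_cases hm : m + 1 < d
      · exact ⟨0, 0, q, by simp, by omega⟩
      let t : D[X] := X ^ (m + 1 - d) * C (q.coeff (m + 1))
      have h1 : (C (p.coeff d) * q - p * t).natDegree ≤ m := by
        have hle : (C (p.coeff d) * q - p * t).natDegree ≤ m + 1 := by
          refine (natDegree_sub_le _ _).trans (max_le ((natDegree_C_mul_le _ _).trans hq) ?_)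
          refine natDegree_mul_le.trans ?_
          have : t.natDegree ≤ m + 1 - d :=
            (natDegree_mul_C_le _ _).trans (natDegree_X_pow_le _)
          omega
        have hc : (C (p.coeff d) * q - p * t).coeff (m + 1) = 0 := by
          have : p * t = p * X ^ (m + 1 - d) * C (q.coeff (m + 1)) := by simp only [t]; ring
          rw [coeff_sub, coeff_C_mul, this, coeff_mul_C, coeff_mul_X_pow',
            if_pos (Nat.sub_le _ _), Nat.sub_sub_self (by omega), sub_self]
        exact natDegree_le_pred hle hc
      obtain ⟨k, s, r, h, hr⟩ := ih _ h1
      refine ⟨k + 1, s + C (p.coeff d ^ k) * t, r, ?_, hr⟩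
      rw [pow_succ, C_mul]
      linear_combination h
  obtain ⟨k, s, r, h, hr⟩ := aux _ q le_rfl
  -- A second factor `p.coeff d ^ k` makes the exponent even. The multiplier is then positive
  -- wherever the leading coefficient is nonzero, and the remainder keeps the sign of `q` at the
  -- roots of `p`.
  refine ⟨k, C (p.coeff d ^ k) * s, C (p.coeff d ^ k) * r, ?_,
    (natDegree_C_mul_le _ _).trans_lt hr⟩
  rw [two_mul, pow_add, C_mul]
  linear_combination C (p.coeff d ^ k) * h

end RealClosed

/-! ### Predicates decided by finitely many signs. -/

namespace RealClosed

universe u v₁ v₂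

variable {K₁ : Type v₁} [Field K₁] [LinearOrder K₁] [IsStrictOrderedRing K₁]
variable {K₂ : Type v₂} [Field K₂] [LinearOrder K₂] [IsStrictOrderedRing K₂]

/-- A pair of predicates on the points of a ring `D` with values in two ordered fields transfers if
the truth values at two points agree as soon as finitely many elements of `D` have the same
signs at these points. -/
def Transfers {D : Type u} [CommRing D] (P₁ : (D →+* K₁) → Prop) (P₂ : (D →+* K₂) → Prop) : Prop :=
  ∃ E : Finset D, ∀ (a : D →+* K₁) (b : D →+* K₂),
    (∀ e ∈ E, SignType.sign (a e) = SignType.sign (b e)) → (P₁ a ↔ P₂ b)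

namespace Transfers

section Basic

variable {D : Type u} [CommRing D] {P₁ Q₁ : (D →+* K₁) → Prop} {P₂ Q₂ : (D →+* K₂) → Prop}

theorem congr (h : Transfers P₁ P₂) (h₁ : ∀ a, Q₁ a ↔ P₁ a) (h₂ : ∀ a, Q₂ a ↔ P₂ a) :
    Transfers Q₁ Q₂ := by
  obtain ⟨E, hE⟩ := h
  exact ⟨E, fun a b hab => by rw [h₁, h₂, hE a b hab]⟩

theorem const (p : Prop) : Transfers (fun _ : D →+* K₁ => p) (fun _ : D →+* K₂ => p) :=
  ⟨∅, fun _ _ _ => Iff.rfl⟩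

protected theorem not (h : Transfers P₁ P₂) : Transfers (fun a => ¬ P₁ a) (fun b => ¬ P₂ b) := by
  obtain ⟨E, hE⟩ := h
  exact ⟨E, fun a b hab => not_congr (hE a b hab)⟩

protected theorem and (h : Transfers P₁ P₂) (h' : Transfers Q₁ Q₂) :
    Transfers (fun a => P₁ a ∧ Q₁ a) (fun b => P₂ b ∧ Q₂ b) := by
  classical
  obtain ⟨E, hE⟩ := h
  obtain ⟨F, hF⟩ := h'
  exact ⟨E ∪ F, fun a b hab =>
    and_congr (hE a b fun e he => hab e (Finset.mem_union_left _ he))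
      (hF a b fun e he => hab e (Finset.mem_union_right _ he))⟩

protected theorem or (h : Transfers P₁ P₂) (h' : Transfers Q₁ Q₂) :
    Transfers (fun a => P₁ a ∨ Q₁ a) (fun b => P₂ b ∨ Q₂ b) :=
  (h.not.and h'.not).not.congr (fun a => by tauto) (fun a => by tauto)

protected theorem imp (h : Transfers P₁ P₂) (h' : Transfers Q₁ Q₂) :
    Transfers (fun a => P₁ a → Q₁ a) (fun b => P₂ b → Q₂ b) :=
  (h.not.or h').congr (fun a => by tauto) (fun a => by tauto)

theorem forall_finite {ι : Type*} [Finite ι] {P₁ : ι → (D →+* K₁) → Prop}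
    {P₂ : ι → (D →+* K₂) → Prop} (h : ∀ i, Transfers (P₁ i) (P₂ i)) :
    Transfers (fun a => ∀ i, P₁ i a) (fun b => ∀ i, P₂ i b) := by
  classical
  have := Fintype.ofFinite ι
  choose E hE using h
  refine ⟨Finset.univ.biUnion E, fun a b hab => forall_congr' fun i => hE i a b fun e he => ?_⟩
  exact hab e (Finset.mem_biUnion.2 ⟨i, Finset.mem_univ _, he⟩)

theorem exists_finite {ι : Type*} [Finite ι] {P₁ : ι → (D →+* K₁) → Prop}
    {P₂ : ι → (D →+* K₂) → Prop} (h : ∀ i, Transfers (P₁ i) (P₂ i)) :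
    Transfers (fun a => ∃ i, P₁ i a) (fun b => ∃ i, P₂ i b) :=
  (forall_finite fun i => (h i).not).not.congr (fun a => by simp) (fun a => by simp)

theorem sign_eq (d : D) (σ : SignType) : Transfers (fun a : D →+* K₁ => SignType.sign (a d) = σ)
    (fun b : D →+* K₂ => SignType.sign (b d) = σ) :=
  ⟨{d}, fun a b hab => Eq.congr_left (hab d (Finset.mem_singleton_self d))⟩

theorem eq_zero (d : D) : Transfers (fun a : D →+* K₁ => a d = 0) (fun b : D →+* K₂ => b d = 0) :=
  (sign_eq d 0).congr (fun a => sign_eq_zero_iff.symm) (fun a => sign_eq_zero_iff.symm)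

theorem pos (d : D) : Transfers (fun a : D →+* K₁ => 0 < a d) (fun b : D →+* K₂ => 0 < b d) :=
  (sign_eq d 1).congr (fun a => sign_eq_one_iff.symm) (fun a => sign_eq_one_iff.symm)

end Basic

/-- To prove that `∃ x, Γ x ∧ P x` transfers, one may replace `P` by sign conditions. -/
theorem exists_of_signs {D : Type u} [CommRing D] {ι : Type*} [Finite ι] (e : ι → D[X])
    {Γ₁ P₁ : (D →+* K₁) → K₁ → Prop} {Γ₂ P₂ : (D →+* K₂) → K₂ → Prop}
    (hP : ∀ a b x y, Γ₁ a x → Γ₂ b y →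
      (∀ i, SignType.sign (((e i).map a).eval x) = SignType.sign (((e i).map b).eval y)) →
      (P₁ a x ↔ P₂ b y))
    (h : ∀ τ : ι → SignType,
      Transfers (fun a => ∃ x, Γ₁ a x ∧ ∀ i, SignType.sign (((e i).map a).eval x) = τ i)
        (fun b => ∃ x, Γ₂ b x ∧ ∀ i, SignType.sign (((e i).map b).eval x) = τ i)) :
    Transfers (fun a => ∃ x, Γ₁ a x ∧ P₁ a x) (fun b => ∃ x, Γ₂ b x ∧ P₂ b x) := by
  classical
  have := Fintype.ofFinite ι
  choose F hF using h
  -- There are only finitely many sign vectors `τ`, so the union of the deciding sets is finite.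
  refine ⟨Finset.univ.biUnion F, fun a b hab => ?_⟩
  have hab' : ∀ τ, _ := fun τ => hF τ a b fun e he =>
    hab e (Finset.mem_biUnion.2 ⟨τ, Finset.mem_univ _, he⟩)
  constructor
  · rintro ⟨x, hx, hPx⟩
    obtain ⟨y, hy, hτ⟩ := (hab' fun i => SignType.sign (((e i).map a).eval x)).1
      ⟨x, hx, fun i => rfl⟩
    exact ⟨y, hy, (hP a b x y hx hy fun i => (hτ i).symm).1 hPx⟩
  · rintro ⟨y, hy, hPy⟩
    obtain ⟨x, hx, hτ⟩ := (hab' fun i => SignType.sign (((e i).map b).eval y)).2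
      ⟨y, hy, fun i => rfl⟩
    exact ⟨x, hx, (hP a b x y hx hy fun i => hτ i).2 hPy⟩

/-- Quantification over the roots of polynomials of degree less than `d`. -/
def RootClosed (K₁ : Type v₁) [Field K₁] [LinearOrder K₁] (K₂ : Type v₂) [Field K₂]
    [LinearOrder K₂] (d : ℕ) : Prop :=
  ∀ {D : Type u} [CommRing D] [Algebra ℚ D] (p : D[X]), p.natDegree < d →
    ∀ {P₁ : (D →+* K₁) → K₁ → Prop} {P₂ : (D →+* K₂) → K₂ → Prop},
    Transfers (D := D[X]) (fun h => P₁ (h.comp C) (h X)) (fun h => P₂ (h.comp C) (h X)) →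
    Transfers (fun a => ∃ x, p.map a ≠ 0 ∧ (p.map a).eval x = 0 ∧ P₁ a x)
      (fun b => ∃ x, p.map b ≠ 0 ∧ (p.map b).eval x = 0 ∧ P₂ b x)

section Terms

variable {D D' : Type u} [CommRing D] [CommRing D']

theorem eval_map_comp {K : Type*} [Field K] (f : D →+* D') (h : D' →+* K) (y : D') (e : D[X]) :
    (e.map (h.comp f)).eval (h y) = h (e.eval₂ f y) := by
  rw [hom_eval₂, eval_map]

theorem sign_eval (f : D →+* D') (y : D') (e : D[X]) (σ : SignType) :
    Transfers (fun h : D' →+* K₁ => SignType.sign ((e.map (h.comp f)).eval (h y)) = σ)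
      (fun h : D' →+* K₂ => SignType.sign ((e.map (h.comp f)).eval (h y)) = σ) := by
  simp only [eval_map_comp]
  exact sign_eq _ _

theorem eval_eq_zero (f : D →+* D') (y : D') (e : D[X]) :
    Transfers (fun h : D' →+* K₁ => (e.map (h.comp f)).eval (h y) = 0)
      (fun h : D' →+* K₂ => (e.map (h.comp f)).eval (h y) = 0) := by
  simp only [eval_map_comp]
  exact eq_zero _

theorem lt (x y : D) : Transfers (fun h : D →+* K₁ => h x < h y) (fun h : D →+* K₂ => h x < h y) :=
  (pos (y - x)).congr (fun a => by simp) (fun a => by simp)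

theorem mul_eval_neg (f : D →+* D') (x y : D') (e : D[X]) :
    Transfers (fun h : D' →+* K₁ =>
      (e.map (h.comp f)).eval (h x) * (e.map (h.comp f)).eval (h y) < 0)
      (fun h : D' →+* K₂ => (e.map (h.comp f)).eval (h x) * (e.map (h.comp f)).eval (h y) < 0) := by
  simp only [eval_map_comp]
  exact (lt (e.eval₂ f x * e.eval₂ f y) 0).congr (fun a => by simp) (fun a => by simp)

/-- The reason for assuming `Algebra ℚ D`: midpoints, which occur as test points, are values of ring
elements. -/
theorem map_half [Algebra ℚ D] {K : Type*} [Field K] [CharZero K] (h : D →+* K) (x y : D) :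
    h (algebraMap ℚ D (1 / 2) * (x + y)) = (h x + h y) / 2 := by
  have : h (algebraMap ℚ D (1 / 2)) = 1 / 2 := by
    have h2 : algebraMap ℚ D (1 / 2) * 2 = 1 := by
      rw [← map_ofNat (algebraMap ℚ D) 2, ← _root_.map_mul]
      norm_num
    have h3 := congrArg h h2
    rw [_root_.map_mul, map_ofNat, _root_.map_one] at h3
    field_simp
    exact h3
  rw [_root_.map_mul, _root_.map_add, this]
  ring

/-- Needed for nested quantifiers: the polynomial has coefficients in the original ring `D`, while
the parameter ring `D'` already contains the variables quantified further out. -/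
theorem RootClosed.exists_root {d : ℕ} (H : RootClosed.{u} K₁ K₂ d) [Algebra ℚ D'] (f : D →+* D')
    {p : D[X]} (hp : p.natDegree < d)
    {P₁ : (D' →+* K₁) → K₁ → Prop} {P₂ : (D' →+* K₂) → K₂ → Prop}
    (h : Transfers (D := D'[X]) (fun h => P₁ (h.comp C) (h X)) (fun h => P₂ (h.comp C) (h X))) :
    Transfers (fun a => ∃ x, p.map (a.comp f) ≠ 0 ∧ (p.map (a.comp f)).eval x = 0 ∧ P₁ a x)
      (fun b => ∃ x, p.map (b.comp f) ≠ 0 ∧ (p.map (b.comp f)).eval x = 0 ∧ P₂ b x) := by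
  have := H (p.map f) (natDegree_map_le.trans_lt hp) h
  simpa only [Polynomial.map_map] using this

end Terms

end Transfers

end RealClosed

/-! ### Elimination of one quantifier. -/

namespace RealClosed

universe u v₁ v₂

variable {K₁ : Type v₁} [Field K₁] [LinearOrder K₁] [IsStrictOrderedRing K₁]
variable {K₂ : Type v₂} [Field K₂] [LinearOrder K₂] [IsStrictOrderedRing K₂]

namespace Transfers

/-- A homomorphism from `D[X]` to a field is a homomorphism from `D` together with a value for `X`.
-/
theorem exists_signs {D : Type u} [CommRing D] {P₁ : (D →+* K₁) → K₁ → Prop}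
    {P₂ : (D →+* K₂) → K₂ → Prop}
    (h : Transfers (D := D[X]) (fun h => P₁ (h.comp C) (h X)) (fun h => P₂ (h.comp C) (h X))) :
    ∃ E : Finset D[X], ∀ a b x y,
      (∀ q ∈ E, SignType.sign ((q.map a).eval x) = SignType.sign ((q.map b).eval y)) →
      (P₁ a x ↔ P₂ b y) := by
  obtain ⟨E, hE⟩ := h
  refine ⟨E, fun a b x y hab => ?_⟩
  have h1 := hE (eval₂RingHom a x) (eval₂RingHom b y) (by simpa [eval_map] using hab)
  have e1 : (eval₂RingHom a x).comp C = a := by ext; simp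
  have e2 : (eval₂RingHom b y).comp C = b := by ext; simp
  simpa only [e1, e2, coe_eval₂RingHom, eval₂_X] using h1

theorem sign_eval_half {D D' : Type u} [CommRing D] [CommRing D'] [Algebra ℚ D'] (f : D →+* D')
    (x y : D') (e : D[X]) (σ : SignType) :
    Transfers (fun h : D' →+* K₁ => SignType.sign ((e.map (h.comp f)).eval ((h x + h y) / 2)) = σ)
      (fun h : D' →+* K₂ => SignType.sign ((e.map (h.comp f)).eval ((h x + h y) / 2)) = σ) := by
  simp only [← map_half]
  exact sign_eval f _ e σ

/-- The sign of a polynomial at a root of `p` is the sign of its pseudo-remainder. -/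
theorem sign_eval_eq_of_pseudo_division {K : Type*} [Field K] [LinearOrder K]
    [IsStrictOrderedRing K] {D : Type*} [CommRing D] (a : D →+* K) {p q s r : D[X]} {l : D} {k : ℕ}
    (h : C (l ^ (2 * k)) * q = p * s + r) (hl : a l ≠ 0) {x : K} (hx : (p.map a).eval x = 0) :
    SignType.sign ((q.map a).eval x) = SignType.sign ((r.map a).eval x) := by
  have h1 := congrArg (fun t => (Polynomial.map a t).eval x) h
  simp only [Polynomial.map_mul, Polynomial.map_add, eval_mul, eval_add, hx, zero_mul, zero_add,
    map_C, eval_C, RingHom.map_pow a] at h1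
  have h2 : 0 < a l ^ (2 * k) := by
    rw [pow_mul]
    positivity
  rw [← h1, sign_mul, sign_pos h2, one_mul]

variable [IsRealClosed K₁] [IsRealClosed K₂]

/-- Remainders modulo a linear polynomial are constants, so their signs no longer involve the root.
-/
theorem exists_root_of_natDegree_eq_one {D : Type u} [CommRing D] {p : D[X]}
    (hp : p.natDegree = 1) {P₁ : (D →+* K₁) → K₁ → Prop} {P₂ : (D →+* K₂) → K₂ → Prop}
    (h : Transfers (D := D[X]) (fun h => P₁ (h.comp C) (h X)) (fun h => P₂ (h.comp C) (h X))) :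
    Transfers (fun a => ∃ x, (a (p.coeff 1) ≠ 0 ∧ (p.map a).eval x = 0) ∧ P₁ a x)
      (fun b => ∃ x, (b (p.coeff 1) ≠ 0 ∧ (p.map b).eval x = 0) ∧ P₂ b x) := by
  obtain ⟨E, hE⟩ := exists_signs h
  choose k s r hr hrd using exists_pseudo_division p hp one_ne_zero
  refine exists_of_signs (fun q : E => r q) ?_ fun τ => ?_
  · rintro a b x y ⟨ha, hx⟩ ⟨hb, hy⟩ hs
    refine hE a b x y fun q hq => ?_
    rw [sign_eval_eq_of_pseudo_division a (hr q) ha hx,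
      sign_eval_eq_of_pseudo_division b (hr q) hb hy]
    exact hs ⟨q, hq⟩
  · refine ((eq_zero (p.coeff 1)).not.and
      (forall_finite fun q : E => sign_eq ((r q).coeff 0) (τ q))).congr ?_ ?_ <;>
    · intro a
      have hc : ∀ q : E, ∀ x, ((r q).map a).eval x = a ((r q).coeff 0) := by
        intro q x
        rw [eq_C_of_natDegree_eq_zero (show (r q).natDegree = 0 by have := hrd q; omega)]
        simp
      simp only [hc]
      constructor
      · rintro ⟨x, ⟨h1, -⟩, h2⟩
        exact ⟨h1, h2⟩
      · rintro ⟨h1, h2⟩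
        refine ⟨-a (p.coeff 0) / a (p.coeff 1), ⟨h1, ?_⟩, h2⟩
        rw [eq_X_add_C_of_natDegree_le_one hp.le]
        simp
        field_simp
        ring

/-- The bound of `abs_mul_lt_of_root`. -/
def rootBound {D : Type*} [CommRing D] (p : D[X]) : D :=
  (p.coeff p.natDegree) ^ 2 +
    ∑ i ∈ Finset.range p.natDegree, ((p.coeff i) ^ 2 + (p.coeff p.natDegree) ^ 2)

theorem root_mem_Ioo {K : Type*} [Field K] [LinearOrder K] [IsStrictOrderedRing K] {D : Type*}
    [CommRing D] (a : D →+* K) {p : D[X]} (hp : p.natDegree ≠ 0)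
    (hl : a (p.coeff p.natDegree) ≠ 0) {x : K} (hx : (p.map a).eval x = 0) :
    -(a (rootBound p) / a (p.coeff p.natDegree) ^ 2) < x ∧
      x < a (rootBound p) / a (p.coeff p.natDegree) ^ 2 := by
  have hd : (p.map a).natDegree = p.natDegree := natDegree_map_of_leadingCoeff_ne_zero a hl
  have h := abs_mul_lt_of_root hd hp hx
  simp only [coeff_map] at h
  have h2 : 0 < a (p.coeff p.natDegree) ^ 2 := by positivity
  have h3 : |x| < a (rootBound p) / a (p.coeff p.natDegree) ^ 2 := by
    rw [lt_div_iff₀ h2, mul_comm]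
    simpa [rootBound] using h
  exact abs_lt.1 h3

/-- The two linear polynomials have the roots `∓` the root bound, which enclose all roots of `p`;
with the derivative they supply the hypotheses of `exists_root_sign_iff`. -/
theorem exists_root_map_sign_iff {K : Type*} [Field K] [LinearOrder K] [IsStrictOrderedRing K]
    [IsRealClosed K] {D : Type*} [CommRing D] (a : D →+* K) {p : D[X]} {d : ℕ}
    (hp : p.natDegree = d) (hd : d ≠ 0) (ha : a (p.coeff d) ≠ 0) {ι : Type*} [Finite ι]
    (e : ι → D[X]) (τ : ι → SignType) {i₀ i₁ i₂ : ι} (h₀ : e i₀ = derivative p)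
    (h₁ : e i₁ = C (p.coeff d ^ 2) * X + C (rootBound p))
    (h₂ : e i₂ = C (p.coeff d ^ 2) * X - C (rootBound p)) :
    (∃ x, (p.map a).eval x = 0 ∧ ∀ i, SignType.sign (((e i).map a).eval x) = τ i) ↔
    (∃ i, ∃ x, (e i).map a ≠ 0 ∧ ((e i).map a).eval x = 0 ∧ (p.map a).eval x = 0 ∧
      ∀ i, SignType.sign (((e i).map a).eval x) = τ i) ∨
    (∃ i j, ∃ u, (e i).map a ≠ 0 ∧ ((e i).map a).eval u = 0 ∧
      ∃ v, (e j).map a ≠ 0 ∧ ((e j).map a).eval v = 0 ∧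
      u < v ∧ (p.map a).eval u * (p.map a).eval v < 0 ∧
      (∀ i, SignType.sign (((e i).map a).eval ((u + v) / 2)) = τ i) ∧
      ¬ ∃ k, ∃ w, (e k).map a ≠ 0 ∧ ((e k).map a).eval w = 0 ∧ u < w ∧ w < v) := by
  have hlin : ∀ y : D, (C (p.coeff d ^ 2) * X + C y).map a ≠ 0 := by
    intro y h0
    have h1 := congrArg (fun t => coeff t 1) h0
    simp only [coeff_map, coeff_add, coeff_C_mul, coeff_X_one, mul_one, coeff_C, one_ne_zero,
      if_false, add_zero, coeff_zero] at h1
    rw [RingHom.map_pow] at h1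
    exact ha (pow_eq_zero_iff two_ne_zero |>.1 h1)
  have hbd := fun x hx => root_mem_Ioo a (p := p) (by omega) (by rwa [hp]) (x := x) hx
  rw [hp] at hbd
  refine exists_root_sign_iff (p.map a) (fun i => (e i).map a) τ ⟨i₀, by rw [h₀, derivative_map]⟩
    ?_ ⟨i₁, ?_, -(a (rootBound p) / a (p.coeff d) ^ 2), ?_, fun x hx => (hbd x hx).1⟩
    ⟨i₂, ?_, a (rootBound p) / a (p.coeff d) ^ 2, ?_, fun x hx => (hbd x hx).2⟩
  · intro h0
    have h1 := congrArg (fun t => coeff t (d - 1)) h0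
    simp only [coeff_derivative, coeff_map, coeff_zero] at h1
    rw [show d - 1 + 1 = d by omega] at h1
    exact (mul_ne_zero ha (by positivity)) h1
  · rw [h₁]
    exact hlin _
  · rw [h₁]
    simp only [Polynomial.map_add, Polynomial.map_mul, map_C, map_X, eval_add, eval_mul, eval_C,
      eval_X, RingHom.map_pow a]
    field_simp
    ring
  · rw [h₂, sub_eq_add_neg, ← C_neg]
    exact hlin _
  · rw [h₂]
    simp only [Polynomial.map_sub, Polynomial.map_mul, map_C, map_X, eval_sub, eval_mul, eval_C,
      eval_X, RingHom.map_pow a]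
    field_simp
    ring

theorem exists_and_and_iff {α : Type*} {p s : Prop} {q r : α → Prop}
    (h : p → ((∃ x, q x ∧ r x) ↔ s)) : (∃ x, (p ∧ q x) ∧ r x) ↔ p ∧ s :=
  ⟨fun ⟨x, ⟨h1, h2⟩, h3⟩ => ⟨h1, (h h1).1 ⟨x, h2, h3⟩⟩, fun ⟨h1, h2⟩ =>
    let ⟨x, hx, hs⟩ := (h h1).2 h2
    ⟨x, ⟨h1, hx⟩, hs⟩⟩

/-- At a root of `p` the deciding polynomials may be replaced by their remainders modulo `p`. With
the derivative and the two linear bounds added, all of them have degree less than `d` (for the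
bounds this needs `2 ≤ d`), so `exists_root_sign_iff` leaves only quantifiers over roots of lower
degree. -/
theorem exists_root_of_rootClosed {d : ℕ} (hd : 2 ≤ d) (H : RootClosed.{u} K₁ K₂ d)
    {D : Type u} [CommRing D] [Algebra ℚ D] {p : D[X]}
    (hp : p.natDegree = d) {P₁ : (D →+* K₁) → K₁ → Prop} {P₂ : (D →+* K₂) → K₂ → Prop}
    (h : Transfers (D := D[X]) (fun h => P₁ (h.comp C) (h X)) (fun h => P₂ (h.comp C) (h X))) :
    Transfers (fun a => ∃ x, (a (p.coeff d) ≠ 0 ∧ (p.map a).eval x = 0) ∧ P₁ a x)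
      (fun b => ∃ x, (b (p.coeff d) ≠ 0 ∧ (p.map b).eval x = 0) ∧ P₂ b x) := by
  obtain ⟨E, hE⟩ := exists_signs h
  choose k s r hr hrd using exists_pseudo_division p hp (by omega)
  let c : Fin 3 → D[X] := ![derivative p, C (p.coeff d ^ 2) * X + C (rootBound p),
    C (p.coeff d ^ 2) * X - C (rootBound p)]
  let e : E ⊕ Fin 3 → D[X] := Sum.elim (fun q : E => r q) c
  have he : ∀ i, (e i).natDegree < d := by
    rintro (q | i)
    · exact hrd q
    · have hlin : ∀ y : D, (C (p.coeff d ^ 2) * X + C y).natDegree < d := fun y =>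
        natDegree_linear_le.trans_lt (by omega)
      fin_cases i
      · refine (natDegree_derivative_le p).trans_lt (by omega)
      · exact hlin _
      · have := hlin (-rootBound p)
        rwa [C_neg, ← sub_eq_add_neg] at this
  refine exists_of_signs e ?_ fun τ => ?_
  · rintro a b x y ⟨ha, hx⟩ ⟨hb, hy⟩ hs
    refine hE a b x y fun q hq => ?_
    rw [sign_eval_eq_of_pseudo_division a (hr q) ha hx,
      sign_eval_eq_of_pseudo_division b (hr q) hb hy]
    exact hs (Sum.inl ⟨q, hq⟩)
  refine Transfers.congr ((eq_zero (p.coeff d)).not.and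
    (Transfers.or (exists_finite fun i => ?_)
      (exists_finite fun i => exists_finite fun j => ?_)))
    (fun a => exists_and_and_iff fun ha => exists_root_map_sign_iff a hp (by omega) ha e τ
      (i₀ := Sum.inr 0) (i₁ := Sum.inr 1) (i₂ := Sum.inr 2) rfl rfl rfl)
    (fun a => exists_and_and_iff fun ha => exists_root_map_sign_iff a hp (by omega) ha e τ
      (i₀ := Sum.inr 0) (i₁ := Sum.inr 1) (i₂ := Sum.inr 2) rfl rfl rfl)
  · refine H (e i) (he i) ?_
    exact (eval_eq_zero C X p).and (forall_finite fun k => sign_eval C X (e k) _)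
  · refine H (e i) (he i) ?_
    refine H.exists_root C (he j) ?_
    refine Transfers.and ?_ (Transfers.and ?_ (Transfers.and (forall_finite fun k => ?_)
      (Transfers.not (exists_finite fun k => ?_))))
    · exact lt (C X) X
    · exact mul_eval_neg (C.comp C) (C X) X p
    · exact sign_eval_half (C.comp C) (C X) X (e k) (τ k)
    · refine H.exists_root (C.comp C) (he k) ?_
      exact Transfers.and (lt (C (C X)) X) (lt X (C X))

/-- Induction on the degree. Where the leading coefficient vanishes, `p` may be replaced by
`p.eraseLead`; elsewhere the root is explicit in degree 1 and `exists_root_of_rootClosed` reduces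
the degree. -/
theorem rootClosed (d : ℕ) : RootClosed.{u} K₁ K₂ d := by
  induction d with
  | zero => exact fun p hp => absurd hp (Nat.not_lt_zero _)
  | succ d ih =>
    intro D _ _ p hp P₁ P₂ h
    rcases Nat.lt_succ_iff_lt_or_eq.1 hp with hlt | heq
    · exact ih p hlt h
    rcases Nat.eq_zero_or_pos d with rfl | hpos
    · refine (const False).congr ?_ ?_ <;>
      · intro a
        rw [eq_C_of_natDegree_eq_zero heq]
        simp only [map_C, eval_C, C_ne_zero, iff_false]
        rintro ⟨x, h1, h2, -⟩
        exact h1 h2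
    have h1 : Transfers (fun a => ∃ x, (a (p.coeff d) ≠ 0 ∧ (p.map a).eval x = 0) ∧ P₁ a x)
        (fun b => ∃ x, (b (p.coeff d) ≠ 0 ∧ (p.map b).eval x = 0) ∧ P₂ b x) := by
      by_cases hd : d = 1
      · subst hd
        exact exists_root_of_natDegree_eq_one heq h
      · exact exists_root_of_rootClosed (by omega) ih heq h
    have h2 := ih p.eraseLead
      ((eraseLead_natDegree_le p).trans_lt (by omega)) h
    refine (h1.or ((eq_zero (p.coeff d)).and h2)).congr ?_ ?_ <;>
    · intro a
      by_cases ha : a (p.coeff d) = 0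
      · have hmap : p.map a = p.eraseLead.map a := by
          conv_lhs => rw [← eraseLead_add_monomial_natDegree_leadingCoeff p]
          rw [leadingCoeff, heq, Polynomial.map_add, map_monomial, ha, monomial_zero_right,
            add_zero]
        rw [← hmap]
        simp [ha]
      · have hmap : p.map a ≠ 0 := by
          intro h0
          apply ha
          rw [← coeff_map, h0, coeff_zero]
        simp [ha, hmap]

/-- Elimination of one quantifier. -/
theorem exists_elim {D : Type u} [CommRing D] [Algebra ℚ D]
    {P₁ : (D →+* K₁) → K₁ → Prop} {P₂ : (D →+* K₂) → K₂ → Prop}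
    (h : Transfers (D := D[X]) (fun h => P₁ (h.comp C) (h X)) (fun h => P₂ (h.comp C) (h X))) :
    Transfers (fun a => ∃ x, P₁ a x) (fun b => ∃ x, P₂ b x) := by
  obtain ⟨E, hE⟩ := exists_signs h
  let e : E → D[X] := fun q => q
  have main : Transfers (fun a => ∃ x, True ∧ P₁ a x) (fun b => ∃ x, True ∧ P₂ b x) := by
    refine exists_of_signs e (fun a b x y _ _ hs => hE a b x y fun q hq => hs ⟨q, hq⟩)
      fun τ => ?_
    obtain ⟨d, hd⟩ : ∃ d, ∀ q : E, (e q).natDegree < d :=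
      ⟨E.sup natDegree + 1, fun q => Nat.lt_succ_of_le (Finset.le_sup (f := natDegree) q.2)⟩
    have H : RootClosed.{u} K₁ K₂ d := rootClosed d
    refine Transfers.congr (Transfers.or (exists_finite fun i => ?_)
      (Transfers.or (exists_finite fun i => exists_finite fun j => ?_) ?_))
      (fun a => exists_sign_iff (fun i => (e i).map a) τ)
      (fun a => exists_sign_iff (fun i => (e i).map a) τ)
    · refine H (e i) (hd i) (Transfers.or (forall_finite fun k => sign_eval C X (e k) _)
        (Transfers.or (forall_finite fun k => ?_) (forall_finite fun k => ?_)))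
      · exact (sign_eval C (X + 1) (e k) (τ k)).congr (fun a => by simp) (fun a => by simp)
      · exact (sign_eval C (X - 1) (e k) (τ k)).congr (fun a => by simp) (fun a => by simp)
    · refine H (e i) (hd i) (H.exists_root C (hd j) ?_)
      exact forall_finite fun k => sign_eval_half (C.comp C) (C X) X (e k) _
    · refine forall_finite fun k => ?_
      exact (sign_eval (RingHom.id D) 0 (e k) (τ k)).congr (fun a => by simp) (fun a => by simp)
  simpa only [true_and] using main

end Transfers

end RealClosed

/-! ### Definable predicates on tuples and the transfer principle. -/

namespace RealClosed

universe v₁ v₂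

variable {K₁ : Type v₁} [Field K₁] [LinearOrder K₁] [IsStrictOrderedRing K₁]
variable {K₂ : Type v₂} [Field K₂] [LinearOrder K₂] [IsStrictOrderedRing K₂]

theorem Transfers.comap {D D' : Type} [CommRing D] [CommRing D'] {P₁ : (D →+* K₁) → Prop}
    {P₂ : (D →+* K₂) → Prop} (h : Transfers P₁ P₂) (g : D →+* D') :
    Transfers (fun a => P₁ (a.comp g)) (fun b => P₂ (b.comp g)) := by
  classical
  obtain ⟨E, hE⟩ := h
  exact ⟨E.image g, fun a b hab => hE _ _ fun e he => hab _ (Finset.mem_image_of_mem g he)⟩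

variable {k : Type} [CommRing k] {ι : Type}

/-- A pair of predicates on tuples indexed by `ι` that is definable by the same formula
with parameters in `k`. -/
def Definable (P₁ : (k →+* K₁) → (ι → K₁) → Prop) (P₂ : (k →+* K₂) → (ι → K₂) → Prop) : Prop :=
  Transfers (D := MvPolynomial ι k) (fun h => P₁ (h.comp MvPolynomial.C) fun i => h (.X i))
    (fun h => P₂ (h.comp MvPolynomial.C) fun i => h (.X i))

/-- A pair of functions on tuples that is given by the same polynomial with coefficients
in `k`. -/
def IsTerm (t₁ : (k →+* K₁) → (ι → K₁) → K₁) (t₂ : (k →+* K₂) → (ι → K₂) → K₂) : Prop :=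
  ∃ p : MvPolynomial ι k, (∀ φ x, t₁ φ x = p.eval₂ φ x) ∧ (∀ φ x, t₂ φ x = p.eval₂ φ x)

namespace IsTerm

variable {s₁ t₁ : (k →+* K₁) → (ι → K₁) → K₁} {s₂ t₂ : (k →+* K₂) → (ι → K₂) → K₂}

theorem var (i : ι) : IsTerm (k := k) (fun _ x => (x i : K₁)) (fun _ x => (x i : K₂)) :=
  ⟨.X i, by simp, by simp⟩

theorem const (c : k) : IsTerm (ι := ι) (fun φ _ => (φ c : K₁)) (fun φ _ => (φ c : K₂)) :=
  ⟨.C c, by simp, by simp⟩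

protected theorem add (hs : IsTerm s₁ s₂) (ht : IsTerm t₁ t₂) :
    IsTerm (fun φ x => s₁ φ x + t₁ φ x) (fun φ x => s₂ φ x + t₂ φ x) := by
  obtain ⟨p, hp₁, hp₂⟩ := hs
  obtain ⟨q, hq₁, hq₂⟩ := ht
  exact ⟨p + q, fun φ x => by beta_reduce; rw [hp₁, hq₁, MvPolynomial.eval₂_add],
    fun φ x => by beta_reduce; rw [hp₂, hq₂, MvPolynomial.eval₂_add]⟩

protected theorem mul (hs : IsTerm s₁ s₂) (ht : IsTerm t₁ t₂) :
    IsTerm (fun φ x => s₁ φ x * t₁ φ x) (fun φ x => s₂ φ x * t₂ φ x) := by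
  obtain ⟨p, hp₁, hp₂⟩ := hs
  obtain ⟨q, hq₁, hq₂⟩ := ht
  exact ⟨p * q, fun φ x => by beta_reduce; rw [hp₁, hq₁, MvPolynomial.eval₂_mul],
    fun φ x => by beta_reduce; rw [hp₂, hq₂, MvPolynomial.eval₂_mul]⟩

protected theorem sub (hs : IsTerm s₁ s₂) (ht : IsTerm t₁ t₂) :
    IsTerm (fun φ x => s₁ φ x - t₁ φ x) (fun φ x => s₂ φ x - t₂ φ x) := by
  obtain ⟨p, hp₁, hp₂⟩ := hs
  obtain ⟨q, hq₁, hq₂⟩ := ht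
  refine ⟨p - q, fun φ x => ?_, fun φ x => ?_⟩
  · beta_reduce
    rw [hp₁, hq₁]
    exact (map_sub (MvPolynomial.eval₂Hom φ x) p q).symm
  · beta_reduce
    rw [hp₂, hq₂]
    exact (map_sub (MvPolynomial.eval₂Hom φ x) p q).symm

protected theorem sum {α : Type*} (S : Finset α) {t₁ : α → (k →+* K₁) → (ι → K₁) → K₁}
    {t₂ : α → (k →+* K₂) → (ι → K₂) → K₂} (h : ∀ j, IsTerm (t₁ j) (t₂ j)) :
    IsTerm (fun φ x => ∑ j ∈ S, t₁ j φ x) (fun φ x => ∑ j ∈ S, t₂ j φ x) := by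
  choose p hp₁ hp₂ using h
  exact ⟨∑ j ∈ S, p j, fun φ x => by simp only [hp₁, MvPolynomial.eval₂_sum],
    fun φ x => by simp only [hp₂, MvPolynomial.eval₂_sum]⟩

theorem eval₂ {σ : Type} (f : σ → ι) (p : MvPolynomial σ k) :
    IsTerm (fun φ x => (p.eval₂ φ fun s => x (f s) : K₁))
      (fun φ x => (p.eval₂ φ fun s => x (f s) : K₂)) :=
  ⟨MvPolynomial.rename f p, fun φ x => by rw [MvPolynomial.eval₂_rename]; rfl,
    fun φ x => by rw [MvPolynomial.eval₂_rename]; rfl⟩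

end IsTerm

namespace Definable

section Basic

variable {P₁ Q₁ : (k →+* K₁) → (ι → K₁) → Prop} {P₂ Q₂ : (k →+* K₂) → (ι → K₂) → Prop}

theorem congr (h : Definable P₁ P₂) (h₁ : ∀ φ x, Q₁ φ x ↔ P₁ φ x) (h₂ : ∀ φ x, Q₂ φ x ↔ P₂ φ x) :
    Definable Q₁ Q₂ :=
  Transfers.congr h (fun _ => h₁ _ _) (fun _ => h₂ _ _)

theorem const (p : Prop) : Definable (fun (_ : k →+* K₁) (_ : ι → K₁) => p)
    (fun (_ : k →+* K₂) (_ : ι → K₂) => p) :=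
  Transfers.const p

protected theorem not (h : Definable P₁ P₂) :
    Definable (fun φ x => ¬ P₁ φ x) (fun φ x => ¬ P₂ φ x) :=
  Transfers.not h

protected theorem and (h : Definable P₁ P₂) (h' : Definable Q₁ Q₂) :
    Definable (fun φ x => P₁ φ x ∧ Q₁ φ x) (fun φ x => P₂ φ x ∧ Q₂ φ x) :=
  Transfers.and h h'

protected theorem imp (h : Definable P₁ P₂) (h' : Definable Q₁ Q₂) :
    Definable (fun φ x => P₁ φ x → Q₁ φ x) (fun φ x => P₂ φ x → Q₂ φ x) :=
  Transfers.imp h h'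

theorem forall_finite {α : Type*} [Finite α] {P₁ : α → (k →+* K₁) → (ι → K₁) → Prop}
    {P₂ : α → (k →+* K₂) → (ι → K₂) → Prop} (h : ∀ i, Definable (P₁ i) (P₂ i)) :
    Definable (fun φ x => ∀ i, P₁ i φ x) (fun φ x => ∀ i, P₂ i φ x) :=
  Transfers.forall_finite h

theorem exists_finite {α : Type*} [Finite α] {P₁ : α → (k →+* K₁) → (ι → K₁) → Prop}
    {P₂ : α → (k →+* K₂) → (ι → K₂) → Prop} (h : ∀ i, Definable (P₁ i) (P₂ i)) :
    Definable (fun φ x => ∃ i, P₁ i φ x) (fun φ x => ∃ i, P₂ i φ x) :=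
  Transfers.exists_finite h

theorem apply_eval₂ {K : Type*} [Field K] (h : MvPolynomial ι k →+* K) (p : MvPolynomial ι k) :
    p.eval₂ (h.comp MvPolynomial.C) (fun i => h (.X i)) = h p := by
  have : MvPolynomial.eval₂Hom (h.comp MvPolynomial.C) (fun i => h (.X i)) = h :=
    MvPolynomial.ringHom_ext (by simp) (by simp)
  exact congrArg (fun g => g p) this

theorem pos {t₁ : (k →+* K₁) → (ι → K₁) → K₁} {t₂ : (k →+* K₂) → (ι → K₂) → K₂}
    (h : IsTerm t₁ t₂) : Definable (fun φ x => 0 < t₁ φ x) (fun φ x => 0 < t₂ φ x) := by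
  obtain ⟨p, hp₁, hp₂⟩ := h
  refine Transfers.congr (Transfers.pos p) (fun h => ?_) (fun h => ?_)
  · beta_reduce
    rw [hp₁, apply_eval₂]
  · beta_reduce
    rw [hp₂, apply_eval₂]

theorem nonneg {t₁ : (k →+* K₁) → (ι → K₁) → K₁} {t₂ : (k →+* K₂) → (ι → K₂) → K₂}
    (h : IsTerm t₁ t₂) : Definable (fun φ x => 0 ≤ t₁ φ x) (fun φ x => 0 ≤ t₂ φ x) := by
  obtain ⟨p, hp₁, hp₂⟩ := h
  refine Transfers.congr (Transfers.not (Transfers.lt p 0)) (fun h => ?_) (fun h => ?_)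
  · beta_reduce
    rw [hp₁, apply_eval₂, map_zero, not_lt]
  · beta_reduce
    rw [hp₂, apply_eval₂, map_zero, not_lt]

theorem eq_zero {t₁ : (k →+* K₁) → (ι → K₁) → K₁} {t₂ : (k →+* K₂) → (ι → K₂) → K₂}
    (h : IsTerm t₁ t₂) : Definable (fun φ x => t₁ φ x = 0) (fun φ x => t₂ φ x = 0) := by
  obtain ⟨p, hp₁, hp₂⟩ := h
  refine Transfers.congr (Transfers.eq_zero p) (fun h => ?_) (fun h => ?_)
  · beta_reduce
    rw [hp₁, apply_eval₂]
  · beta_reduce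
    rw [hp₂, apply_eval₂]

theorem eq {s₁ t₁ : (k →+* K₁) → (ι → K₁) → K₁} {s₂ t₂ : (k →+* K₂) → (ι → K₂) → K₂}
    (hs : IsTerm s₁ s₂) (ht : IsTerm t₁ t₂) :
    Definable (fun φ x => s₁ φ x = t₁ φ x) (fun φ x => s₂ φ x = t₂ φ x) :=
  (eq_zero (hs.sub ht)).congr (fun _ _ => sub_eq_zero.symm) (fun _ _ => sub_eq_zero.symm)

theorem reindex {κ : Type} (f : ι → κ) (h : Definable P₁ P₂) :
    Definable (fun φ x => P₁ φ fun i => x (f i)) (fun φ x => P₂ φ fun i => x (f i)) := by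
  have h1 := Transfers.comap h (MvPolynomial.rename f : MvPolynomial ι k →ₐ[k] _).toRingHom
  have h2 : (MvPolynomial.rename f : MvPolynomial ι k →ₐ[k] _).toRingHom.comp MvPolynomial.C =
      MvPolynomial.C := by
    ext r
    simp
  refine h1.congr (fun a => ?_) (fun a => ?_) <;>
  · beta_reduce
    rw [RingHom.comp_assoc, h2]
    simp

end Basic

variable [Algebra ℚ k] [IsRealClosed K₁] [IsRealClosed K₂]

theorem exists_option {P₁ : (k →+* K₁) → (ι → K₁) → K₁ → Prop}
    {P₂ : (k →+* K₂) → (ι → K₂) → K₂ → Prop}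
    (h : Definable (ι := Option ι) (fun φ w => P₁ φ (fun i => w (some i)) (w none))
      (fun φ w => P₂ φ (fun i => w (some i)) (w none))) :
    Definable (fun φ x => ∃ y, P₁ φ x y) (fun φ x => ∃ y, P₂ φ x y) := by
  let g : MvPolynomial (Option ι) k →+* Polynomial (MvPolynomial ι k) :=
    MvPolynomial.eval₂Hom (Polynomial.C.comp MvPolynomial.C)
      (fun o => o.elim Polynomial.X fun i => Polynomial.C (.X i))
  refine Transfers.exists_elim
    (P₁ := fun a y => P₁ (a.comp MvPolynomial.C) (fun i => a (.X i)) y)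
    (P₂ := fun a y => P₂ (a.comp MvPolynomial.C) (fun i => a (.X i)) y) ?_
  refine (Transfers.comap h g).congr (fun a => ?_) (fun a => ?_) <;>
  · apply iff_of_eq
    congr 1
    · ext r
      simp [g]
    · ext i
      simp [g]
    · simp [g]

/-- One coordinate at a time. The coordinate split off becomes a free variable for the induction
hypothesis, which is why `ι` is quantified inside. -/
theorem exists_tuple (σ : Type) [Finite σ] : ∀ {ι : Type}
    {P₁ : (k →+* K₁) → (ι → K₁) → (σ → K₁) → Prop}
    {P₂ : (k →+* K₂) → (ι → K₂) → (σ → K₂) → Prop},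
    Definable (ι := ι ⊕ σ) (fun φ w => P₁ φ (fun i => w (.inl i)) (fun s => w (.inr s)))
      (fun φ w => P₂ φ (fun i => w (.inl i)) (fun s => w (.inr s))) →
    Definable (fun φ x => ∃ z, P₁ φ x z) (fun φ x => ∃ z, P₂ φ x z) := by
  induction σ using Finite.induction_empty_option with
  | of_equiv e ih =>
    intro ι P₁ P₂ h
    have h1 := ih (P₁ := fun φ x z => P₁ φ x fun s => z (e.symm s))
      (P₂ := fun φ x z => P₂ φ x fun s => z (e.symm s)) (h.reindex (Sum.map id e.symm))
    refine h1.congr (fun φ x => ?_) (fun φ x => ?_) <;>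
    · constructor
      · rintro ⟨z, hz⟩
        exact ⟨fun s => z (e s), by simpa using hz⟩
      · rintro ⟨z, hz⟩
        exact ⟨_, hz⟩
  | h_empty =>
    intro ι P₁ P₂ h
    refine (h.reindex (Sum.elim id PEmpty.elim)).congr (fun φ x => ?_) (fun φ x => ?_) <;>
    · constructor
      · rintro ⟨z, hz⟩
        have hz' : z = fun e => e.elim := by
          ext e
          exact e.elim
        rw [hz'] at hz
        convert hz using 1
        · rfl
        · exact funext fun e => e.elim
      · intro hz
        exact ⟨_, hz⟩
  | h_option ih =>
    rename_i σ _
    intro ι P₁ P₂ h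
    have h1 := ih (ι := Option ι)
      (P₁ := fun φ x z => P₁ φ (fun i => x (some i)) fun o => o.elim (x none) z)
      (P₂ := fun φ x z => P₂ φ (fun i => x (some i)) fun o => o.elim (x none) z) (by
        refine (h.reindex (κ := Option ι ⊕ σ) (Sum.elim (fun i => .inl (some i))
          (fun o => o.elim (.inl none) .inr))).congr (fun φ x => ?_) (fun φ x => ?_) <;>
        · apply iff_of_eq
          congr 1
          ext o
          cases o <;> rfl)
    have h2 := exists_option (P₁ := fun φ x y => ∃ z : σ → K₁, P₁ φ x fun o => o.elim y z)
      (P₂ := fun φ x y => ∃ z : σ → K₂, P₂ φ x fun o => o.elim y z) h1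
    refine h2.congr (fun φ x => ?_) (fun φ x => ?_) <;>
    · constructor
      · rintro ⟨z, hz⟩
        refine ⟨z none, fun s => z (some s), ?_⟩
        convert hz using 1
        ext o
        cases o <;> rfl
      · rintro ⟨y, z, hz⟩
        exact ⟨_, hz⟩

theorem forall_tuple (σ : Type) [Finite σ] {ι : Type}
    {P₁ : (k →+* K₁) → (ι → K₁) → (σ → K₁) → Prop}
    {P₂ : (k →+* K₂) → (ι → K₂) → (σ → K₂) → Prop}
    (h : Definable (ι := ι ⊕ σ) (fun φ w => P₁ φ (fun i => w (.inl i)) (fun s => w (.inr s)))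
      (fun φ w => P₂ φ (fun i => w (.inl i)) (fun s => w (.inr s)))) :
    Definable (fun φ x => ∀ z, P₁ φ x z) (fun φ x => ∀ z, P₂ φ x z) :=
  (exists_tuple σ (P₁ := fun φ x z => ¬ P₁ φ x z) (P₂ := fun φ x z => ¬ P₂ φ x z) h.not).not.congr
    (fun _ _ => by simp) (fun _ _ => by simp)

/-- The transfer principle for sentences with real parameters. -/
theorem transfer {P₁ : (k →+* K₁) → Prop} {P₂ : (k →+* K₂) → Prop}
    (h : Definable (ι := Empty) (fun φ _ => P₁ φ) (fun φ _ => P₂ φ)) (φ : k →+* K₁)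
    (ψ : k →+* K₂) (hs : ∀ c, SignType.sign (φ c) = SignType.sign (ψ c)) : P₁ φ ↔ P₂ ψ := by
  obtain ⟨E, hE⟩ := h
  have h1 := hE (MvPolynomial.eval₂Hom φ Empty.elim) (MvPolynomial.eval₂Hom ψ Empty.elim) (by
    intro e _
    obtain ⟨c, rfl⟩ := MvPolynomial.C_surjective Empty e
    simpa using hs c)
  have e1 : (MvPolynomial.eval₂Hom φ (Empty.elim : Empty → K₁)).comp MvPolynomial.C = φ := by
    ext; simp
  have e2 : (MvPolynomial.eval₂Hom ψ (Empty.elim : Empty → K₂)).comp MvPolynomial.C = ψ := by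
    ext; simp
  simpa only [e1, e2] using h1

end Definable

/-- Real irreducible polynomials have degree at most 2, so a polynomial of odd degree has a linear
factor. -/
theorem isRealClosed_real : IsRealClosed ℝ := by
  refine .of_linearOrderedField (fun {x} hx => ⟨√x, (Real.mul_self_sqrt hx).symm⟩) ?_
  intro f hf
  induction f using WfDvdMonoid.induction_on_irreducible with
  | zero => simp at hf
  | unit u hu => simp [Polynomial.natDegree_eq_zero_of_isUnit hu] at hf
  | mul q p hq hp ih =>
    by_cases hq0 : Odd q.natDegree
    · obtain ⟨x, hx⟩ := ih hq0
      exact ⟨x, by simp [Polynomial.IsRoot.def.1 hx]⟩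
    · have h2 := hp.natDegree_le_two
      rw [Polynomial.natDegree_mul hp.ne_zero hq, Nat.odd_add, Nat.not_odd_iff_even] at *
      have h1 : p.natDegree = 1 := by
        have := hf.2 hq0
        rcases this with ⟨m, hm⟩
        omega
      obtain ⟨x, hx⟩ := Polynomial.exists_root_of_degree_eq_one
        (Polynomial.degree_eq_iff_natDegree_eq_of_pos one_pos |>.2 h1)
      exact ⟨x, by simp [Polynomial.IsRoot.def.1 hx]⟩

end RealClosed

/-! ### Orders of vanishing in terms of derivatives. -/

namespace AffineCurve

section Jets

variable {K : Type*} [Field K] {B : Type*} [CommRing B] [Algebra K B]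

/-- The first `k` derivatives of `f` along `D` vanish at the point `η`. -/
def JetVanish (D : Derivation K B B) (η : B →ₐ[K] K) (k : ℕ) (f : B) : Prop :=
  ∀ i < k, η (D^[i] f) = 0

variable {D : Derivation K B B} {η : B →ₐ[K] K} {k : ℕ} {f g : B}

theorem jetVanish_succ : JetVanish D η (k + 1) f ↔ η f = 0 ∧ JetVanish D η k (D f) := by
  constructor
  · intro h
    exact ⟨h 0 (Nat.succ_pos k), fun i hi => h (i + 1) (Nat.succ_lt_succ hi)⟩
  · rintro ⟨h0, h⟩ i hi
    cases i with
    | zero => exact h0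
    | succ i => exact h i (Nat.lt_of_succ_lt_succ hi)

theorem JetVanish.mono {l : ℕ} (h : JetVanish D η k f) (hl : l ≤ k) : JetVanish D η l f :=
  fun i hi => h i (hi.trans_le hl)

theorem JetVanish.add (hf : JetVanish D η k f) (hg : JetVanish D η k g) :
    JetVanish D η k (f + g) := fun i hi => by
  rw [iterate_map_add, map_add, hf i hi, hg i hi, add_zero]

theorem JetVanish.sub (hf : JetVanish D η k f) (hg : JetVanish D η k g) :
    JetVanish D η k (f - g) := fun i hi => by
  rw [iterate_map_sub, map_sub, hf i hi, hg i hi, sub_zero]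

theorem JetVanish.mul_left (a : B) (hf : JetVanish D η k f) : JetVanish D η k (a * f) := by
  induction k generalizing a f with
  | zero => exact fun i hi => absurd hi (Nat.not_lt_zero i)
  | succ k ih =>
    rw [jetVanish_succ]
    have h := jetVanish_succ.1 hf
    refine ⟨by rw [map_mul, h.1, mul_zero], ?_⟩
    rw [Derivation.leibniz, smul_eq_mul, smul_eq_mul, mul_comm f]
    exact (ih a h.2).add (ih (D a) (hf.mono (Nat.le_succ k)))

theorem derivation_mem_pow {m : Ideal B} (h : f ∈ m ^ (k + 1)) : D f ∈ m ^ k := by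
  induction k generalizing f with
  | zero => simp
  | succ k ih =>
    rw [pow_succ'] at h
    refine Submodule.mul_induction_on h (fun a ha b hb => ?_) (fun a b ha hb => ?_)
    · rw [Derivation.leibniz, smul_eq_mul, smul_eq_mul]
      refine add_mem ?_ (Ideal.mul_mem_right _ _ hb)
      rw [pow_succ']
      exact Ideal.mul_mem_mul ha (ih hb)
    · rw [map_add]
      exact add_mem ha hb

theorem JetVanish.of_mem_pow (h : f ∈ RingHom.ker η ^ k) : JetVanish D η k f := by
  induction k generalizing f with
  | zero => exact fun i hi => absurd hi (Nat.not_lt_zero i)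
  | succ k ih =>
    rw [jetVanish_succ]
    exact ⟨Ideal.pow_le_self (Nat.succ_ne_zero k) h, ih (derivation_mem_pow h)⟩

/-- Only those terms of the Leibniz expansion survive at `η` in which the `k` derivatives remove all
`k` factors `τ`. -/
theorem apply_iterate_mul_pow {τ : B} (hτ : η τ = 0) (hD : D τ = 1) (k : ℕ) (a : B) :
    η (D^[k] (a * τ ^ k)) = k.factorial * η a := by
  induction k generalizing a with
  | zero => simp
  | succ k ih =>
    have hm : τ ∈ RingHom.ker η := hτ
    have h1 : D (a * τ ^ (k + 1)) = D a * τ ^ (k + 1) + ((k + 1 : ℕ) * a) * τ ^ k := by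
      rw [Derivation.leibniz, Derivation.leibniz_pow, hD]
      simp
      ring
    rw [Function.iterate_succ_apply, h1, iterate_map_add, map_add, ih,
      JetVanish.of_mem_pow (Ideal.mul_mem_left _ _ (Ideal.pow_mem_pow hm (k + 1))) k
        (Nat.lt_succ_self k), Nat.factorial_succ]
    simp
    ring

/-- It suffices that `τ` generates the ideal modulo its square, which is all that the differentials
reveal at an `R`-rational point. -/
theorem ker_pow_le {τ : B} (hτ : η τ = 0)
    (hm : RingHom.ker η ≤ Ideal.span {τ} ⊔ RingHom.ker η ^ 2) (k : ℕ) :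
    RingHom.ker η ^ k ≤ Ideal.span {τ ^ k} ⊔ RingHom.ker η ^ (k + 1) := by
  induction k with
  | zero => simp
  | succ k ih =>
    calc RingHom.ker η ^ (k + 1) = RingHom.ker η * RingHom.ker η ^ k := pow_succ' _ _
      _ ≤ RingHom.ker η * (Ideal.span {τ ^ k} ⊔ RingHom.ker η ^ (k + 1)) := Ideal.mul_mono_right ih
      _ = RingHom.ker η * Ideal.span {τ ^ k} ⊔ RingHom.ker η ^ (k + 2) := by
        rw [Ideal.mul_sup, ← pow_succ']
      _ ≤ (Ideal.span {τ} ⊔ RingHom.ker η ^ 2) * Ideal.span {τ ^ k} ⊔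
          RingHom.ker η ^ (k + 2) := sup_le_sup_right (Ideal.mul_mono_left hm) _
      _ ≤ Ideal.span {τ ^ (k + 1)} ⊔ RingHom.ker η ^ (k + 2) := ?_
    rw [Ideal.sup_mul, Ideal.span_singleton_mul_span_singleton, ← pow_succ', sup_assoc]
    refine sup_le_sup_left (sup_le ?_ le_rfl) _
    rw [show k + 2 = 2 + k by ring, pow_add]
    refine Ideal.mul_mono_right ?_
    rw [Ideal.span_singleton_le_iff_mem]
    exact Ideal.pow_mem_pow hτ k

/-- Inductively `f` is `a * τ ^ k` plus an element of the next power. The `k`-th derivative at `η`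
is `k! * η a`, so in characteristic zero its vanishing puts `a` into the ideal. -/
theorem mem_ker_pow_iff [CharZero K] {τ : B} (hτ : η τ = 0) (hD : D τ = 1)
    (hm : RingHom.ker η ≤ Ideal.span {τ} ⊔ RingHom.ker η ^ 2) :
    f ∈ RingHom.ker η ^ k ↔ JetVanish D η k f := by
  refine ⟨.of_mem_pow, fun h => ?_⟩
  induction k with
  | zero => simp
  | succ k ih =>
    obtain ⟨y, hy, h', hh', rfl⟩ := Submodule.mem_sup.1
      (ker_pow_le hτ hm k (ih (h.mono (Nat.le_succ k))))
    obtain ⟨a, rfl⟩ := Ideal.mem_span_singleton'.1 hy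
    refine add_mem ?_ hh'
    have h1 := h k (Nat.lt_succ_self k)
    rw [iterate_map_add, map_add, apply_iterate_mul_pow hτ hD,
      JetVanish.of_mem_pow hh' k (Nat.lt_succ_self k), add_zero] at h1
    have h2 : a ∈ RingHom.ker η :=
      (mul_eq_zero.1 h1).resolve_left (Nat.cast_ne_zero.2 (Nat.factorial_ne_zero k))
    rw [pow_succ']
    exact Ideal.mul_mem_mul h2 (Ideal.pow_mem_pow hτ k)

theorem order_eq [CharZero K] {τ : B} (hτ : η τ = 0) (hD : D τ = 1)
    (hm : RingHom.ker η ≤ Ideal.span {τ} ⊔ RingHom.ker η ^ 2) (h : JetVanish D η k f)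
    (h' : η (D^[k] f) ≠ 0) : order (RingHom.ker η) f = k := by
  unfold order
  apply le_antisymm
  · refine iSup₂_le fun l hl => ?_
    rw [mem_ker_pow_iff hτ hD hm] at hl
    by_contra hlt
    exact h' (hl k (by exact_mod_cast not_le.1 hlt))
  · exact le_iSup₂_of_le k ((mem_ker_pow_iff hτ hD hm).2 h) le_rfl

end Jets

/-! ### Vanishing orders at `R`-rational points. -/

section BaseChange

variable {A : Type*} [CommRing A] [Algebra ℝ A]
variable {R : Type*} [Field R] [LinearOrder R] [IsStrictOrderedRing R] [Algebra ℝ R]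

/-- The base change of a derivation. -/
def baseChangeDerivation (R : Type*) [Field R] [Algebra ℝ R] (D : Derivation ℝ A A) :
    Derivation R (R ⊗[ℝ] A) (R ⊗[ℝ] A) :=
  Derivation.mk' (D.toLinearMap.baseChange R) (by
    intro x y
    induction x with
    | zero => simp
    | add x x' hx hx' =>
      rw [add_mul, map_add, hx, hx', map_add]
      simp only [smul_eq_mul]
      ring
    | tmul r a =>
      induction y with
      | zero => simp
      | add y y' hy hy' =>
        rw [mul_add, map_add, hy, hy', map_add]
        simp only [smul_eq_mul]
        ring
      | tmul s b =>
        simp [TensorProduct.tmul_add, mul_comm s r])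

theorem baseChangeDerivation_tmul (D : Derivation ℝ A A) (r : R) (a : A) :
    baseChangeDerivation R D (r ⊗ₜ a) = r ⊗ₜ D a := by
  simp [baseChangeDerivation]

theorem iterate_baseChangeDerivation_tmul (D : Derivation ℝ A A) (r : R) (a : A) (i : ℕ) :
    (baseChangeDerivation R D)^[i] (r ⊗ₜ a) = r ⊗ₜ (D^[i] a) := by
  induction i generalizing a with
  | zero => rfl
  | succ i ih => rw [Function.iterate_succ_apply, baseChangeDerivation_tmul, ih,
      Function.iterate_succ_apply]

theorem evalAt_tmul (η : A →ₐ[ℝ] R) (r : R) (a : A) : evalAt η (r ⊗ₜ a) = r * η a := by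
  simp [evalAt]

/-- The first-order expansion of the functions on a curve at an `R`-rational point. -/
theorem ker_evalAt_le {t : A} {D : Derivation ℝ A A}
    (hD : ∀ a, KaehlerDifferential.D ℝ A a = D a • KaehlerDifferential.D ℝ A t)
    (η : A →ₐ[ℝ] R) :
    RingHom.ker (evalAt η) ≤
      Ideal.span {(1 : R) ⊗ₜ[ℝ] t - η t ⊗ₜ[ℝ] (1 : A)} ⊔ RingHom.ker (evalAt η) ^ 2 := by
  -- `ψ` carries the ideal `I` of the diagonal into the ideal of the point `η`. The identity `da = D
  -- a • dt` in `I / I ^ 2` thereby becomes the first-order expansion of `a` at `η`.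
  let ψ : A ⊗[ℝ] A →ₐ[ℝ] R ⊗[ℝ] A := Algebra.TensorProduct.map η (AlgHom.id ℝ A)
  have hψ : (KaehlerDifferential.ideal ℝ A).map ψ ≤ RingHom.ker (evalAt η) := by
    rw [Ideal.map_le_iff_le_comap]
    have h1 : ((evalAt η).restrictScalars ℝ).comp ψ =
        η.comp (Algebra.TensorProduct.lmul' ℝ) := by
      ext a <;> simp [ψ, evalAt_tmul]
    intro x hx
    have h2 := congrArg (fun g => g x) h1
    simp only [AlgHom.comp_apply, AlgHom.restrictScalars_apply] at h2
    rw [Ideal.mem_comap, RingHom.mem_ker, h2, (RingHom.mem_ker).1 hx, map_zero]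
  have key : ∀ a : A, ((1 : R) ⊗ₜ[ℝ] a - η a ⊗ₜ[ℝ] (1 : A)) -
      (η (D a) ⊗ₜ[ℝ] (1 : A)) * ((1 : R) ⊗ₜ[ℝ] t - η t ⊗ₜ[ℝ] (1 : A)) ∈
      RingHom.ker (evalAt η) ^ 2 := by
    intro a
    let x : KaehlerDifferential.ideal ℝ A :=
      ⟨1 ⊗ₜ a - a ⊗ₜ 1, KaehlerDifferential.one_smul_sub_smul_one_mem_ideal ℝ a⟩
    let y : KaehlerDifferential.ideal ℝ A :=
      ⟨1 ⊗ₜ t - t ⊗ₜ 1, KaehlerDifferential.one_smul_sub_smul_one_mem_ideal ℝ t⟩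
    have h1 : (KaehlerDifferential.ideal ℝ A).toCotangent x =
        (KaehlerDifferential.ideal ℝ A).toCotangent (D a • y) :=
      (hD a).trans (LinearMap.map_smul_of_tower (KaehlerDifferential.ideal ℝ A).toCotangent
        (D a) y).symm
    rw [Ideal.toCotangent_eq] at h1
    have h2 := Ideal.pow_right_mono hψ 2 (by
      rw [← Ideal.map_pow]
      exact Ideal.mem_map_of_mem ψ h1)
    convert h2 using 1
    simp [ψ, x, y, Algebra.smul_def]
  intro b hb
  have hb' : b = b - evalAt η b ⊗ₜ[ℝ] (1 : A) := by
    rw [(RingHom.mem_ker).1 hb, TensorProduct.zero_tmul, sub_zero]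
  rw [hb']
  clear hb hb'
  induction b with
  | zero => simp
  | add x y hx hy =>
    rw [map_add, TensorProduct.add_tmul, add_sub_add_comm]
    exact add_mem hx hy
  | tmul r a =>
    have h3 : r ⊗ₜ[ℝ] a - evalAt η (r ⊗ₜ[ℝ] a) ⊗ₜ[ℝ] (1 : A) =
        (r ⊗ₜ[ℝ] (1 : A)) * ((1 : R) ⊗ₜ[ℝ] a - η a ⊗ₜ[ℝ] (1 : A)) := by
      rw [evalAt_tmul, mul_sub]
      simp
    rw [h3]
    refine Ideal.mul_mem_left _ _ ?_
    rw [← sub_add_cancel ((1 : R) ⊗ₜ[ℝ] a - η a ⊗ₜ[ℝ] (1 : A))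
      ((η (D a) ⊗ₜ[ℝ] (1 : A)) * ((1 : R) ⊗ₜ[ℝ] t - η t ⊗ₜ[ℝ] (1 : A)))]
    exact add_mem (Ideal.mem_sup_right (key a))
      (Ideal.mem_sup_left (Ideal.mul_mem_left _ _ (Ideal.mem_span_singleton_self _)))

/-- The vanishing order in terms of the derivatives with respect to the parameter `t`. -/
theorem vanishingOrder_eq {t : A} {D : Derivation ℝ A A} (ht : D t = 1)
    (hD : ∀ a, KaehlerDifferential.D ℝ A a = D a • KaehlerDifferential.D ℝ A t)
    (η : A →ₐ[ℝ] R) {f : R ⊗[ℝ] A} {k : ℕ}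
    (h : JetVanish (baseChangeDerivation R D) (evalAt η) k f)
    (h' : evalAt η ((baseChangeDerivation R D)^[k] f) ≠ 0) : vanishingOrder η f = k := by
  refine order_eq (τ := (1 : R) ⊗ₜ[ℝ] t - η t ⊗ₜ[ℝ] (1 : A)) ?_ ?_ (ker_evalAt_le hD η) h h'
  · rw [map_sub, evalAt_tmul, evalAt_tmul]
    simp
  · rw [map_sub, baseChangeDerivation_tmul, baseChangeDerivation_tmul, ht, D.map_one_eq_zero]
    simp
    rfl

end BaseChange

end AffineCurve

/-! ### Integral curves of derivations. -/

namespace AffineCurve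

section IntegralCurve

theorem contDiff_eval {σ : Type*} [Fintype σ] (p : MvPolynomial σ ℝ) :
    ContDiff ℝ 1 fun x : σ → ℝ => MvPolynomial.eval x p := by
  induction p using MvPolynomial.induction_on with
  | C c => simpa using contDiff_const
  | add p q hp hq => simpa using hp.add hq
  | mul_X p i hp =>
    simp only [map_mul, MvPolynomial.eval_X]
    exact hp.mul (contDiff_apply ℝ ℝ i)

theorem hasDerivAt_eval {σ : Type*} [Fintype σ] (d : σ → MvPolynomial σ ℝ) {α : ℝ → σ → ℝ} {s : ℝ}
    (h : HasDerivAt α (fun j => MvPolynomial.eval (α s) (d j)) s) (p : MvPolynomial σ ℝ) :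
    HasDerivAt (fun s => MvPolynomial.eval (α s) p)
      (MvPolynomial.eval (α s) (MvPolynomial.mkDerivation ℝ d p)) s := by
  induction p using MvPolynomial.induction_on with
  | C c => simpa using hasDerivAt_const s c
  | add p q hp hq =>
    simp only [map_add]
    exact hp.fun_add hq
  | mul_X p i hp =>
    have hi := hasDerivAt_pi.1 h i
    simp only [map_mul, MvPolynomial.eval_X]
    refine (hp.fun_mul hi).congr_deriv ?_
    simp
    ring

theorem map_mkDerivation {A : Type*} [CommRing A] [Algebra ℝ A] (D : Derivation ℝ A A) {σ : Type*}
    (π : MvPolynomial σ ℝ →ₐ[ℝ] A) {d : σ → MvPolynomial σ ℝ} (hd : ∀ j, π (d j) = D (π (.X j)))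
    (p : MvPolynomial σ ℝ) : π (MvPolynomial.mkDerivation ℝ d p) = D (π p) := by
  induction p using MvPolynomial.induction_on with
  | C c =>
    have : π (MvPolynomial.C c) = algebraMap ℝ A c := π.commutes c
    rw [this]
    simp
  | add p q hp hq => simp [hp, hq]
  | mul_X p i hp => simp [hp, hd]

/-- A linear system of differential equations with continuous coefficients has only
the trivial solution with initial value `0`. -/
theorem eq_zero_of_linear_ode {ι : Type*} [Fintype ι] {y : ℝ → ι → ℝ} {H : ℝ → ι → ι → ℝ} {r : ℝ}
    (hr : 0 < r) (hH : ∀ i j, ContinuousOn (fun s => H s i j) (Set.Icc (-r) r))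
    (hy : ∀ s ∈ Set.Icc (-r) r, HasDerivAt y (fun i => ∑ j, H s i j * y s j) s) (h0 : y 0 = 0) :
    ∀ s ∈ Set.Icc (-r) r, y s = 0 := by
  have hb : ∀ i j, ∃ M, ∀ s ∈ Set.Icc (-r) r, |H s i j| ≤ M := fun i j =>
    isCompact_Icc.exists_bound_of_continuousOn (hH i j)
  choose M hM using hb
  let N : ℝ := ∑ i, ∑ j, |M i j|
  have hN : 0 ≤ N := Finset.sum_nonneg fun i _ => Finset.sum_nonneg fun j _ => abs_nonneg _
  have hlip : ∀ s ∈ Set.Ioo (-r) r, LipschitzOnWith N.toNNReal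
      (fun w : ι → ℝ => fun i => ∑ j, H s i j * w j) Set.univ := by
    intro s hs
    refine LipschitzOnWith.of_dist_le_mul fun w _ w' _ => ?_
    rw [Real.coe_toNNReal N hN]
    refine (dist_pi_le_iff (mul_nonneg hN dist_nonneg)).2 fun i => ?_
    rw [Real.dist_eq, ← Finset.sum_sub_distrib]
    calc |∑ j, (H s i j * w j - H s i j * w' j)| ≤ ∑ j, |M i j| * dist w w' := by
          refine (Finset.abs_sum_le_sum_abs _ _).trans (Finset.sum_le_sum fun j _ => ?_)
          rw [← mul_sub, abs_mul]
          refine mul_le_mul ((hM i j s (Set.Ioo_subset_Icc_self hs)).trans (le_abs_self _)) ?_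
            (abs_nonneg _) (abs_nonneg _)
          rw [← Real.dist_eq]
          exact dist_le_pi_dist w w' j
      _ = (∑ j, |M i j|) * dist w w' := by rw [Finset.sum_mul]
      _ ≤ N * dist w w' := by
          refine mul_le_mul_of_nonneg_right ?_ dist_nonneg
          exact Finset.single_le_sum (f := fun i => ∑ j, |M i j|)
            (fun i _ => Finset.sum_nonneg fun j _ => abs_nonneg _) (Finset.mem_univ i)
  have heq := ODE_solution_unique_of_mem_Icc (s := fun _ => Set.univ) (t₀ := 0) (g := fun _ => 0)
    hlip ⟨by linarith, hr⟩
    (fun s hs => (hy s hs).continuousAt.continuousWithinAt)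
    (fun s hs => hy s (Set.Ioo_subset_Icc_self hs)) (fun _ _ => Set.mem_univ _)
    continuousOn_const (fun s _ => by
      convert hasDerivAt_const s (0 : ι → ℝ) using 1
      ext i
      simp) (fun _ _ => Set.mem_univ _) h0
  exact fun s hs => heq hs

/-- Integral curves of a derivation of the coordinate ring through a real point stay on
the variety. -/
theorem exists_integral_curve {A : Type*} [CommRing A] [Algebra ℝ A] [Algebra.FiniteType ℝ A]
    (D : Derivation ℝ A A) (ξ : A →ₐ[ℝ] ℝ) :
    ∃ r > 0, ∃ γ : ℝ → A →ₐ[ℝ] ℝ, γ 0 = ξ ∧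
      ∀ s ∈ Set.Ioo (-r) r, ∀ a, HasDerivAt (fun s => γ s a) (γ s (D a)) s := by
  obtain ⟨m, π, hπ⟩ := Algebra.FiniteType.iff_quotient_mvPolynomial''.1
    (inferInstance : Algebra.FiniteType ℝ A)
  choose d hd using fun j => hπ (D (π (.X j)))
  have hξ : ∀ p, MvPolynomial.eval (fun j => ξ (π (.X j))) p = ξ (π p) := by
    intro p
    have : MvPolynomial.aeval (fun j => ξ (π (.X j))) = ξ.comp π := by
      ext j
      simp
    simpa [MvPolynomial.aeval_eq_eval] using congrArg (fun g => g p) this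
  have hC : ContDiff ℝ 1 fun x : Fin m → ℝ => fun j => MvPolynomial.eval x (d j) :=
    contDiff_pi.2 fun j => contDiff_eval (d j)
  obtain ⟨α, hα0, ε, hε, hα⟩ :=
    ContDiffAt.exists_forall_mem_closedBall_exists_eq_forall_mem_Ioo_hasDerivAt₀
      (hC.contDiffAt (x := fun j => ξ (π (.X j)))) 0
  simp only [zero_sub, zero_add] at hα
  obtain ⟨G, hG⟩ : (RingHom.ker π).FG := (isNoetherianRing_iff_ideal_fg _).1 inferInstance _
  have hgm : ∀ g : G, π g = 0 := fun g => by
    have : (g : MvPolynomial (Fin m) ℝ) ∈ RingHom.ker π := hG ▸ Ideal.subset_span g.2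
    exact this
  have hexp : ∀ p, π p = 0 → ∃ c : G → MvPolynomial (Fin m) ℝ,
      p = ∑ g, c g * (g : MvPolynomial (Fin m) ℝ) := by
    intro p hp
    have hp' : p ∈ Ideal.span (G : Set (MvPolynomial (Fin m) ℝ)) := by
      rw [hG]
      exact hp
    obtain ⟨c, hc⟩ := Submodule.mem_span_finset'.1 hp'
    exact ⟨c, hc.symm⟩
  -- The lifted vector field preserves the ideal of relations. Hence the values of its generators
  -- along `α` solve a homogeneous linear system, with initial value `0` because `ξ` lies on the
  -- variety.
  have hexp' : ∀ g : G, ∃ c : G → MvPolynomial (Fin m) ℝ,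
      MvPolynomial.mkDerivation ℝ d g = ∑ g', c g' * (g' : MvPolynomial (Fin m) ℝ) := fun g =>
    hexp _ (by rw [map_mkDerivation D π hd, hgm, map_zero])
  choose c hc using hexp'
  have hsub : ∀ s ∈ Set.Icc (-(ε / 2)) (ε / 2), s ∈ Set.Ioo (-ε) ε := fun s hs =>
    ⟨by linarith [hs.1], by linarith [hs.2]⟩
  have hzero : ∀ s ∈ Set.Icc (-(ε / 2)) (ε / 2),
      (fun g : G => MvPolynomial.eval (α s) (g : MvPolynomial (Fin m) ℝ)) = 0 := by
    refine eq_zero_of_linear_ode (by linarith)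
      (H := fun s g g' => MvPolynomial.eval (α s) (c g g')) (fun g g' s hs => ?_) (fun s hs => ?_) ?_
    · exact (hasDerivAt_eval d (hα s (hsub s hs)) _).continuousAt.continuousWithinAt
    · refine hasDerivAt_pi.2 fun g => ?_
      refine (hasDerivAt_eval d (hα s (hsub s hs)) g).congr_deriv ?_
      rw [hc g]
      simp
    · ext g
      rw [hα0, hξ, hgm]
      simp
  have hex : ∀ s, ∃ γ : A →ₐ[ℝ] ℝ, (s ∈ Set.Icc (-(ε / 2)) (ε / 2) →
      ∀ p, γ (π p) = MvPolynomial.eval (α s) p) := by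
    intro s
    by_cases hs : s ∈ Set.Icc (-(ε / 2)) (ε / 2)
    · have hker : ∀ p ∈ RingHom.ker π, (MvPolynomial.aeval (α s) : _ →ₐ[ℝ] ℝ) p = 0 := by
        intro p hp
        obtain ⟨c, rfl⟩ := hexp p hp
        rw [map_sum]
        refine Finset.sum_eq_zero fun g _ => ?_
        rw [map_mul, MvPolynomial.aeval_eq_eval]
        have := congrFun (hzero s hs) g
        simp only [Pi.zero_apply] at this
        simp [this]
      refine ⟨(Ideal.Quotient.liftₐ (RingHom.ker π) _ hker).comp
        (Ideal.quotientKerAlgEquivOfSurjective hπ).symm.toAlgHom, fun _ p => ?_⟩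
      have : (Ideal.quotientKerAlgEquivOfSurjective hπ).symm (π p) =
          Ideal.Quotient.mk (RingHom.ker π) p := by
        rw [AlgEquiv.symm_apply_eq]
        rfl
      simp [this]
    · exact ⟨ξ, fun h => absurd h hs⟩
  choose γ hγ using hex
  refine ⟨ε / 2, by linarith, γ, ?_, fun s hs a => ?_⟩
  · ext a
    obtain ⟨p, rfl⟩ := hπ a
    rw [hγ 0 ⟨by linarith, by linarith⟩, hα0, hξ]
  · obtain ⟨p, rfl⟩ := hπ a
    rw [← map_mkDerivation D π hd, hγ s (Set.Ioo_subset_Icc_self hs)]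
    refine (hasDerivAt_eval d (hα s (hsub s (Set.Ioo_subset_Icc_self hs))) p).congr_of_eventuallyEq ?_
    filter_upwards [isOpen_Ioo.mem_nhds hs] with s' hs'
    exact hγ s' (Set.Ioo_subset_Icc_self hs') p

end IntegralCurve

end AffineCurve

/-! ### Chebyshev systems and extremal functions over the reals. -/

namespace AffineCurve

section RealAnalysis

open Filter Topology

variable {A : Type*} [CommRing A] [Algebra ℝ A] {D : Derivation ℝ A A} {r : ℝ}
  {γ : ℝ → A →ₐ[ℝ] ℝ}

/-- `γ` is an integral curve of `D` on the interval `(-r, r)`. -/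
def IsIntegralCurveOfDerivation (D : Derivation ℝ A A) (r : ℝ) (γ : ℝ → A →ₐ[ℝ] ℝ) : Prop :=
  ∀ s ∈ Set.Ioo (-r) r, ∀ a, HasDerivAt (fun s => γ s a) (γ s (D a)) s

/-- Taylor's formula with Lagrange remainder along an integral curve. -/
theorem IsIntegralCurveOfDerivation.exists_lagrange (hγ : IsIntegralCurveOfDerivation D r γ) {z : ℝ}
    (hz : z ∈ Set.Ioo (-r) r) (m : ℕ) {f : A} (hf : JetVanish D (γ z) m f) {s : ℝ}
    (hs : s ∈ Set.Ioo (-r) r) :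
    ∃ w ∈ Set.uIcc z s, γ s f = γ w (D^[m] f) / m.factorial * (s - z) ^ m := by
  induction m generalizing f s with
  | zero => exact ⟨s, Set.right_mem_uIcc, by simp⟩
  | succ m ih =>
    rw [jetVanish_succ] at hf
    rcases eq_or_ne s z with rfl | hne
    · exact ⟨s, Set.right_mem_uIcc, by simp [hf.1]⟩
    -- Cauchy's mean value theorem for `f` against `(x - z) ^ (m + 1)`; the induction hypothesis
    -- then applies to `D f` at `c`. That `c ≠ z` permits cancelling `(c - z) ^ m`.
    have main : ∃ c ∈ Set.uIcc z s, c ≠ z ∧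
        γ s f * ((m + 1 : ℝ) * (c - z) ^ m) = (s - z) ^ (m + 1) * γ c (D f) := by
      have hd : ∀ x, HasDerivAt (fun x : ℝ => (x - z) ^ (m + 1)) ((m + 1 : ℝ) * (x - z) ^ m) x := by
        intro x
        simpa using ((hasDerivAt_id x).sub_const z).fun_pow (m + 1)
      rcases hne.lt_or_gt with hlt | hlt
      · have hsub : Set.Icc s z ⊆ Set.Ioo (-r) r := fun x hx =>
          ⟨hs.1.trans_le hx.1, hx.2.trans_lt hz.2⟩
        obtain ⟨c, hc, h⟩ := exists_ratio_hasDerivAt_eq_ratio_slope (fun x => γ x f)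
          (fun x => γ x (D f)) hlt
          (fun x hx => (hγ x (hsub hx) f).continuousAt.continuousWithinAt)
          (fun x hx => hγ x (hsub (Set.Ioo_subset_Icc_self hx)) f)
          (fun x => (x - z) ^ (m + 1)) (fun x => (m + 1 : ℝ) * (x - z) ^ m)
          (fun x _ => (hd x).continuousAt.continuousWithinAt) (fun x _ => hd x)
        refine ⟨c, Set.mem_uIcc.2 (Or.inr ⟨hc.1.le, hc.2.le⟩), hc.2.ne, ?_⟩
        rw [hf.1] at h
        simp only [sub_self, zero_pow (Nat.succ_ne_zero m)] at h
        linarith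
      · have hsub : Set.Icc z s ⊆ Set.Ioo (-r) r := fun x hx =>
          ⟨hz.1.trans_le hx.1, hx.2.trans_lt hs.2⟩
        obtain ⟨c, hc, h⟩ := exists_ratio_hasDerivAt_eq_ratio_slope (fun x => γ x f)
          (fun x => γ x (D f)) hlt
          (fun x hx => (hγ x (hsub hx) f).continuousAt.continuousWithinAt)
          (fun x hx => hγ x (hsub (Set.Ioo_subset_Icc_self hx)) f)
          (fun x => (x - z) ^ (m + 1)) (fun x => (m + 1 : ℝ) * (x - z) ^ m)
          (fun x _ => (hd x).continuousAt.continuousWithinAt) (fun x _ => hd x)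
        refine ⟨c, Set.mem_uIcc.2 (Or.inl ⟨hc.1.le, hc.2.le⟩), hc.1.ne', ?_⟩
        rw [hf.1] at h
        simp only [sub_self, zero_pow (Nat.succ_ne_zero m)] at h
        linarith
    obtain ⟨c, hc, hcz, h⟩ := main
    have hcr : c ∈ Set.Ioo (-r) r := Set.OrdConnected.uIcc_subset Set.ordConnected_Ioo hz hs hc
    obtain ⟨w, hw, h'⟩ := ih hf.2 hcr
    refine ⟨w, Set.uIcc_subset_uIcc_left hc hw, ?_⟩
    have hne' : (c - z) ^ m ≠ 0 := pow_ne_zero _ (sub_ne_zero.2 hcz)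
    rw [h', ← mul_assoc, ← mul_assoc] at h
    have h2 := mul_right_cancel₀ hne' h
    rw [Function.iterate_succ_apply, Nat.factorial_succ]
    push_cast
    field_simp
    field_simp at h2
    linear_combination h2

theorem IsIntegralCurveOfDerivation.eventually_abs_sub_le (hγ : IsIntegralCurveOfDerivation D r γ)
    {z : ℝ} (hz : z ∈ Set.Ioo (-r) r) {m : ℕ} {f : A} (hf : JetVanish D (γ z) m f) {ε : ℝ}
    (hε : 0 < ε) :
    ∀ᶠ s in 𝓝 z, |γ s f - γ z (D^[m] f) / m.factorial * (s - z) ^ m| ≤ ε * |s - z| ^ m := by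
  have hcont := (hγ z hz (D^[m] f)).continuousAt
  obtain ⟨δ, hδ, hball⟩ := Metric.continuousAt_iff.1 hcont ε hε
  filter_upwards [isOpen_Ioo.mem_nhds hz, Metric.ball_mem_nhds z hδ] with s hs hs'
  obtain ⟨w, hw, h⟩ := hγ.exists_lagrange hz m hf hs
  have hwz : dist w z < δ := by
    have : |w - z| ≤ |s - z| := Set.abs_sub_left_of_mem_uIcc hw
    rw [Real.dist_eq]
    exact this.trans_lt (by rwa [Metric.mem_ball, Real.dist_eq] at hs')
  have h1 := hball hwz
  rw [Real.dist_eq] at h1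
  rw [h, ← sub_mul, ← sub_div, abs_mul, abs_pow, abs_div, Nat.abs_cast]
  refine mul_le_mul_of_nonneg_right ?_ (by positivity)
  have hm : (1 : ℝ) ≤ m.factorial := by exact_mod_cast Nat.factorial_pos m
  exact (div_le_self (abs_nonneg _) hm).trans h1.le

/-- Near `z` the Taylor error is at most half the leading term. -/
theorem IsIntegralCurveOfDerivation.eventually_le_abs (hγ : IsIntegralCurveOfDerivation D r γ)
    {z : ℝ} (hz : z ∈ Set.Ioo (-r) r) {m : ℕ} {f : A} (hf : JetVanish D (γ z) m f)
    (hf' : γ z (D^[m] f) ≠ 0) : ∃ c > 0, ∀ᶠ s in 𝓝 z, c * |s - z| ^ m ≤ |γ s f| := by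
  have hm : (0 : ℝ) < m.factorial := by exact_mod_cast Nat.factorial_pos m
  have hc : 0 < |γ z (D^[m] f) / m.factorial| / 2 := by positivity
  refine ⟨_, hc, ?_⟩
  filter_upwards [hγ.eventually_abs_sub_le hz hf hc] with s hs
  have h1 := abs_sub_abs_le_abs_sub (γ z (D^[m] f) / m.factorial * (s - z) ^ m) (γ s f)
  rw [abs_sub_comm, abs_mul, abs_pow] at h1
  linarith

theorem IsIntegralCurveOfDerivation.eventually_abs_le (hγ : IsIntegralCurveOfDerivation D r γ)
    {z : ℝ} (hz : z ∈ Set.Ioo (-r) r) {m : ℕ} {f g : A} (hf : JetVanish D (γ z) m f)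
    (hf' : γ z (D^[m] f) ≠ 0) (hg : JetVanish D (γ z) m g) :
    ∃ C, ∀ᶠ s in 𝓝 z, |γ s g| ≤ C * |γ s f| := by
  obtain ⟨c, hc, h⟩ := hγ.eventually_le_abs hz hf hf'
  refine ⟨(|γ z (D^[m] g) / m.factorial| + 1) / c, ?_⟩
  filter_upwards [h, hγ.eventually_abs_sub_le hz hg one_pos] with s hs hs'
  have h1 := abs_sub_abs_le_abs_sub (γ s g) (γ z (D^[m] g) / m.factorial * (s - z) ^ m)
  rw [abs_mul, abs_pow] at h1
  have h2 : |γ s g| ≤ (|γ z (D^[m] g) / m.factorial| + 1) * |s - z| ^ m := by linarith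
  rw [div_mul_eq_mul_div, le_div_iff₀ hc]
  have h3 := mul_le_mul_of_nonneg_left hs
    (show 0 ≤ |γ z (D^[m] g) / m.factorial| + 1 by positivity)
  nlinarith

/-- For odd `m` the leading term dominates with opposite signs on the two sides of `z`. -/
theorem IsIntegralCurveOfDerivation.even_of_nonneg (hγ : IsIntegralCurveOfDerivation D r γ)
    {z : ℝ} (hz : z ∈ Set.Ioo (-r) r) {m : ℕ} {f : A} (hf : JetVanish D (γ z) m f)
    (hf' : γ z (D^[m] f) ≠ 0) (h : ∀ᶠ s in 𝓝 z, 0 ≤ γ s f) : Even m := by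
  have hm : (0 : ℝ) < m.factorial := by exact_mod_cast Nat.factorial_pos m
  set c := γ z (D^[m] f) / m.factorial with hc_def
  have hc0 : c ≠ 0 := div_ne_zero hf' hm.ne'
  have hc : 0 < |c| / 2 := by positivity
  by_contra hodd
  rw [Nat.not_even_iff_odd] at hodd
  obtain ⟨δ, hδ, hball⟩ := Metric.eventually_nhds_iff.1 (h.and (hγ.eventually_abs_sub_le hz hf hc))
  obtain ⟨h1, h2⟩ := hball (y := z + δ / 2) (by simp [abs_of_pos hδ, hδ])
  obtain ⟨h3, h4⟩ := hball (y := z - δ / 2) (by simp [abs_of_pos hδ, hδ])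
  have hp : 0 < (δ / 2) ^ m := by positivity
  rw [add_sub_cancel_left, ← hc_def, abs_of_pos (half_pos hδ)] at h2
  rw [sub_sub_cancel_left, hodd.neg_pow, abs_neg, abs_of_pos (half_pos hδ), ← hc_def] at h4
  have h5 := (abs_le.1 h2).2
  have h6 := (abs_le.1 h4).2
  rcases hc0.lt_or_gt with hneg | hpos
  · rw [abs_of_neg hneg] at h5
    nlinarith
  · rw [abs_of_pos hpos] at h6
    nlinarith

/-- Rolle's theorem for finitely many zeros. -/
theorem exists_finset_deriv_zero {h h' : ℝ → ℝ} {a b : ℝ}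
    (hd : ∀ x ∈ Set.Ioo a b, HasDerivAt h (h' x) x) (Z : Finset ℝ)
    (hZ : ∀ z ∈ Z, z ∈ Set.Ioo a b ∧ h z = 0) (hne : Z.Nonempty) :
    ∃ W : Finset ℝ, Disjoint Z W ∧ W.card + 1 = Z.card ∧
      ∀ w ∈ W, (w ∈ Set.Ioo a b ∧ h' w = 0) ∧ ∃ z ∈ Z, w < z := by
  induction Z using Finset.induction_on_max with
  | empty => simp at hne
  | insert M Z hM ih =>
    have hMZ : M ∉ Z := fun h => lt_irrefl _ (hM M h)
    rcases Z.eq_empty_or_nonempty with rfl | hne'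
    · exact ⟨∅, by simp⟩
    obtain ⟨W, hdis, hcard, hW⟩ := ih (fun z hz => hZ z (Finset.mem_insert_of_mem hz)) hne'
    have hyZ := Z.max'_mem hne'
    set y := Z.max' hne' with hy
    have hyM := hM y hyZ
    have hyab := hZ y (Finset.mem_insert_of_mem hyZ)
    have hMab := hZ M (Finset.mem_insert_self M Z)
    have hsub : Set.Icc y M ⊆ Set.Ioo a b := fun x hx =>
      ⟨hyab.1.1.trans_le hx.1, hx.2.trans_lt hMab.1.2⟩
    obtain ⟨w, hw, hw'⟩ := exists_hasDerivAt_eq_zero hyM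
      (fun x hx => (hd x (hsub hx)).continuousAt.continuousWithinAt)
      (by rw [hyab.2, hMab.2]) (fun x hx => hd x (hsub (Set.Ioo_subset_Icc_self hx)))
    -- The clause `∃ z ∈ Z, w < z` keeps all earlier points to the left of `y`, so the new Rolle
    -- point is distinct from them.
    have hlt : ∀ v ∈ W, v < y := fun v hv => by
      obtain ⟨z, hz, hvz⟩ := (hW v hv).2
      exact hvz.trans_le (Z.le_max' z hz)
    have hwW : w ∉ W := fun hwW => lt_asymm (hlt w hwW) hw.1
    refine ⟨insert w W, ?_, ?_, ?_⟩
    · rw [Finset.disjoint_insert_left, Finset.disjoint_insert_right]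
      refine ⟨?_, ?_, hdis⟩
      · rw [Finset.mem_insert, not_or]
        exact ⟨hw.2.ne', fun hMW => lt_asymm (hlt M hMW) hyM⟩
      · exact fun hwZ => absurd (Z.le_max' w hwZ) (not_le.2 hw.1)
    · rw [Finset.card_insert_of_notMem hwW, Finset.card_insert_of_notMem hMZ, hcard]
    · intro v hv
      rcases Finset.mem_insert.1 hv with rfl | hv
      · exact ⟨⟨hsub (Set.Ioo_subset_Icc_self hw), hw'⟩, M, Finset.mem_insert_self _ _, hw.2⟩
      · obtain ⟨h1, z, hz, h2⟩ := hW v hv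
        exact ⟨h1, z, Finset.mem_insert_of_mem hz, h2⟩

theorem IsIntegralCurveOfDerivation.exists_forall_ne_zero (hγ : IsIntegralCurveOfDerivation D r γ)
    (hr : 0 < r) {f : A} (hf : ∃ i, γ 0 (D^[i] f) ≠ 0) :
    ∃ ε > 0, ε ≤ r ∧ ∀ s ∈ Set.Ioo 0 ε, γ s f ≠ 0 := by
  classical
  have h0 : (0 : ℝ) ∈ Set.Ioo (-r) r := ⟨by linarith, hr⟩
  obtain ⟨c, hc, h⟩ := hγ.eventually_le_abs h0 (m := Nat.find hf)
    (fun i hi => not_not.1 (Nat.find_min hf hi)) (Nat.find_spec hf)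
  obtain ⟨δ, hδ, hball⟩ := Metric.eventually_nhds_iff.1 h
  refine ⟨min δ r, lt_min hδ hr, min_le_right _ _, fun s hs h => ?_⟩
  have h1 := hball (y := s) (by
    rw [Real.dist_eq, sub_zero, abs_of_pos hs.1]
    exact hs.2.trans_le (min_le_left _ _))
  rw [h, abs_zero, sub_zero] at h1
  have : 0 < c * |s| ^ Nat.find hf := by
    have := abs_pos.2 hs.1.ne'
    positivity
  linarith

/-- The Wronskian of `v` with another element. -/
def wronskian (D : Derivation ℝ A A) (v : A) : A →ₗ[ℝ] A :=
  LinearMap.mulLeft ℝ v ∘ₗ D.toLinearMap - LinearMap.mulRight ℝ (D v)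

theorem wronskian_apply (v f : A) : wronskian D v f = v * D f - f * D v := by
  simp [wronskian]

theorem JetVanish.wronskian {η : A →ₐ[ℝ] ℝ} {k : ℕ} {f : A} (h : JetVanish D η (k + 1) f) (v : A) :
    JetVanish D η k (wronskian D v f) := by
  rw [wronskian_apply]
  refine ((jetVanish_succ.1 h).2.mul_left v).sub ?_
  rw [mul_comm]
  exact (h.mono (Nat.le_succ k)).mul_left _

theorem IsIntegralCurveOfDerivation.hasDerivAt_div (hγ : IsIntegralCurveOfDerivation D r γ) {s : ℝ}
    (hs : s ∈ Set.Ioo (-r) r) {f v : A} (hv : γ s v ≠ 0) :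
    HasDerivAt (fun s => γ s f / γ s v) (γ s (wronskian D v f) / γ s v ^ 2) s := by
  refine ((hγ s hs f).fun_div (hγ s hs v) hv).congr_deriv ?_
  rw [wronskian_apply, map_sub, map_mul, map_mul]
  ring

/-- The quotient `f / v` is a constant `c` to the right of `0`, so `c • v - f` vanishes arbitrarily
close to `0`, which a nonzero element of finite order at `0` cannot do. -/
theorem IsIntegralCurveOfDerivation.eq_smul_of_wronskian_eq_zero
    (hγ : IsIntegralCurveOfDerivation D r γ) (hr : 0 < r)
    (hord : ∀ f : A, f ≠ 0 → ∃ i, γ 0 (D^[i] f) ≠ 0) {f v : A} (hv : v ≠ 0)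
    (h : wronskian D v f = 0) : ∃ c : ℝ, c • v = f := by
  obtain ⟨ε, hε, hεr, hne⟩ := hγ.exists_forall_ne_zero hr (hord v hv)
  have hsub : Set.Ioo 0 ε ⊆ Set.Ioo (-r) r := fun x hx => ⟨by linarith [hx.1], hx.2.trans_le hεr⟩
  have hmid : ε / 2 ∈ Set.Ioo 0 ε := ⟨by linarith, by linarith⟩
  have hconst : ∀ s ∈ Set.Ioo 0 ε, γ s f / γ s v = γ (ε / 2) f / γ (ε / 2) v := by
    intro s hs
    have h1 := (convex_Ioo 0 ε).norm_image_sub_le_of_norm_hasDerivWithin_le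
      (f := fun s => γ s f / γ s v) (f' := fun _ => 0) (C := 0) (x := ε / 2) (y := s)
      (fun x hx => by
        have := hγ.hasDerivAt_div (hsub hx) (f := f) (hne x hx)
        rw [h, map_zero, zero_div] at this
        exact this.hasDerivWithinAt) (by simp) hmid hs
    rw [zero_mul, norm_le_zero_iff, sub_eq_zero] at h1
    exact h1
  set c := γ (ε / 2) f / γ (ε / 2) v
  refine ⟨c, ?_⟩
  by_contra hcon
  obtain ⟨ε', hε', -, hne'⟩ := hγ.exists_forall_ne_zero hr
    (hord (c • v - f) (sub_ne_zero.2 hcon))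
  have hpos : 0 < min ε ε' := lt_min hε hε'
  have hm : min ε ε' / 2 ∈ Set.Ioo 0 ε :=
    ⟨by linarith, by linarith [min_le_left ε ε']⟩
  refine hne' (min ε ε' / 2) ⟨by linarith, by linarith [min_le_right ε ε']⟩ ?_
  have h2 := hconst _ hm
  rw [div_eq_iff (hne _ hm)] at h2
  rw [map_sub, map_smul, h2, smul_eq_mul, sub_self]

/-- A space of dimension `n + 1` of functions on the curve is an extended Chebyshev system on a
small interval: nonzero elements have at most `n` zeros, counted with multiplicities. -/
theorem IsIntegralCurveOfDerivation.exists_sum_le (hγ : IsIntegralCurveOfDerivation D r γ)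
    (hr : 0 < r) (hord : ∀ f : A, f ≠ 0 → ∃ i, γ 0 (D^[i] f) ≠ 0) (n : ℕ) (V : Submodule ℝ A)
    (hV : Module.finrank ℝ V = n + 1) :
    ∃ ε > 0, ε ≤ r ∧ ∀ f ∈ V, f ≠ 0 → ∀ (Z : Finset ℝ) (μ : ℝ → ℕ),
      (∀ z ∈ Z, z ∈ Set.Ioo 0 ε ∧ JetVanish D (γ z) (μ z) f) → ∑ z ∈ Z, μ z ≤ n := by
  classical
  induction n generalizing V with
  | zero =>
    obtain ⟨⟨v, hvV⟩, hv0, hspan⟩ := finrank_eq_one_iff'.1 hV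
    have hv : v ≠ 0 := fun h => hv0 (by simp [h])
    obtain ⟨ε, hε, hεr, hne⟩ := hγ.exists_forall_ne_zero hr (hord v hv)
    refine ⟨ε, hε, hεr, fun f hf hf0 Z μ hZ => ?_⟩
    obtain ⟨c, hc⟩ := hspan ⟨f, hf⟩
    replace hc : c • v = f := congrArg Subtype.val hc
    rw [Nat.le_zero, Finset.sum_eq_zero_iff]
    intro z hz
    by_contra hμ
    have h1 := (hZ z hz).2 0 (Nat.pos_of_ne_zero hμ)
    rw [Function.iterate_zero, id, ← hc, map_smul, smul_eq_mul] at h1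
    rcases mul_eq_zero.1 h1 with h2 | h2
    · exact hf0 (by rw [← hc, h2, zero_smul])
    · exact hne z (hZ z hz).1 h2
  | succ n ih =>
    have hfin : Module.Finite ℝ V := Module.finite_of_finrank_pos (by omega)
    obtain ⟨⟨v, hvV⟩, hv0⟩ := Module.finrank_pos_iff_exists_ne_zero.1
      (show 0 < Module.finrank ℝ V by omega)
    have hv : v ≠ 0 := fun h => hv0 (by simp [h])
    obtain ⟨ε₁, hε₁, hε₁r, hne⟩ := hγ.exists_forall_ne_zero hr (hord v hv)
    let L := wronskian D v
    have hLv : L v = 0 := by rw [wronskian_apply, sub_self]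
    -- The Wronskian with `v` kills only the line of `v` in `V`, so its image has one dimension
    -- less.
    have hker : Module.finrank ℝ (LinearMap.ker (L.domRestrict V)) = 1 := by
      refine finrank_eq_one (⟨⟨v, hvV⟩, hLv⟩ : LinearMap.ker (L.domRestrict V))
        (fun h => hv (congrArg (fun x : LinearMap.ker (L.domRestrict V) => ((x : V) : A)) h)) ?_
      rintro ⟨⟨f, hf⟩, hLf⟩
      obtain ⟨c, hc⟩ := hγ.eq_smul_of_wronskian_eq_zero hr hord hv
        (f := f) (by simpa using hLf)
      exact ⟨c, Subtype.ext (Subtype.ext hc)⟩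
    have hrank := LinearMap.finrank_range_add_finrank_ker (L.domRestrict V)
    rw [hker, hV, LinearMap.range_domRestrict] at hrank
    obtain ⟨ε₂, hε₂, hε₂r, hcheb⟩ := ih (V.map L) (by omega)
    refine ⟨min ε₁ ε₂, lt_min hε₁ hε₂, (min_le_left _ _).trans hε₁r, fun f hf hf0 Z μ hZ => ?_⟩
    have hsub₁ : Set.Ioo 0 (min ε₁ ε₂) ⊆ Set.Ioo 0 ε₁ :=
      Set.Ioo_subset_Ioo_right (min_le_left _ _)
    have hsub₂ : Set.Ioo 0 (min ε₁ ε₂) ⊆ Set.Ioo 0 ε₂ :=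
      Set.Ioo_subset_Ioo_right (min_le_right _ _)
    let Z' := Z.filter fun z => μ z ≠ 0
    have hsum : ∑ z ∈ Z, μ z = ∑ z ∈ Z', μ z := (Finset.sum_filter_ne_zero Z).symm
    rw [hsum]
    rcases Z'.eq_empty_or_nonempty with hemp | hnon
    · simp [hemp]
    have hZ' : ∀ z ∈ Z', z ∈ Set.Ioo 0 (min ε₁ ε₂) ∧ JetVanish D (γ z) (μ z) f ∧ μ z ≠ 0 := by
      intro z hz
      rw [Finset.mem_filter] at hz
      exact ⟨(hZ z hz.1).1, (hZ z hz.1).2, hz.2⟩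
    have hzero : ∀ z ∈ Z', γ z f = 0 := fun z hz =>
      (hZ' z hz).2.1 0 (Nat.pos_of_ne_zero (hZ' z hz).2.2)
    have hLf : L f ≠ 0 := by
      intro h
      obtain ⟨c, hc⟩ := hγ.eq_smul_of_wronskian_eq_zero hr hord hv h
      obtain ⟨z, hz⟩ := hnon
      have h1 := hzero z hz
      rw [← hc, map_smul, smul_eq_mul] at h1
      rcases mul_eq_zero.1 h1 with h2 | h2
      · exact hf0 (by rw [← hc, h2, zero_smul])
      · exact hne z (hsub₁ (hZ' z hz).1) h2
    obtain ⟨W, hdis, hcard, hW⟩ := exists_finset_deriv_zero (a := 0) (b := min ε₁ ε₂)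
      (h := fun s => γ s f / γ s v) (h' := fun s => γ s (L f) / γ s v ^ 2)
      (fun s hs => hγ.hasDerivAt_div
        ⟨by linarith [hs.1], (hsub₁ hs).2.trans_le hε₁r⟩ (hne s (hsub₁ hs))) Z'
      (fun z hz => ⟨(hZ' z hz).1, by rw [hzero z hz, zero_div]⟩) hnon
    -- `L f` is the numerator of the derivative of `f / v`. It keeps multiplicity `μ z - 1` at each
    -- zero of `f` and gains the `Z'.card - 1` Rolle points, so its count falls short of that of `f`
    -- by exactly 1.
    have hbound := hcheb (L f) (Submodule.mem_map_of_mem hf) hLf (Z' ∪ W)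
      (fun z => if z ∈ Z' then μ z - 1 else 1) (by
        intro z hz
        rcases Finset.mem_union.1 hz with hz | hz
        · refine ⟨hsub₂ (hZ' z hz).1, ?_⟩
          rw [if_pos hz]
          refine JetVanish.wronskian ?_ v
          rw [Nat.sub_add_cancel (Nat.pos_of_ne_zero (hZ' z hz).2.2)]
          exact (hZ' z hz).2.1
        · have hzZ : z ∉ Z' := fun h => Finset.disjoint_left.1 hdis h hz
          obtain ⟨⟨h1, h2⟩, -⟩ := hW z hz
          refine ⟨hsub₂ h1, ?_⟩
          rw [if_neg hzZ]
          intro i hi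
          obtain rfl : i = 0 := by omega
          exact (div_eq_zero_iff.1 h2).resolve_right (pow_ne_zero 2 (hne z (hsub₁ h1))))
    rw [Finset.sum_union hdis, Finset.sum_congr rfl (fun z hz => if_pos hz),
      Finset.sum_congr rfl (fun z hz => if_neg fun h => Finset.disjoint_left.1 hdis h hz),
      Finset.sum_const, smul_eq_mul, mul_one] at hbound
    have h1 : ∑ z ∈ Z', μ z = ∑ z ∈ Z', (μ z - 1) + Z'.card := by
      rw [Finset.card_eq_sum_ones, ← Finset.sum_add_distrib]
      exact Finset.sum_congr rfl fun z hz => by have := (hZ' z hz).2.2; omega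
    omega

theorem IsIntegralCurveOfDerivation.exists_forall_abs_le (hγ : IsIntegralCurveOfDerivation D r γ)
    {S : Set ℝ} (hS : IsCompact S) (hSr : S ⊆ Set.Ioo (-r) r) {f g : A}
    (h : ∀ z ∈ S, ∃ m, JetVanish D (γ z) m f ∧ γ z (D^[m] f) ≠ 0 ∧ JetVanish D (γ z) m g) :
    ∃ C, ∀ s ∈ S, |γ s g| ≤ C * |γ s f| := by
  refine hS.induction_on (p := fun T => ∃ C, ∀ s ∈ T, |γ s g| ≤ C * |γ s f|) ⟨0, by simp⟩
    (fun T T' hT ⟨C, hC⟩ => ⟨C, fun s hs => hC s (hT hs)⟩) ?_ ?_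
  · rintro T T' ⟨C, hC⟩ ⟨C', hC'⟩
    refine ⟨max C C', fun s hs => ?_⟩
    rcases hs with hs | hs
    · exact (hC s hs).trans (mul_le_mul_of_nonneg_right (le_max_left _ _) (abs_nonneg _))
    · exact (hC' s hs).trans (mul_le_mul_of_nonneg_right (le_max_right _ _) (abs_nonneg _))
  · intro z hz
    obtain ⟨m, hf, hf', hg⟩ := h z hz
    obtain ⟨C, hC⟩ := hγ.eventually_abs_le (hSr hz) hf hf' hg
    exact ⟨_, mem_nhdsWithin_of_mem_nhds hC, C, fun s hs => hs⟩

/-- The zeros of extremal nonnegative functions on a small interval. -/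
theorem IsIntegralCurveOfDerivation.exists_zeros_of_extremal
    (hγ : IsIntegralCurveOfDerivation D r γ) {n : ℕ} {V : Submodule ℝ A}
    (hV : Module.finrank ℝ V = n + 1) {ε : ℝ} (hεr : ε ≤ r)
    (hcheb : ∀ f ∈ V, f ≠ 0 → ∀ (Z : Finset ℝ) (μ : ℝ → ℕ),
      (∀ z ∈ Z, z ∈ Set.Ioo 0 ε ∧ JetVanish D (γ z) (μ z) f) → ∑ z ∈ Z, μ z ≤ n)
    {s₀ : ℝ} (hs₀ : 0 < s₀) (hs₀ε : s₀ < ε) {f : A} (hfV : f ∈ V) (hf0 : f ≠ 0)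
    (hpos : ∀ s ∈ Set.Icc 0 s₀, 0 ≤ γ s f)
    (hext : ∀ g ∈ V, (∀ s ∈ Set.Icc 0 s₀, 0 ≤ γ s f + γ s g) →
      (∀ s ∈ Set.Icc 0 s₀, 0 ≤ γ s f - γ s g) → ∃ c : ℝ, g = c • f)
    (h0 : γ 0 f ≠ 0) (h1 : γ s₀ f ≠ 0) :
    Even n ∧ ∃ (Z : Finset ℝ) (μ : ℝ → ℕ), (∀ z, z ∈ Z ↔ z ∈ Set.Icc 0 s₀ ∧ γ z f = 0) ∧
      (∀ z ∈ Z, JetVanish D (γ z) (μ z) f ∧ γ z (D^[μ z] f) ≠ 0) ∧ ∑ z ∈ Z, μ z = n := by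
  classical
  have hIcc : Set.Icc 0 s₀ ⊆ Set.Ioo (-r) r := fun x hx =>
    ⟨by linarith [hx.1], by linarith [hx.2]⟩
  have hint : ∀ z ∈ Set.Icc 0 s₀, γ z f = 0 → z ∈ Set.Ioo 0 s₀ := by
    intro z hz hzf
    exact ⟨lt_of_le_of_ne hz.1 (fun h => h0 (h ▸ hzf)),
      lt_of_le_of_ne hz.2 (fun h => h1 (h ▸ hzf))⟩
  have hfinite : {z | z ∈ Set.Icc 0 s₀ ∧ γ z f = 0}.Finite := by
    by_contra hinf
    obtain ⟨Z, hZ, hcard⟩ := Set.Infinite.exists_subset_card_eq hinf (n + 1)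
    have := hcheb f hfV hf0 Z (fun _ => 1) (by
      intro z hz
      obtain ⟨hz1, hz2⟩ := hZ hz
      have := hint z hz1 hz2
      refine ⟨⟨this.1, this.2.trans hs₀ε⟩, fun i hi => ?_⟩
      obtain rfl : i = 0 := by omega
      exact hz2)
    rw [Finset.sum_const, hcard] at this
    simp at this
  have hord : ∀ z, ∃ m, z ∈ Set.Ioo 0 ε → JetVanish D (γ z) m f ∧ γ z (D^[m] f) ≠ 0 := by
    intro z
    by_cases hz : z ∈ Set.Ioo 0 ε
    · have hex : ∃ m, γ z (D^[m] f) ≠ 0 := by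
        by_contra hcon
        push Not at hcon
        -- A zero of infinite order would count as one of multiplicity `n + 1`.
        have := hcheb f hfV hf0 {z} (fun _ => n + 1) (by
          intro z' hz'
          rw [Finset.mem_singleton.1 hz']
          exact ⟨hz, fun i _ => hcon i⟩)
        simp at this
      exact ⟨Nat.find hex, fun _ => ⟨fun i hi => not_not.1 (Nat.find_min hex hi),
        Nat.find_spec hex⟩⟩
    · exact ⟨0, fun h => absurd h hz⟩
  choose μ hμ using hord
  let Z := hfinite.toFinset
  have hZ : ∀ z, z ∈ Z ↔ z ∈ Set.Icc 0 s₀ ∧ γ z f = 0 := fun z => by simp [Z]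
  have hZε : ∀ z ∈ Z, z ∈ Set.Ioo 0 ε := fun z hz => by
    have := hint z ((hZ z).1 hz).1 ((hZ z).1 hz).2
    exact ⟨this.1, this.2.trans hs₀ε⟩
  have hle : ∑ z ∈ Z, μ z ≤ n :=
    hcheb f hfV hf0 Z μ fun z hz => ⟨hZε z hz, (hμ z (hZε z hz)).1⟩
  have heq : ∑ z ∈ Z, μ z = n := by
    by_contra hne
    have hfin : Module.Finite ℝ V := Module.finite_of_finrank_pos (by omega)
    -- One linear condition for each zero and each derivative below its multiplicity. These are
    -- fewer than `n` conditions on a space of dimension `n + 1`, so at least two dimensions remain.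
    let Φ : V →ₗ[ℝ] ((Σ z : Z, Fin (μ z)) → ℝ) := LinearMap.pi fun p =>
      (γ p.1).toLinearMap ∘ₗ (D.toLinearMap ^ (p.2 : ℕ)) ∘ₗ V.subtype
    have hΦ : ∀ (g : V) p, Φ g p = γ p.1 (D^[(p.2 : ℕ)] (g : A)) := by
      intro g p
      simp [Φ, Module.End.pow_apply]
    have hdim : 2 ≤ Module.finrank ℝ (LinearMap.ker Φ) := by
      have h2 := LinearMap.finrank_range_add_finrank_ker Φ
      have h3 : Module.finrank ℝ (LinearMap.range Φ) ≤ ∑ z ∈ Z, μ z := by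
        refine (Submodule.finrank_le _).trans ?_
        rw [Module.finrank_fintype_fun_eq_card, Fintype.card_sigma]
        simp only [Fintype.card_fin]
        rw [Finset.sum_coe_sort Z μ]
      omega
    have hg : ∃ g ∈ V, (∀ z ∈ Z, JetVanish D (γ z) (μ z) g) ∧ ∀ c : ℝ, g ≠ c • f := by
      by_contra hcon
      push Not at hcon
      have : Module.finrank ℝ (LinearMap.ker Φ) ≤ 1 := by
        have hle1 : LinearMap.ker Φ ≤ Submodule.span ℝ {(⟨f, hfV⟩ : V)} := by
          intro g hg
          obtain ⟨c, hc⟩ := hcon g g.2 (fun z hz i hi => by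
            have := congrFun (LinearMap.mem_ker.1 hg) ⟨⟨z, hz⟩, ⟨i, hi⟩⟩
            rwa [hΦ] at this)
          exact Submodule.mem_span_singleton.2 ⟨c, Subtype.ext hc.symm⟩
        exact (Submodule.finrank_mono hle1).trans
          (finrank_span_singleton fun h => hf0 (congrArg Subtype.val h)).le
      omega
    obtain ⟨g, hgV, hgZ, hgf⟩ := hg
    obtain ⟨C, hC⟩ := hγ.exists_forall_abs_le (isCompact_Icc (a := 0) (b := s₀)) hIcc
      (f := f) (g := g) (by
        intro z hz
        by_cases hzf : γ z f = 0
        · have hzZ := (hZ z).2 ⟨hz, hzf⟩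
          exact ⟨μ z, (hμ z (hZε z hzZ)).1, (hμ z (hZε z hzZ)).2, hgZ z hzZ⟩
        · exact ⟨0, fun i hi => absurd hi (Nat.not_lt_zero i), hzf,
            fun i hi => absurd hi (Nat.not_lt_zero i)⟩)
    -- Chosen so that `|δ g| ≤ f` on the arc; `+ 1` avoids division by zero.
    let δ : ℝ := 1 / (|C| + 1)
    have hδ : 0 < δ := by positivity
    have hδC : ∀ s ∈ Set.Icc 0 s₀, |γ s (δ • g)| ≤ γ s f := by
      intro s hs
      rw [map_smul, smul_eq_mul, abs_mul, abs_of_pos hδ]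
      have h2 := hC s hs
      rw [abs_of_nonneg (hpos s hs)] at h2
      have h3 : |γ s g| ≤ (|C| + 1) * γ s f :=
        h2.trans (mul_le_mul_of_nonneg_right (by linarith [le_abs_self C]) (hpos s hs))
      calc δ * |γ s g| ≤ δ * ((|C| + 1) * γ s f) := mul_le_mul_of_nonneg_left h3 hδ.le
        _ = γ s f := by simp only [δ]; field_simp
    obtain ⟨c, hc⟩ := hext (δ • g) (V.smul_mem δ hgV)
      (fun s hs => by linarith [neg_le_of_abs_le (hδC s hs)])
      (fun s hs => by linarith [le_of_abs_le (hδC s hs)])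
    refine hgf (δ⁻¹ * c) ?_
    rw [mul_smul, ← hc, smul_smul, inv_mul_cancel₀ hδ.ne', one_smul]
  refine ⟨?_, Z, μ, hZ, fun z hz => hμ z (hZε z hz), heq⟩
  rw [← heq]
  refine Finset.even_sum _ fun z hz => ?_
  have hz' := hint z ((hZ z).1 hz).1 ((hZ z).1 hz).2
  refine hγ.even_of_nonneg (hIcc (Set.Ioo_subset_Icc_self hz')) (hμ z (hZε z hz)).1
    (hμ z (hZε z hz)).2 ?_
  filter_upwards [isOpen_Ioo.mem_nhds hz'] with s hs
  exact hpos s (Set.Ioo_subset_Icc_self hs)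

end RealAnalysis

end AffineCurve

/-! ### The zero count as a first-order statement. -/

namespace RealClosed

section ExtremalZeros

universe v₁ v₂

/-- Let `val j i` be the `i`-th derivative of the `j`-th basis element of a space of functions on `S`.
Every extremal nonnegative function in that space for which the functionals with coefficients `e₀`
and `e₁` do not vanish has finitely many zeros on `S`, and `n` of them when counted with
multiplicities, where `n` is even. -/
def ExtremalZeros (n : ℕ) {P K : Type*} [Field K] [LinearOrder K] (S : Set P)
    (val : Fin (n + 1) → ℕ → P → K) (e₀ e₁ : Fin (n + 1) → K) : Prop :=
  ∀ c : Fin (n + 1) → K, c ≠ 0 → (∀ p ∈ S, 0 ≤ ∑ j, c j * val j 0 p) →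
    (∀ d : Fin (n + 1) → K, (∀ p ∈ S, 0 ≤ ∑ j, c j * val j 0 p + ∑ j, d j * val j 0 p) →
      (∀ p ∈ S, 0 ≤ ∑ j, c j * val j 0 p - ∑ j, d j * val j 0 p) →
      ∀ i j, d i * c j = d j * c i) →
    ∑ j, c j * e₀ j ≠ 0 → ∑ j, c j * e₁ j ≠ 0 →
    Even n ∧ ∃ (k : Fin (n + 1)) (μ : Fin k → Fin (n + 1)), ∑ a, (μ a : ℕ) = n ∧
      ∃ z : Fin k → P, (∀ a b, z a = z b → a = b) ∧ (∀ a, z a ∈ S) ∧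
        (∀ a, ∑ j, c j * val j 0 (z a) = 0) ∧
        (∀ a, (∀ i : Fin (μ a), ∑ j, c j * val j i (z a) = 0) ∧
          ∑ j, c j * val j (μ a) (z a) ≠ 0) ∧
        ∀ w ∈ S, ∑ j, c j * val j 0 w = 0 → ∃ a, w = z a

/-- Points enter only through the values of `val`, so the statement can be moved between parameters,
points of the curve and coordinate tuples. -/
theorem ExtremalZeros.of_bijOn {n : ℕ} {P P' K : Type*} [Field K] [LinearOrder K] {S : Set P}
    {S' : Set P'} {val : Fin (n + 1) → ℕ → P → K} {val' : Fin (n + 1) → ℕ → P' → K}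
    {e₀ e₁ : Fin (n + 1) → K} (h : ExtremalZeros n S val e₀ e₁) {g : P → P'}
    (hg : Set.BijOn g S S') (hval : ∀ p ∈ S, ∀ j i, val' j i (g p) = val j i p) :
    ExtremalZeros n S' val' e₀ e₁ := by
  have hF : ∀ p ∈ S, ∀ (c : Fin (n + 1) → K) i,
      ∑ j, c j * val' j i (g p) = ∑ j, c j * val j i p := fun p hp c i =>
    Finset.sum_congr rfl fun j _ => by rw [hval p hp]
  intro c hc hpos hext h₀ h₁
  obtain ⟨hn, k, μ, hμ, z, hz, hzS, hz0, hzμ, hzall⟩ := h c hc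
    (fun p hp => hF p hp c 0 ▸ hpos _ (hg.mapsTo hp))
    (fun d hd hd' => hext d
      (fun p' hp' => by
        obtain ⟨p, hp, rfl⟩ := hg.surjOn hp'
        rw [hF p hp, hF p hp]
        exact hd p hp)
      (fun p' hp' => by
        obtain ⟨p, hp, rfl⟩ := hg.surjOn hp'
        rw [hF p hp, hF p hp]
        exact hd' p hp)) h₀ h₁
  refine ⟨hn, k, μ, hμ, fun a => g (z a), fun a b hab => hz a b (hg.injOn (hzS a) (hzS b) hab),
    fun a => hg.mapsTo (hzS a), fun a => by rw [hF _ (hzS a), hz0], fun a => ⟨fun i => ?_, ?_⟩, ?_⟩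
  · rw [hF _ (hzS a), (hzμ a).1]
  · rw [hF _ (hzS a)]
    exact (hzμ a).2
  · intro w hw hw0
    obtain ⟨p, hp, rfl⟩ := hg.surjOn hw
    rw [hF p hp] at hw0
    obtain ⟨a, rfl⟩ := hzall p hp hw0
    exact ⟨a, rfl⟩

variable {K₁ : Type v₁} [Field K₁] [LinearOrder K₁] [IsStrictOrderedRing K₁] [IsRealClosed K₁]
variable {K₂ : Type v₂} [Field K₂] [LinearOrder K₂] [IsStrictOrderedRing K₂] [IsRealClosed K₂]
variable {k : Type} [CommRing k] {ι σ : Type}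

theorem isTerm_sum_mul_eval₂ {l : ℕ} (p : Fin l → MvPolynomial σ k) (f : Fin l → ι) (g : σ → ι) :
    IsTerm (fun φ x => (∑ j, x (f j) * (p j).eval₂ φ fun s => x (g s) : K₁))
      (fun φ x => (∑ j, x (f j) * (p j).eval₂ φ fun s => x (g s) : K₂)) :=
  IsTerm.sum _ fun j => (IsTerm.var (f j)).mul (IsTerm.eval₂ g (p j))

theorem isTerm_sum_mul_const {l : ℕ} (e : Fin l → k) (f : Fin l → ι) :
    IsTerm (fun φ x => (∑ j, x (f j) * φ (e j) : K₁))
      (fun φ x => (∑ j, x (f j) * φ (e j) : K₂)) :=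
  IsTerm.sum _ fun j => (IsTerm.var (f j)).mul (IsTerm.const (e j))

variable [Algebra ℚ k]

/-- The number of zeros and their multiplicities range over `Fin (n + 1)`, so they give finite
disjunctions. Proportionality is expressed by 2 × 2 minors, and all other quantifiers run over
tuples of field elements. -/
theorem definable_extremalZeros [Finite σ] (n : ℕ) {S₁ : (k →+* K₁) → Set (σ → K₁)}
    {S₂ : (k →+* K₂) → Set (σ → K₂)}
    (hS : Definable (fun φ z => z ∈ S₁ φ) (fun φ z => z ∈ S₂ φ))
    (p : Fin (n + 1) → ℕ → MvPolynomial σ k) (e₀ e₁ : Fin (n + 1) → k) :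
    Definable (ι := Empty)
      (fun φ _ => ExtremalZeros n (S₁ φ) (fun j i z => (p j i).eval₂ φ z)
        (fun j => φ (e₀ j)) (fun j => φ (e₁ j)))
      (fun φ _ => ExtremalZeros n (S₂ φ) (fun j i z => (p j i).eval₂ φ z)
        (fun j => φ (e₀ j)) (fun j => φ (e₁ j))) := by
  unfold ExtremalZeros
  refine .forall_tuple _ (.imp ?_ (.imp ?_ (.imp ?_ (.imp ?_ (.imp ?_ (.and (.const _)
    (.exists_finite fun N => .exists_finite fun μ => .and (.const _) ?_)))))))
  · exact (Definable.forall_finite fun j => Definable.eq_zero (IsTerm.var (Sum.inr j))).not.congr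
      (fun _ _ => by rw [ne_eq, funext_iff]; rfl) (fun _ _ => by rw [ne_eq, funext_iff]; rfl)
  · exact .forall_tuple σ (.imp (hS.reindex Sum.inr)
      (.nonneg (isTerm_sum_mul_eval₂ (fun j => p j 0) (fun j => Sum.inl (Sum.inr j)) Sum.inr)))
  · refine .forall_tuple _ (.imp ?_ (.imp ?_ ?_))
    · exact .forall_tuple σ (.imp (hS.reindex Sum.inr)
        (.nonneg ((isTerm_sum_mul_eval₂ (fun j => p j 0) (fun j => Sum.inl (Sum.inl (Sum.inr j))) Sum.inr).add
          (isTerm_sum_mul_eval₂ (fun j => p j 0) (fun j => Sum.inl (Sum.inr j)) Sum.inr))))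
    · exact .forall_tuple σ (.imp (hS.reindex Sum.inr)
        (.nonneg ((isTerm_sum_mul_eval₂ (fun j => p j 0) (fun j => Sum.inl (Sum.inl (Sum.inr j))) Sum.inr).sub
          (isTerm_sum_mul_eval₂ (fun j => p j 0) (fun j => Sum.inl (Sum.inr j)) Sum.inr))))
    · exact .forall_finite fun i => .forall_finite fun j =>
        .eq ((IsTerm.var (Sum.inr i)).mul (IsTerm.var (Sum.inl (Sum.inr j))))
          ((IsTerm.var (Sum.inr j)).mul (IsTerm.var (Sum.inl (Sum.inr i))))
  · exact .not (.eq_zero (isTerm_sum_mul_const e₀ Sum.inr))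
  · exact .not (.eq_zero (isTerm_sum_mul_const e₁ Sum.inr))
  · refine (Definable.exists_tuple (Fin N × σ)
      (P₁ := fun φ x z => (∀ a b, (∀ s, z (a, s) = z (b, s)) → a = b) ∧
        (∀ a, (fun s => z (a, s)) ∈ S₁ φ) ∧
        (∀ a, ∑ j, x (.inr j) * (p j 0).eval₂ φ (fun s => z (a, s)) = 0) ∧
        (∀ a, (∀ i : Fin (μ a), ∑ j, x (.inr j) * (p j i).eval₂ φ (fun s => z (a, s)) = 0) ∧
          ¬ ∑ j, x (.inr j) * (p j (μ a)).eval₂ φ (fun s => z (a, s)) = 0) ∧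
        ∀ w : σ → K₁, w ∈ S₁ φ → ∑ j, x (.inr j) * (p j 0).eval₂ φ w = 0 →
          ∃ a, ∀ s, w s = z (a, s))
      (P₂ := fun φ x z => (∀ a b, (∀ s, z (a, s) = z (b, s)) → a = b) ∧
        (∀ a, (fun s => z (a, s)) ∈ S₂ φ) ∧
        (∀ a, ∑ j, x (.inr j) * (p j 0).eval₂ φ (fun s => z (a, s)) = 0) ∧
        (∀ a, (∀ i : Fin (μ a), ∑ j, x (.inr j) * (p j i).eval₂ φ (fun s => z (a, s)) = 0) ∧
          ¬ ∑ j, x (.inr j) * (p j (μ a)).eval₂ φ (fun s => z (a, s)) = 0) ∧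
        ∀ w : σ → K₂, w ∈ S₂ φ → ∑ j, x (.inr j) * (p j 0).eval₂ φ w = 0 →
          ∃ a, ∀ s, w s = z (a, s)) ?_).congr (fun φ x => ?_) (fun φ x => ?_)
    · refine .and ?_ (.and ?_ (.and ?_ (.and ?_ ?_)))
      · exact .forall_finite fun a => .forall_finite fun b => .imp (.forall_finite fun s =>
          .eq (IsTerm.var (Sum.inr (a, s))) (IsTerm.var (Sum.inr (b, s)))) (.const _)
      · exact .forall_finite fun a => hS.reindex fun s => Sum.inr (a, s)
      · exact .forall_finite fun a => .eq_zero
          (isTerm_sum_mul_eval₂ (fun j => p j 0) (fun j => Sum.inl (Sum.inr j)) fun s => Sum.inr (a, s))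
      · exact .forall_finite fun a => .and
          (.forall_finite fun i => .eq_zero
            (isTerm_sum_mul_eval₂ (fun j => p j i) (fun j => Sum.inl (Sum.inr j)) fun s => Sum.inr (a, s)))
          (.not (.eq_zero
            (isTerm_sum_mul_eval₂ (fun j => p j (μ a)) (fun j => Sum.inl (Sum.inr j)) fun s => Sum.inr (a, s))))
      · exact .forall_tuple σ (.imp (hS.reindex Sum.inr) (.imp
          (.eq_zero (isTerm_sum_mul_eval₂ (fun j => p j 0) (fun j => Sum.inl (Sum.inl (Sum.inr j))) Sum.inr))
          (.exists_finite fun a => .forall_finite fun s =>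
            .eq (IsTerm.var (Sum.inr s)) (IsTerm.var (Sum.inl (Sum.inr (a, s)))))))
    all_goals
      exact ⟨fun ⟨z, h1, h2, h3, h4, h5⟩ => ⟨fun q => z q.1 q.2, fun a b h => h1 a b (funext h),
          h2, h3, h4, fun w hw hw0 => (h5 w hw hw0).imp fun a h => congrFun h⟩,
        fun ⟨z, h1, h2, h3, h4, h5⟩ => ⟨fun a s => z (a, s), fun a b h => h1 a b (congrFun h),
          h2, h3, h4, fun w hw hw0 => (h5 w hw hw0).imp fun a h => funext h⟩⟩

end ExtremalZeros

end RealClosed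

/-! ### Points as coordinate tuples, and transfer on the curve. -/

namespace AffineCurve

section Coordinates

universe u v₁ v₂

open RealClosed

variable {A : Type u} [CommRing A] [Algebra ℝ A] {σ : Type}

/-- The truth value at a tuple of coordinates of a formula whose atoms are lifted to polynomials
along `ρ`. -/
def SemialgFormula.HoldsAt (ρ : A → MvPolynomial σ ℝ) {K : Type*} [Field K] [LinearOrder K]
    (φ : ℝ →+* K) (z : σ → K) : SemialgFormula A → Prop
  | .pos a => 0 < (ρ a).eval₂ φ z
  | .not Φ => ¬ Φ.HoldsAt ρ φ z
  | .and Φ Ψ => Φ.HoldsAt ρ φ z ∧ Ψ.HoldsAt ρ φ z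

/-- The set of coordinate tuples of points at which the formula `Φ` holds, on the variety
with equations `G`. -/
def formulaSet (ρ : A → MvPolynomial σ ℝ) (G : Finset (MvPolynomial σ ℝ)) (Φ : SemialgFormula A)
    {K : Type*} [Field K] [LinearOrder K] (φ : ℝ →+* K) : Set (σ → K) :=
  {z | (∀ g : G, (g : MvPolynomial σ ℝ).eval₂ φ z = 0) ∧ Φ.HoldsAt ρ φ z}

theorem definable_formulaSet (ρ : A → MvPolynomial σ ℝ) (G : Finset (MvPolynomial σ ℝ))
    (Φ : SemialgFormula A)
    {K₁ : Type v₁} [Field K₁] [LinearOrder K₁] [IsStrictOrderedRing K₁]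
    {K₂ : Type v₂} [Field K₂] [LinearOrder K₂] [IsStrictOrderedRing K₂] :
    Definable (k := ℝ) (fun φ (z : σ → K₁) => z ∈ formulaSet ρ G Φ φ)
      (fun φ (z : σ → K₂) => z ∈ formulaSet ρ G Φ φ) := by
  refine .and (.forall_finite fun g => .eq_zero (IsTerm.eval₂ id (g : MvPolynomial σ ℝ))) ?_
  induction Φ with
  | pos a => exact .pos (IsTerm.eval₂ id (ρ a))
  | not Φ ih => exact .not ih
  | and Φ Ψ ih ih' => exact .and ih ih'

variable {π : MvPolynomial σ ℝ →ₐ[ℝ] A}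

/-- The tuple of coordinates of a point. -/
def coords (π : MvPolynomial σ ℝ →ₐ[ℝ] A) {K : Type*} [Field K] [Algebra ℝ K] (η : A →ₐ[ℝ] K)
    (i : σ) : K := η (π (.X i))

theorem eval₂_coords {K : Type*} [Field K] [Algebra ℝ K] (η : A →ₐ[ℝ] K) (p : MvPolynomial σ ℝ) :
    p.eval₂ (algebraMap ℝ K) (coords π η) = η (π p) :=
  (congrArg (fun g => g p) (MvPolynomial.aeval_unique (η.comp π))).symm

theorem bijOn_coords (hπ : Function.Surjective π) {ρ : A → MvPolynomial σ ℝ}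
    (hρ : Function.RightInverse ρ π) {G : Finset (MvPolynomial σ ℝ)}
    (hG : Ideal.span (G : Set (MvPolynomial σ ℝ)) = RingHom.ker π) (Φ : SemialgFormula A)
    {K : Type*} [Field K] [LinearOrder K] [IsStrictOrderedRing K] [Algebra ℝ K] :
    Set.BijOn (coords π) {η : A →ₐ[ℝ] K | Φ.Holds η} (formulaSet ρ G Φ (algebraMap ℝ K)) := by
  have hΦ : ∀ η : A →ₐ[ℝ] K, Φ.HoldsAt ρ (algebraMap ℝ K) (coords π η) ↔ Φ.Holds η := by
    intro η
    induction Φ with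
    | pos a =>
      change 0 < (ρ a).eval₂ _ _ ↔ 0 < η a
      rw [eval₂_coords, hρ a]
    | not Φ ih => exact not_congr ih
    | and Φ Ψ ih ih' => exact and_congr ih ih'
  refine ⟨fun η hη => ⟨fun g => ?_, (hΦ η).2 hη⟩, fun η _ η' _ h => ?_, fun z hz => ?_⟩
  · have hg : (g : MvPolynomial σ ℝ) ∈ RingHom.ker π := hG ▸ Ideal.subset_span g.2
    rw [eval₂_coords, (RingHom.mem_ker).1 hg, map_zero]
  · have h1 : η.comp π = η'.comp π := MvPolynomial.algHom_ext fun i => congrFun h i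
    ext a
    obtain ⟨p, rfl⟩ := hπ a
    exact congrArg (fun g => g p) h1
  · have hker : RingHom.ker π ≤ RingHom.ker (MvPolynomial.aeval z : MvPolynomial σ ℝ →ₐ[ℝ] K) := by
      rw [← hG, Ideal.span_le]
      exact fun g hg => hz.1 ⟨g, hg⟩
    obtain ⟨η, rfl⟩ : ∃ η, coords π η = z := ⟨AlgHom.liftOfSurjective π hπ _ hker, funext fun i =>
      (AlgHom.liftOfSurjective_apply π hπ _ hker _).trans (MvPolynomial.aeval_X _ _)⟩
    exact ⟨η, (hΦ η).1 hz.2, rfl⟩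

theorem exists_presentation (A : Type u) [CommRing A] [Algebra ℝ A] [Algebra.FiniteType ℝ A] :
    ∃ (m : ℕ) (π : MvPolynomial (Fin m) ℝ →ₐ[ℝ] A) (G : Finset (MvPolynomial (Fin m) ℝ)),
      Function.Surjective π ∧ Ideal.span (G : Set (MvPolynomial (Fin m) ℝ)) = RingHom.ker π := by
  obtain ⟨m, π, hπ⟩ := Algebra.FiniteType.iff_quotient_mvPolynomial''.1
    (inferInstance : Algebra.FiniteType ℝ A)
  obtain ⟨G, hG⟩ : (RingHom.ker π).FG := (isNoetherianRing_iff_ideal_fg _).1 inferInstance _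
  exact ⟨m, π, G, hπ, hG⟩

/-- Positive reals are squares, so every homomorphism from `ℝ` to an ordered field preserves signs.
-/
theorem sign_algebraMap (R : Type*) [Field R] [LinearOrder R] [IsStrictOrderedRing R]
    [Algebra ℝ R] (c : ℝ) : SignType.sign (algebraMap ℝ ℝ c) = SignType.sign (algebraMap ℝ R c) := by
  have hpos : ∀ c : ℝ, 0 < c → 0 < algebraMap ℝ R c := by
    intro c hc
    rw [← Real.mul_self_sqrt hc.le, map_mul]
    exact mul_self_pos.2 (by simpa using (Real.sqrt_pos.2 hc).ne')
  rw [Algebra.algebraMap_self_apply]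
  rcases lt_trichotomy c 0 with h | rfl | h
  · rw [sign_neg h, sign_neg]
    simpa using hpos (-c) (by linarith)
  · simp
  · rw [sign_pos h, sign_pos (hpos c h)]

variable [Algebra.FiniteType ℝ A]
variable {R : Type v₂} [Field R] [LinearOrder R] [IsStrictOrderedRing R] [IsRealClosed R]
  [Algebra ℝ R]

/-- Inclusion between the two coordinate sets is a first-order sentence with real parameters.
Consequently base extension does not depend on the chosen description. -/
theorem SemialgFormula.holds_of_imp {Φ Ψ : SemialgFormula A}
    (h : ∀ ζ : A →ₐ[ℝ] ℝ, Φ.Holds ζ → Ψ.Holds ζ) (η : A →ₐ[ℝ] R) (hη : Φ.Holds η) : Ψ.Holds η := by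
  obtain ⟨m, π, G, hπ, hG⟩ := exists_presentation A
  have hρ := Function.rightInverse_surjInv hπ
  have := isRealClosed_real
  have htr := (Definable.forall_tuple (Fin m) (ι := Empty)
    (P₁ := fun φ _ z => z ∈ formulaSet (Function.surjInv hπ) G Φ φ →
      z ∈ formulaSet (Function.surjInv hπ) G Ψ φ)
    (P₂ := fun φ _ z => z ∈ formulaSet (Function.surjInv hπ) G Φ φ →
      z ∈ formulaSet (Function.surjInv hπ) G Ψ φ)
    (((definable_formulaSet _ G Φ (K₁ := ℝ) (K₂ := R)).imp
      (definable_formulaSet _ G Ψ)).reindex Sum.inr)).transfer _ _ (sign_algebraMap R)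
  have h1 := htr.1 (fun z hz => by
    obtain ⟨ζ, hζ, rfl⟩ := (bijOn_coords hπ hρ hG Φ).surjOn hz
    exact (bijOn_coords hπ hρ hG Ψ).mapsTo (h ζ hζ)) _ ((bijOn_coords hπ hρ hG Φ).mapsTo hη)
  obtain ⟨η', hη', h2⟩ := (bijOn_coords hπ hρ hG Ψ).surjOn h1
  -- A tautological formula makes the coordinates injective on all points.
  rwa [(bijOn_coords hπ hρ hG (.not (.and Φ (.not Φ)))).injOn
    (fun hc : Φ.Holds η' ∧ ¬ Φ.Holds η' => hc.2 hc.1)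
    (fun hc : Φ.Holds η ∧ ¬ Φ.Holds η => hc.2 hc.1) h2] at hη'

theorem baseExtension_eq {S : Set (A →ₐ[ℝ] ℝ)} {Φ : SemialgFormula A}
    (hΦ : {ζ : A →ₐ[ℝ] ℝ | Φ.Holds ζ} = S) : baseExtension R S = {η | Φ.Holds η} := by
  ext η
  constructor
  · rintro ⟨Ψ, hΨ, hη⟩
    refine Ψ.holds_of_imp (fun ζ hζ => ?_) η hη
    have : ζ ∈ S := hΨ ▸ hζ
    rwa [← hΦ] at this
  · exact fun hη => ⟨Φ, hΦ, hη⟩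

theorem extremalZeros_transfer (D : A → A) {n : ℕ} (v : Fin (n + 1) → A) (Φ : SemialgFormula A)
    (ζ₀ ζ₁ : A →ₐ[ℝ] ℝ)
    (h : ExtremalZeros n {ζ : A →ₐ[ℝ] ℝ | Φ.Holds ζ} (fun j i ζ => ζ (D^[i] (v j)))
      (fun j => ζ₀ (v j)) (fun j => ζ₁ (v j))) :
    ExtremalZeros n {η : A →ₐ[ℝ] R | Φ.Holds η} (fun j i η => η (D^[i] (v j)))
      (fun j => algebraMap ℝ R (ζ₀ (v j))) (fun j => algebraMap ℝ R (ζ₁ (v j))) := by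
  obtain ⟨m, π, G, hπ, hG⟩ := exists_presentation A
  have hρ := Function.rightInverse_surjInv hπ
  have := isRealClosed_real
  have htr := (definable_extremalZeros n
    (definable_formulaSet (Function.surjInv hπ) G Φ (K₁ := ℝ) (K₂ := R))
    (fun j i => Function.surjInv hπ (D^[i] (v j))) (fun j => ζ₀ (v j))
    (fun j => ζ₁ (v j))).transfer _ _ (sign_algebraMap R)
  have h1 := htr.1 (h.of_bijOn (bijOn_coords hπ hρ hG Φ) (fun ζ _ j i => by
    rw [eval₂_coords, hρ]))
  have hb := bijOn_coords hπ hρ hG Φ (K := R)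
  have : Nonempty (A →ₐ[ℝ] R) := ⟨extendPoint R ζ₀⟩
  refine h1.of_bijOn (g := Function.invFunOn (coords π) {η : A →ₐ[ℝ] R | Φ.Holds η})
    (hb.symm hb.invOn_invFunOn.symm) (fun z hz j i => ?_)
  obtain ⟨η, hη, rfl⟩ := hb.surjOn hz
  rw [hb.invOn_invFunOn.1 hη, eval₂_coords, hρ]

end Coordinates

end AffineCurve

/-! ### Extreme rays and their zeros. -/

namespace AffineCurve

section Extremal

open RealClosed

variable {A : Type*} [CommRing A] [Algebra ℝ A] {D : Derivation ℝ A A} {n : ℕ}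
  {V : Submodule ℝ A}

theorem iterate_derivation_sum {ι : Type*} [Fintype ι] (D : Derivation ℝ A A) (c : ι → ℝ)
    (v : ι → A) (i : ℕ) : D^[i] (∑ j, c j • v j) = ∑ j, c j • D^[i] (v j) := by
  have h : ∀ a, D^[i] a = (D.toLinearMap ^ i) a := fun a => by
    rw [Module.End.pow_apply]
    rfl
  simp only [h, map_sum, map_smul]

/-- Extremal nonnegative functions on a small interval have the expected number of zeros. -/
theorem IsIntegralCurveOfDerivation.extremalZeros {r : ℝ} {γ : ℝ → A →ₐ[ℝ] ℝ}
    (hγ : IsIntegralCurveOfDerivation D r γ) (v : Module.Basis (Fin (n + 1)) ℝ V) {ε : ℝ}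
    (hεr : ε ≤ r)
    (hcheb : ∀ f ∈ V, f ≠ 0 → ∀ (Z : Finset ℝ) (μ : ℝ → ℕ),
      (∀ z ∈ Z, z ∈ Set.Ioo 0 ε ∧ JetVanish D (γ z) (μ z) f) → ∑ z ∈ Z, μ z ≤ n)
    {s₀ : ℝ} (hs₀ : 0 < s₀) (hs₀ε : s₀ < ε) :
    ExtremalZeros n (Set.Icc 0 s₀) (fun j i s => γ s (D^[i] (v j : A)))
      (fun j => γ 0 (v j : A)) (fun j => γ s₀ (v j : A)) := by
  intro c hc hpos hext h₀ h₁
  have hV : Module.finrank ℝ V = n + 1 := by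
    rw [Module.finrank_eq_card_basis v, Fintype.card_fin]
  have hval : ∀ (d : Fin (n + 1) → ℝ) (ζ : A →ₐ[ℝ] ℝ) (i : ℕ),
      ∑ j, d j * ζ (D^[i] (v j : A)) = ζ (D^[i] (∑ j, d j • (v j : A))) := by
    intro d ζ i
    rw [iterate_derivation_sum, map_sum]
    simp
  have hval₀ : ∀ (d : Fin (n + 1) → ℝ) (ζ : A →ₐ[ℝ] ℝ),
      ∑ j, d j * ζ (v j : A) = ζ (∑ j, d j • (v j : A)) := fun d ζ => hval d ζ 0
  simp only [Function.iterate_zero, id, hval₀] at hpos hext h₀ h₁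
  have hmem : ∀ d : Fin (n + 1) → ℝ, ∑ j, d j • (v j : A) ∈ V := fun d =>
    V.sum_mem fun j _ => V.smul_mem _ (v j).2
  obtain ⟨j₀, hj₀⟩ := Function.ne_iff.1 hc
  obtain ⟨hn, Z, μ, hZ, hμ, hsum⟩ := hγ.exists_zeros_of_extremal hV hεr hcheb hs₀ hs₀ε (hmem c)
    (fun h => h₀ (by rw [h, map_zero])) hpos (by
      intro g hg hg₁ hg₂
      have hgd : ∑ j, v.repr ⟨g, hg⟩ j • (v j : A) = g := by
        have := congrArg V.subtype (v.sum_repr ⟨g, hg⟩)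
        simpa only [map_sum, map_smul, Submodule.subtype_apply] using this
      have hd := hext (fun j => v.repr ⟨g, hg⟩ j) (by rwa [hgd]) (by rwa [hgd])
      -- The factor is read off at a coordinate where `c` is nonzero.
      refine ⟨v.repr ⟨g, hg⟩ j₀ / c j₀, ?_⟩
      conv_lhs => rw [← hgd]
      rw [Finset.smul_sum]
      refine Finset.sum_congr rfl fun j _ => ?_
      rw [smul_smul, div_mul_eq_mul_div, ← hd j j₀, mul_div_cancel_right₀ _ hj₀]) h₀ h₁
  have hpos' : ∀ z ∈ Z, 1 ≤ μ z := by
    intro z hz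
    by_contra hlt
    have h0 : μ z = 0 := by omega
    have := (hμ z hz).2
    rw [h0] at this
    exact this ((hZ z).1 hz).2
  have hcard : Z.card ≤ n := by
    rw [← hsum, Finset.card_eq_sum_ones]
    exact Finset.sum_le_sum hpos'
  have hμn : ∀ z ∈ Z, μ z ≤ n := fun z hz => by
    rw [← hsum]
    exact Finset.single_le_sum (fun _ _ => Nat.zero_le _) hz
  let e := Z.equivFin.symm
  refine ⟨hn, ⟨Z.card, Nat.lt_succ_of_le hcard⟩,
    fun a => ⟨μ (e a), Nat.lt_succ_of_le (hμn _ (e a).2)⟩, ?_, fun a => e a,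
    fun a b hab => e.injective (Subtype.ext hab), fun a => ((hZ _).1 (e a).2).1, fun a => ?_,
    fun a => ⟨fun i => ?_, ?_⟩, fun w hw hw0 => ?_⟩
  · rw [e.sum_comp (fun z : Z => μ z), Finset.sum_coe_sort Z μ, hsum]
  · rw [hval]
    exact ((hZ _).1 (e a).2).2
  · rw [hval]
    exact (hμ _ (e a).2).1 i i.2
  · rw [hval]
    exact (hμ _ (e a).2).2
  · rw [hval] at hw0
    exact ⟨e.symm ⟨w, (hZ w).2 ⟨hw, hw0⟩⟩, by simp⟩

variable {R : Type*} [Field R] [LinearOrder R] [IsStrictOrderedRing R] [Algebra ℝ R]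

/-- If no formula describes `S`, its base extension is empty and the cone is all of `V_R`. It then
contains `-f` as well as `f`, and no half-line spanned by `f ≠ 0` is a face. -/
theorem exists_formula_of_spansExtremeRay {S : Set (A →ₐ[ℝ] ℝ)} {f : R ⊗[ℝ] A}
    (hf : SpansExtremeRay (nonnegCone R V S) f) :
    ∃ Φ : SemialgFormula A, {ζ : A →ₐ[ℝ] ℝ | Φ.Holds ζ} = S := by
  by_contra hcon
  push Not at hcon
  obtain ⟨hf0, hfP, hface⟩ := hf
  have hmem : -f ∈ nonnegCone R V S :=
    ⟨neg_mem hfP.1, fun η hη => absurd hη.choose_spec.1 (hcon _)⟩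
  have h1 := hface.mem_of_add_mem_left hmem hfP (by rw [neg_add_cancel]; exact zero_mem _)
  obtain ⟨a, ha⟩ := Submodule.mem_span_singleton.1 h1
  have h2 : ((a : R) + 1) • f = 0 := by
    rw [add_smul, one_smul]
    exact eq_neg_iff_add_eq_zero.1 ha
  exact hf0 ((smul_eq_zero.1 h2).resolve_left (by
    have := a.2
    positivity))

/-- The sum of `f + g` and `f - g` is `2 f`, so the face property places `f + g` on the ray. -/
theorem exists_eq_smul_of_spansExtremeRay {S : Set (A →ₐ[ℝ] ℝ)} {f g : R ⊗[ℝ] A}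
    (hf : SpansExtremeRay (nonnegCone R V S) f) (hg : g ∈ V.baseChange R)
    (h₁ : ∀ η ∈ baseExtension R S, 0 ≤ evalAt η f + evalAt η g)
    (h₂ : ∀ η ∈ baseExtension R S, 0 ≤ evalAt η f - evalAt η g) : ∃ a : R, g = a • f := by
  obtain ⟨-, hfP, hface⟩ := hf
  have h3 := hface.mem_of_add_mem_left (x := f + g) (y := f - g)
    ⟨add_mem hfP.1 hg, fun η hη => by rw [map_add]; exact h₁ η hη⟩
    ⟨sub_mem hfP.1 hg, fun η hη => by rw [map_sub]; exact h₂ η hη⟩ (by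
      rw [add_add_sub_cancel]
      have := PointedCone.subset_hull (R := R) (Set.mem_singleton f)
      exact add_mem this this)
  obtain ⟨a, ha⟩ := Submodule.mem_span_singleton.1 h3
  refine ⟨(a : R) - 1, ?_⟩
  rw [sub_smul, one_smul]
  exact eq_sub_of_add_eq' ha.symm

/-- The zeros of a function spanning an extreme ray, over a real closed extension. -/
theorem exists_zeros_of_extremalZeros {t : A} (ht : D t = 1)
    (hD : ∀ a, KaehlerDifferential.D ℝ A a = D a • KaehlerDifferential.D ℝ A t)
    (v : Module.Basis (Fin (n + 1)) ℝ V) {S : Set (A →ₐ[ℝ] ℝ)} {ζ₀ ζ₁ : A →ₐ[ℝ] ℝ}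
    (h : ExtremalZeros n (baseExtension R S) (fun j i η => η (D^[i] (v j : A)))
      (fun j => algebraMap ℝ R (ζ₀ (v j : A))) (fun j => algebraMap ℝ R (ζ₁ (v j : A))))
    {f : R ⊗[ℝ] A} (hf : SpansExtremeRay (nonnegCone R V S) f)
    (h₀ : evalAt (extendPoint R ζ₀) f ≠ 0) (h₁ : evalAt (extendPoint R ζ₁) f ≠ 0) :
    (∃ Z : Finset (A →ₐ[ℝ] R), (∀ η, η ∈ Z ↔ η ∈ baseExtension R S ∧ evalAt η f = 0) ∧
      ∑ η ∈ Z, vanishingOrder η f = (n : ℕ∞)) ∧ Even n := by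
  classical
  -- By flatness `R ⊗ V` embeds into `R ⊗ A`, so coordinates in the extended basis are determined by
  -- the function.
  have hinj : Function.Injective (V.subtype.baseChange R) :=
    Module.Flat.lTensor_preserves_injective_linearMap _ V.injective_subtype
  let b := v.baseChange R
  let ℓ : (Fin (n + 1) → R) → R ⊗[ℝ] A := fun c => ∑ j, c j ⊗ₜ (v j : A)
  have hℓ : ∀ c, ℓ c = V.subtype.baseChange R (∑ j, c j • b j) := by
    intro c
    simp [ℓ, b, map_sum, TensorProduct.smul_tmul']
  have hℓV : ∀ c, ℓ c ∈ V.baseChange R := fun c => ⟨_, (hℓ c).symm⟩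
  have hval : ∀ c (η : A →ₐ[ℝ] R) (i : ℕ), ∑ j, c j * η (D^[i] (v j : A)) =
      evalAt η ((baseChangeDerivation R D)^[i] (ℓ c)) := by
    intro c η i
    have h : ∀ a, (baseChangeDerivation R D)^[i] a =
        ((baseChangeDerivation R D).toLinearMap ^ i) a := fun a => by
      rw [Module.End.pow_apply]
      rfl
    rw [h, map_sum, map_sum]
    refine Finset.sum_congr rfl fun j _ => ?_
    rw [← h, iterate_baseChangeDerivation_tmul, evalAt_tmul]
  have hval₀ : ∀ c (η : A →ₐ[ℝ] R), ∑ j, c j * η (v j : A) = evalAt η (ℓ c) :=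
    fun c η => hval c η 0
  obtain ⟨c, rfl⟩ : ∃ c, ℓ c = f := by
    obtain ⟨f', rfl⟩ := hf.2.1.1
    exact ⟨b.repr f', by rw [hℓ, b.sum_repr]⟩
  obtain ⟨hn, k, μ, hμ, z, hz, hzS, hz0, hzμ, hzall⟩ := h c
    (fun hc => hf.1 (by rw [hℓ, hc]; simp))
    (fun η hη => by
      rw [hval]
      exact hf.2.1.2 η hη)
    (fun d hd hd' => by
      simp only [hval] at hd hd'
      obtain ⟨a, ha⟩ := exists_eq_smul_of_spansExtremeRay hf (hℓV d) hd hd'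
      rw [hℓ, hℓ, ← map_smul] at ha
      have h2 := hinj ha
      rw [Finset.smul_sum] at h2
      have h3 : ∀ i, d i = a * c i := by
        intro i
        have := congrArg (fun x => b.repr x i) h2
        simpa [Finsupp.single_apply] using this
      intro i j
      rw [h3, h3]
      ring)
    (by
      have := hval₀ c (extendPoint R ζ₀)
      exact fun h => h₀ (this ▸ h))
    (by
      have := hval₀ c (extendPoint R ζ₁)
      exact fun h => h₁ (this ▸ h))
  have hval0 : ∀ c (η : A →ₐ[ℝ] R), ∑ j, c j * η (D^[0] (v j : A)) = evalAt η (ℓ c) :=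
    hval₀
  simp only [hval0] at hz0 hzall
  refine ⟨⟨Finset.univ.image z, fun η => ?_, ?_⟩, hn⟩
  · rw [Finset.mem_image]
    constructor
    · rintro ⟨a, -, rfl⟩
      exact ⟨hzS a, hz0 a⟩
    · rintro ⟨hη, hη0⟩
      obtain ⟨a, rfl⟩ := hzall η hη hη0
      exact ⟨a, Finset.mem_univ a, rfl⟩
  · rw [Finset.sum_image (fun a _ b _ hab => hz a b hab)]
    refine Eq.trans ?_ (congrArg Nat.cast hμ)
    rw [Nat.cast_sum]
    refine Finset.sum_congr rfl fun a _ => vanishingOrder_eq ht hD (z a) (fun i hi => ?_) ?_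
    · rw [← hval]
      exact (hzμ a).1 ⟨i, hi⟩
    · rw [← hval]
      exact (hzμ a).2

end Extremal

end AffineCurve

/-! ### Intervals on the positive side as arcs of the integral curve. -/

namespace AffineCurve

section Geometry

open Filter Topology

variable {A : Type*} [CommRing A] [Algebra ℝ A] {D : Derivation ℝ A A}

theorem exists_derivation {t : A} (hΩ : ∃ b : Module.Basis Unit A (Ω[A⁄ℝ]),
    b () = KaehlerDifferential.D ℝ A t) : ∃ D : Derivation ℝ A A, D t = 1 ∧
      ∀ a, KaehlerDifferential.D ℝ A a = D a • KaehlerDifferential.D ℝ A t := by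
  obtain ⟨b, hb⟩ := hΩ
  refine ⟨(b.coord ()).compDer (KaehlerDifferential.D ℝ A), ?_, fun a => ?_⟩
  · change b.repr (KaehlerDifferential.D ℝ A t) () = 1
    rw [← hb, b.repr_self, Finsupp.single_eq_same]
  · change _ = b.repr (KaehlerDifferential.D ℝ A a) () • _
    rw [← hb]
    conv_lhs => rw [← b.sum_repr (KaehlerDifferential.D ℝ A a)]
    simp

/-- An element all of whose derivatives vanish at `ξ` lies in every power of the maximal ideal,
hence is zero by Krull's intersection theorem. -/
theorem exists_iterate_ne_zero [IsDomain A] [IsNoetherianRing A] {ξ : A →ₐ[ℝ] ℝ} {t : A}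
    (hξ : maxIdealAt ξ = Ideal.span {t}) (ht : D t = 1) {f : A} (hf : f ≠ 0) :
    ∃ i, ξ (D^[i] f) ≠ 0 := by
  by_contra hcon
  push Not at hcon
  have hξt : ξ t = 0 := by
    have : t ∈ maxIdealAt ξ := hξ ▸ Ideal.mem_span_singleton_self t
    exact this
  have hmem : f ∈ ⨅ k : ℕ, RingHom.ker ξ ^ k := by
    rw [Ideal.mem_iInf]
    intro k
    rw [mem_ker_pow_iff hξt ht (hξ.le.trans le_sup_left)]
    exact fun i _ => hcon i
  rw [Ideal.iInf_pow_eq_bot_of_isDomain _ (RingHom.ker_ne_top ξ)] at hmem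
  exact hf hmem

variable {r : ℝ} {γ : ℝ → A →ₐ[ℝ] ℝ} {t : A}

theorem continuous_eval_real (a : A) : Continuous fun ζ : A →ₐ[ℝ] ℝ => ζ a :=
  (continuous_apply a).comp continuous_induced_dom

theorem IsIntegralCurveOfDerivation.apply_parameter (hγ : IsIntegralCurveOfDerivation D r γ)
    (ht : D t = 1) (h0 : γ 0 t = 0) {s : ℝ} (hs : s ∈ Set.Ioo (-r) r) : γ s t = s := by
  have hr : 0 < r := by linarith [hs.1.trans hs.2]
  obtain ⟨w, -, h⟩ := hγ.exists_lagrange (z := 0) ⟨by linarith, hr⟩ 1 (f := t)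
    (fun i hi => by
      obtain rfl : i = 0 := by omega
      exact h0) hs
  simpa [ht] using h

theorem IsIntegralCurveOfDerivation.continuousAt (hγ : IsIntegralCurveOfDerivation D r γ)
    {s : ℝ} (hs : s ∈ Set.Ioo (-r) r) : ContinuousAt γ s := by
  rw [(Topology.IsInducing.mk rfl : Topology.IsInducing
    (fun ζ : A →ₐ[ℝ] ℝ => (fun a => ζ a : A → ℝ))).continuousAt_iff, continuousAt_pi]
  exact fun a => (hγ s hs a).continuousAt

theorem IsIntegralCurveOfDerivation.injOn (hγ : IsIntegralCurveOfDerivation D r γ)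
    (ht : D t = 1) (h0 : γ 0 t = 0) : Set.InjOn γ (Set.Ioo (-r) r) := by
  intro s hs s' hs' h
  rw [← hγ.apply_parameter ht h0 hs, ← hγ.apply_parameter ht h0 hs', h]

theorem IsIntegralCurveOfDerivation.isPositiveInterval (hγ : IsIntegralCurveOfDerivation D r γ)
    (ht : D t = 1) (hξ : maxIdealAt (γ 0) = Ideal.span {t}) {s₀ : ℝ} (hs₀ : 0 < s₀) (hs₀r : s₀ < r) :
    IsPositiveInterval (γ 0) t (γ '' Set.Icc 0 s₀) := by
  have h0 : γ 0 t = 0 := by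
    have : t ∈ maxIdealAt (γ 0) := hξ ▸ Ideal.mem_span_singleton_self t
    exact this
  have hsub : Set.Icc 0 s₀ ⊆ Set.Ioo (-r) r := fun s hs =>
    ⟨by linarith [hs.1], hs.2.trans_lt hs₀r⟩
  have hcont : ContinuousOn γ (Set.Icc 0 s₀) := fun s hs =>
    (hγ.continuousAt (hsub hs)).continuousWithinAt
  have hl : (0 : ℝ) ∈ Set.Icc 0 s₀ := Set.left_mem_Icc.2 hs₀.le
  have hr : s₀ ∈ Set.Icc 0 s₀ := Set.right_mem_Icc.2 hs₀.le
  refine ⟨isCompact_Icc.image_of_continuousOn hcont, (isConnected_Icc hs₀.le).image γ hcont,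
    Set.mem_image_of_mem γ hl, ?_, t, ?_, ⟨1, 1, by simp, by simp, rfl⟩, ?_⟩
  · exact ⟨γ 0, Set.mem_image_of_mem γ hl, γ s₀, Set.mem_image_of_mem γ hr, fun h =>
      hs₀.ne (hγ.injOn ht h0 (hsub hl) (hsub hr) h)⟩
  · refine (order_eq (k := 1) h0 ht (hξ.le.trans le_sup_left) (fun i hi => ?_) ?_).trans
      Nat.cast_one
    · obtain rfl : i = 0 := by omega
      exact h0
    · simp [ht]
  · rintro _ ⟨s, hs, rfl⟩
    rw [hγ.apply_parameter ht h0 (hsub hs)]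
    exact hs.1

/-- `t` inverts `γ` on the arc, and `t(S)` is compact, connected, contains `0` and lies in `[0,
s₁]`. -/
theorem IsIntegralCurveOfDerivation.eq_image_Icc (hγ : IsIntegralCurveOfDerivation D r γ)
    (ht : D t = 1) (h0 : γ 0 t = 0) {s₁ : ℝ} (hs₁r : s₁ < r) {S : Set (A →ₐ[ℝ] ℝ)}
    (hS : IsPositiveInterval (γ 0) t S) (hsub : S ⊆ γ '' Set.Icc 0 s₁) :
    ∃ s₀, 0 < s₀ ∧ s₀ ≤ s₁ ∧ S = γ '' Set.Icc 0 s₀ := by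
  obtain ⟨hcomp, hconn, hmem, hnt, -⟩ := hS
  have hpar : ∀ s ∈ Set.Icc 0 s₁, γ s t = s := fun s hs =>
    hγ.apply_parameter ht h0 ⟨by linarith [hs.1, hs.2], hs.2.trans_lt hs₁r⟩
  have heq := eq_Icc_of_connected_compact (hconn.image _ (continuous_eval_real t).continuousOn)
    (hcomp.image (continuous_eval_real t))
  set T := (fun ζ : A →ₐ[ℝ] ℝ => ζ t) '' S
  have hT : T ⊆ Set.Icc 0 s₁ := by
    rintro _ ⟨ζ, hζ, rfl⟩
    obtain ⟨s, hs, rfl⟩ := hsub hζ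
    change γ s t ∈ _
    rwa [hpar s hs]
  have hST : S = γ '' T := by
    ext ζ
    constructor
    · intro hζ
      obtain ⟨s, hs, rfl⟩ := hsub hζ
      exact ⟨s, ⟨_, hζ, hpar s hs⟩, rfl⟩
    · rintro ⟨_, ⟨ζ', hζ', rfl⟩, rfl⟩
      obtain ⟨s, hs, rfl⟩ := hsub hζ'
      change γ (γ s t) ∈ S
      rwa [hpar s hs]
  have h0T : (0 : ℝ) ∈ T := ⟨γ 0, hmem, h0⟩
  have hinf : sInf T = 0 := le_antisymm
    (csInf_le ⟨0, fun s hs => (hT hs).1⟩ h0T) (le_csInf ⟨0, h0T⟩ fun s hs => (hT hs).1)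
  rw [hinf] at heq
  have hsup : sSup T ∈ T := by
    rw [heq] at h0T
    have h1 := Set.right_mem_Icc.2 (h0T.1.trans h0T.2)
    rwa [← heq] at h1
  refine ⟨sSup T, ?_, (hT hsup).2, by rwa [← heq]⟩
  refine lt_of_le_of_ne (hT hsup).1 fun h => ?_
  rw [← h, Set.Icc_self] at heq
  rw [hST, heq, Set.image_singleton] at hnt
  exact Set.not_nontrivial_singleton hnt

/-- If `γ s` were interior to the arc, continuity and injectivity of `γ` would make `s` interior to
`[0, s₀]`. -/
theorem IsIntegralCurveOfDerivation.mem_frontier (hγ : IsIntegralCurveOfDerivation D r γ)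
    (ht : D t = 1) (h0 : γ 0 t = 0) {s₀ s : ℝ} (hs₀r : s₀ < r) (hs : s ∈ Set.Icc 0 s₀)
    (hs' : s ∉ Set.Ioo 0 s₀) : γ s ∈ frontier (γ '' Set.Icc 0 s₀) := by
  refine ⟨subset_closure (Set.mem_image_of_mem γ hs), fun hint => hs' ?_⟩
  have hsr : s ∈ Set.Ioo (-r) r := ⟨by linarith [hs.1, hs.2], hs.2.trans_lt hs₀r⟩
  rw [← interior_Icc, mem_interior_iff_mem_nhds]
  filter_upwards [hγ.continuousAt hsr (mem_interior_iff_mem_nhds.1 hint),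
    isOpen_Ioo.mem_nhds hsr] with s' h1 h2
  obtain ⟨s'', h3, h4⟩ := h1
  rwa [← hγ.injOn ht h0 ⟨by linarith [h3.1, h3.2], h3.2.trans_lt hs₀r⟩ h2 h4]

end Geometry

end AffineCurve

end

theorem proposition7
    -- `A` is the coordinate ring of a non-singular irreducible affine curve `C` over `ℝ`
    {A : Type*} [CommRing A] [IsDedekindDomain A] (hA : ¬ IsField A)
    [Algebra ℝ A] [Algebra.FiniteType ℝ A]
    (n : ℕ) (V : Submodule ℝ A) (hV : Module.finrank ℝ V = n + 1)
    (ξ : A →ₐ[ℝ] ℝ) (t : A)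
    (hξ : AffineCurve.maxIdealAt ξ = Ideal.span {t})
    (hΩ : ∃ b : Module.Basis Unit A (Ω[A⁄ℝ]), b () = KaehlerDifferential.D ℝ A t) :
    ∃ J : Set (A →ₐ[ℝ] ℝ), AffineCurve.IsPositiveInterval ξ t J ∧
      ∀ S : Set (A →ₐ[ℝ] ℝ), AffineCurve.IsPositiveInterval ξ t S → S ⊆ J →
      ∀ (R : Type*) [Field R] [LinearOrder R] [IsStrictOrderedRing R] [IsRealClosed R]
        [Algebra ℝ R] (f : TensorProduct ℝ R A),
        AffineCurve.SpansExtremeRay (AffineCurve.nonnegCone R V S) f →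
        (∀ ζ ∈ frontier S, AffineCurve.evalAt (AffineCurve.extendPoint R ζ) f ≠ 0) →
        (∃ Z : Finset (A →ₐ[ℝ] R),
          (∀ η, η ∈ Z ↔ η ∈ AffineCurve.baseExtension R S ∧ AffineCurve.evalAt η f = 0) ∧
          ∑ η ∈ Z, AffineCurve.vanishingOrder η f = (n : ℕ∞)) ∧
        Even n := by
  obtain ⟨D, ht, hD⟩ := AffineCurve.exists_derivation hΩ
  obtain ⟨r, hr, γ, rfl, hγ'⟩ := AffineCurve.exists_integral_curve D ξ
  have hγ : AffineCurve.IsIntegralCurveOfDerivation D r γ := hγ'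
  have h0 : γ 0 t = 0 := by
    have : t ∈ AffineCurve.maxIdealAt (γ 0) := hξ ▸ Ideal.mem_span_singleton_self t
    exact this
  obtain ⟨ε, hε, hεr, hcheb⟩ := hγ.exists_sum_le hr
    (fun f hf => AffineCurve.exists_iterate_ne_zero hξ ht hf) n V hV
  have hfin : Module.Finite ℝ V := Module.finite_of_finrank_pos (by omega)
  let v := Module.finBasisOfFinrankEq ℝ V hV
  -- Halving `ε` keeps the closed arc, endpoint included, within the range of the Chebyshev bound
  -- and of the integral curve.
  refine ⟨γ '' Set.Icc 0 (ε / 2), hγ.isPositiveInterval ht hξ (by linarith) (by linarith), ?_⟩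
  intro S hS hSJ R _ _ _ _ _ f hf hfr
  obtain ⟨s₀, hs₀, hs₀ε, rfl⟩ := hγ.eq_image_Icc ht h0 (by linarith) hS hSJ
  obtain ⟨Φ, hΦ⟩ := AffineCurve.exists_formula_of_spansExtremeRay hf
  have hsub : Set.Icc 0 s₀ ⊆ Set.Ioo (-r) r := fun s hs =>
    ⟨by linarith [hs.1], by linarith [hs.2]⟩
  have hinj := (hγ.injOn ht h0).mono hsub
  have hext := hγ.extremalZeros v hεr hcheb hs₀ (by linarith)
  have hext' := AffineCurve.extremalZeros_transfer (R := R) D (fun j => (v j : A)) Φ (γ 0) (γ s₀) (by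
    rw [hΦ]
    exact hext.of_bijOn hinj.bijOn_image fun s _ j i => rfl)
  rw [← AffineCurve.baseExtension_eq hΦ] at hext'
  exact AffineCurve.exists_zeros_of_extremalZeros ht hD v hext' hf
    (hfr _ (hγ.mem_frontier ht h0 (by linarith) (Set.left_mem_Icc.2 hs₀.le) (by simp)))
    (hfr _ (hγ.mem_frontier ht h0 (by linarith) (Set.right_mem_Icc.2 hs₀.le) (by simp)))
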